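/- Let $\mathcal X,\mathcal Y_1,\mathcal Y_2,\mathcal Z$ be finite alphabets and let $P_{Y_1Y_2Z|X}$ be a memoryless wiretap broadcast channel with input $X$, legitimate outputs $Y_1,Y_2$ and eavesdropper output $Z$. All information quantities are in bits. An $(M_1,M_2,n)$-code consists of a stochastic encoder, i.e. a conditional p.m.f. $P(x^n|w_1,w_2)$ for $(w_1,w_2)\in\{1,\dots,M_1\}\times\{1,\dots,M_2\}$, and two decoders $y_j^n\mapsto\hat w_j$ ($j=1,2$), each producing a message or declaring an error; the message pair $(W_1,W_2)$ is uniform. A pair $(R_1,R_2)$ with $R_1,R_2\ge 0$ is achievable if there is a sequence of $(M_{1n},M_{2n},n)$-codes with $$\liminf_n \tfrac1n\log_2 M_{jn}\ge R_j\ (j=1,2),\quad \lim_n\mathbb P\big(\hat W_1\ne W_1\text{ or }\hat W_2\ne W_2\big)=0,$$ $$\liminf_n\tfrac1n H(W_1W_2|Z^n)\ge R_1+R_2,\quad \lim_n \tfrac1n I(W_1W_2;Z^n)=0 .$$ The secrecy capacity region is the closure of the set of achievable rate pairs. $Y_1$ is less noisy than $Y_2$ if $I(U;Y_2)\le I(U;Y_1)$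 for every finite-valued $U$ such that $U - X - (Y_1,Y_2)$ is a Markov chain. $Z$ is degraded with respect to $Y_1$ through a conditional p.m.f. $Q(z|y_1)$ if $P(z|x)=\sum_{y_1}P(y_1|x)Q(z|y_1)$ for all $x,z$. For a channel $V=V_{Y_1Y_2Z|X}$ let $\mathcal R(V)$ be the set of pairs $(R_1,R_2)$ with $R_1,R_2\ge0$ such that $$R_2\le I(U;Y_2|T)-I(U;Z|T),\qquad R_1+R_2\le I(X;Y_1|ZUT)+I(U;Y_2|T)-I(U;Z|T)$$ for some finite-valued $T,U$ and some joint p.m.f. $P_TP_{U|T}P_{X|U}V_{Y_1Y_2Z|X}$ of $(T,U,X,Y_1,Y_2,Z)$ (so that $(T,U)-X-(Y_1,Y_2,Z)$). **Theorem (Secrecy capacity region of the less-noisy wiretap broadcast channel).** Suppose that $Y_1$ is less noisy than $Y_2$ and that $Z$ is degraded with respect to $Y_1$ through $Q$. Then the secrecy capacity region of $P_{Y_1Y_2Z|X}$ equals $\mathcal R(V)$ for the channel $V(y_1,y_2,z|x)=P(y_1,y_2|x)\,Q(z|y_1)$. If moreover $X - Y_1 - Z$ is a Markov chain for the channel itself,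 i.e. $P(y_1,z|x)=P(y_1|x)\,Q'(z|y_1)$ for some conditional p.m.f. $Q'$, then the secrecy capacity region equals $\mathcal R(P_{Y_1Y_2Z|X})$. -/

import Mathlib

open Filter Topology

namespace WiretapBC

noncomputable section

universe u v w

/-! ### Shannon information measures of finite random variables, in bits

`p : Ω → ℝ` is a probability mass function on a finite type `Ω`; random variables are functions
on `Ω`. -/

/-- The probability of the event `s`. -/
def probOf {Ω : Type u} [Fintype Ω] (p : Ω → ℝ) (s : Set Ω) : ℝ :=
  ∑ ω, s.indicator p ω

/-- The probability mass function of the random variable `A`. -/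
def law {Ω : Type u} {α : Type v} [Fintype Ω] (p : Ω → ℝ) (A : Ω → α) (a : α) : ℝ :=
  probOf p {ω | A ω = a}

/-- The entropy `H(A) = -∑ P(a) log₂ P(a)`, with `0 log 0 = 0`. -/
def entropy {Ω : Type u} {α : Type v} [Fintype Ω] [Fintype α] (p : Ω → ℝ) (A : Ω → α) : ℝ :=
  ∑ a, Real.negMulLog (law p A a) / Real.log 2

/-- The conditional entropy `H(A | C) = H(A, C) - H(C)`. -/
def condEntropy {Ω : Type u} {α : Type v} {γ : Type w} [Fintype Ω] [Fintype α] [Fintype γ]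
    (p : Ω → ℝ) (A : Ω → α) (C : Ω → γ) : ℝ :=
  entropy p (fun ω => (A ω, C ω)) - entropy p C

/-- The mutual information `I(A; B) = H(A) - H(A | B)`. -/
def mutualInfo {Ω : Type u} {α : Type v} {β : Type w} [Fintype Ω] [Fintype α] [Fintype β]
    (p : Ω → ℝ) (A : Ω → α) (B : Ω → β) : ℝ :=
  entropy p A - condEntropy p A B

/-- The conditional mutual information `I(A; B | C) = H(A | C) - H(A | B, C)`. -/
def condMutualInfo {Ω : Type*} {α : Type*} {β : Type*} {γ : Type*}
    [Fintype Ω] [Fintype α] [Fintype β] [Fintype γ]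
    (p : Ω → ℝ) (A : Ω → α) (B : Ω → β) (C : Ω → γ) : ℝ :=
  condEntropy p A C - condEntropy p A (fun ω => (B ω, C ω))

/-! ### Channels -/

/-- A conditional probability mass function `P(b | a)`, i.e. a channel from `α` to the finite
alphabet `β`. -/
structure Channel (α : Type u) (β : Type v) [Fintype β] where
  prob : α → β → ℝ
  mem_simplex : ∀ a, prob a ∈ stdSimplex ℝ β

section Ordering

variable {X : Type*} {Y : Type*} {Z : Type*} [Fintype X] [Fintype Y] [Fintype Z]

/-- The transition probabilities `P(z | x)` are degraded with respect to `P(y | x)` through `Q`: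
`P(z | x) = ∑ y, P(y | x) Q(z | y)`. -/
def IsDegradedThrough (PZ : X → Z → ℝ) (PY : X → Y → ℝ) (Q : Channel Y Z) : Prop :=
  ∀ x z, PZ x z = ∑ y, PY x y * Q.prob y z

/-- The joint probability mass function of `(U, X, Y)` when `(U, X)` has probability mass
function `P` and `Y` is the output for the input `X`, so that `U - X - Y` is a Markov chain. -/
def inputOutput {U : Type*} (P : U × X → ℝ) (PY : X → Y → ℝ) : U × X × Y → ℝ :=
  fun ω => P (ω.1, ω.2.1) * PY ω.2.1 ω.2.2

/-- The output `Y` is less noisy than the output `Z`: `I(U; Z) ≤ I(U; Y)` for all `U` with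
`U - X - (Y, Z)`. -/
def IsLessNoisy (PY : X → Y → ℝ) (PZ : X → Z → ℝ) : Prop :=
  ∀ (k : ℕ) (P : Fin k × X → ℝ), P ∈ stdSimplex ℝ (Fin k × X) →
    mutualInfo (inputOutput P PZ) (fun ω => ω.1) (fun ω => ω.2.2) ≤
      mutualInfo (inputOutput P PY) (fun ω => ω.1) (fun ω => ω.2.2)

end Ordering

/-! ### The wiretap broadcast channel -/

section WBC

variable {X : Type*} {Y₁ : Type*} {Y₂ : Type*} {Z : Type*}
  [Fintype X] [Fintype Y₁] [Fintype Y₂] [Fintype Z]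

/-- `P(y₁ | x)`. -/
def Channel.toY₁ (W : Channel X (Y₁ × Y₂ × Z)) (x : X) (y₁ : Y₁) : ℝ :=
  ∑ y₂, ∑ z, W.prob x (y₁, y₂, z)

/-- `P(y₂ | x)`. -/
def Channel.toY₂ (W : Channel X (Y₁ × Y₂ × Z)) (x : X) (y₂ : Y₂) : ℝ :=
  ∑ y₁, ∑ z, W.prob x (y₁, y₂, z)

/-- `P(z | x)`. -/
def Channel.toZ (W : Channel X (Y₁ × Y₂ × Z)) (x : X) (z : Z) : ℝ :=
  ∑ y₁, ∑ y₂, W.prob x (y₁, y₂, z)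

/-- `P(y₁, y₂ | x)`. -/
def Channel.toY₁Y₂ (W : Channel X (Y₁ × Y₂ × Z)) (x : X) (y₁ : Y₁) (y₂ : Y₂) : ℝ :=
  ∑ z, W.prob x (y₁, y₂, z)

/-- `P(y₁, z | x)`. -/
def Channel.toY₁Z (W : Channel X (Y₁ × Y₂ × Z)) (x : X) (y₁ : Y₁) (z : Z) : ℝ :=
  ∑ y₂, W.prob x (y₁, y₂, z)

/-- `X - Y₁ - Z` is a Markov chain for every input: `P(y₁, z | x) = P(y₁ | x) Q(z | y₁)` for some
`Q`. -/
def Channel.IsMarkov (W : Channel X (Y₁ × Y₂ × Z)) : Prop :=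
  ∃ Q : Channel Y₁ Z, ∀ x y₁ z, W.toY₁Z x y₁ z = W.toY₁ x y₁ * Q.prob y₁ z

/-- The wiretap broadcast channel in which the eavesdropper's output is produced from `Y₁` by `Q`:
its transition probabilities are `P(y₁, y₂ | x) Q(z | y₁)`. -/
def Channel.cascade (W : Channel X (Y₁ × Y₂ × Z)) (Q : Channel Y₁ Z) :
    Channel X (Y₁ × Y₂ × Z) where
  prob x y := W.toY₁Y₂ x y.1 y.2.1 * Q.prob y.1 y.2.2
  mem_simplex x := by
    refine ⟨fun y => mul_nonneg (Finset.sum_nonneg fun z _ => (W.mem_simplex x).1 _)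
      ((Q.mem_simplex _).1 _), ?_⟩
    have h := (W.mem_simplex x).2
    simp only [Fintype.sum_prod_type] at h ⊢
    simp only [← Finset.mul_sum, (Q.mem_simplex _).2, mul_one]
    exact h

/-- A code of length `n` with `M₁` and `M₂` messages: a stochastic encoder and two decoders, each
of which outputs a message or declares an error (`none`). -/
structure Code (X : Type*) (Y₁ : Type*) (Y₂ : Type*) [Fintype X] (M₁ M₂ n : ℕ) where
  enc : Channel (Fin M₁ × Fin M₂) (Fin n → X)
  dec₁ : (Fin n → Y₁) → Option (Fin M₁)
  dec₂ : (Fin n → Y₂) → Option (Fin M₂)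

/-- The messages, the channel input and the channel outputs in a transmission of length `n`. -/
abbrev Transmission (X : Type*) (Y₁ : Type*) (Y₂ : Type*) (Z : Type*) (M₁ M₂ n : ℕ) :=
  (Fin M₁ × Fin M₂) × (Fin n → X) × (Fin n → Y₁ × Y₂ × Z)

/-- The joint probability mass function of a transmission: the message pair is uniform, the input
is drawn by the encoder, and the channel is memoryless. -/
def Code.dist {M₁ M₂ n : ℕ} (c : Code X Y₁ Y₂ M₁ M₂ n) (W : Channel X (Y₁ × Y₂ × Z)) :
    Transmission X Y₁ Y₂ Z M₁ M₂ n → ℝ :=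
  fun ω => 1 / ((M₁ : ℝ) * (M₂ : ℝ)) * c.enc.prob ω.1 ω.2.1 * ∏ i, W.prob (ω.2.1 i) (ω.2.2 i)

/-- The probability that at least one of the two users does not recover its message. -/
def Code.errorProb {M₁ M₂ n : ℕ} (c : Code X Y₁ Y₂ M₁ M₂ n) (W : Channel X (Y₁ × Y₂ × Z)) : ℝ :=
  probOf (c.dist W) {ω | c.dec₁ (fun i => (ω.2.2 i).1) ≠ some ω.1.1 ∨
    c.dec₂ (fun i => (ω.2.2 i).2.1) ≠ some ω.1.2}

/-- The equivocation `H(W₁, W₂ | Zⁿ)`. -/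
def Code.equivocation {M₁ M₂ n : ℕ} (c : Code X Y₁ Y₂ M₁ M₂ n)
    (W : Channel X (Y₁ × Y₂ × Z)) : ℝ :=
  condEntropy (c.dist W) (fun ω => ω.1) (fun ω i => (ω.2.2 i).2.2)

/-- The leakage `I(W₁, W₂; Zⁿ)`. -/
def Code.leakage {M₁ M₂ n : ℕ} (c : Code X Y₁ Y₂ M₁ M₂ n) (W : Channel X (Y₁ × Y₂ × Z)) : ℝ :=
  mutualInfo (c.dist W) (fun ω => ω.1) (fun ω i => (ω.2.2 i).2.2)

/-- The rate pair `R` is achievable with vanishing error probability and vanishing leakage rate. -/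
def IsAchievable (W : Channel X (Y₁ × Y₂ × Z)) (R : ℝ × ℝ) : Prop :=
  0 ≤ R.1 ∧ 0 ≤ R.2 ∧
  ∃ (M₁ M₂ : ℕ → ℕ) (c : ∀ n, Code X Y₁ Y₂ (M₁ n) (M₂ n) n),
    (∀ n, 0 < M₁ n ∧ 0 < M₂ n) ∧
    (R.1 : EReal) ≤ liminf (fun n : ℕ => ((Real.logb 2 (M₁ n) / n : ℝ) : EReal)) atTop ∧
    (R.2 : EReal) ≤ liminf (fun n : ℕ => ((Real.logb 2 (M₂ n) / n : ℝ) : EReal)) atTop ∧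
    Tendsto (fun n => (c n).errorProb W) atTop (𝓝 0) ∧
    ((R.1 + R.2 : ℝ) : EReal) ≤
      liminf (fun n : ℕ => (((c n).equivocation W / n : ℝ) : EReal)) atTop ∧
    Tendsto (fun n : ℕ => (c n).leakage W / n) atTop (𝓝 0)

/-- The secrecy capacity region: the closure of the set of achievable rate pairs. -/
def secrecyCapacityRegion (W : Channel X (Y₁ × Y₂ × Z)) : Set (ℝ × ℝ) :=
  closure {R | IsAchievable W R}

/-- The joint probability mass function `P(t) P(u | t) P(x | u) P(y₁, y₂, z | x)`. -/
def auxDist {kT kU : ℕ} (PT : Fin kT → ℝ) (PU : Channel (Fin kT) (Fin kU))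
    (PX : Channel (Fin kU) X) (W : Channel X (Y₁ × Y₂ × Z)) :
    Fin kT × Fin kU × X × (Y₁ × Y₂ × Z) → ℝ :=
  fun ω => PT ω.1 * PU.prob ω.1 ω.2.1 * PX.prob ω.2.1 ω.2.2.1 * W.prob ω.2.2.1 ω.2.2.2

/-- The single-letter region: all pairs of nonnegative rates such that, for some finite random
variables `T`, `U` with joint law `P_T P_{U|T} P_{X|U}` with the input,
`R₂ ≤ I(U; Y₂ | T) - I(U; Z | T)` and
`R₁ + R₂ ≤ I(X; Y₁ | Z, U, T) + I(U; Y₂ | T) - I(U; Z | T)`. -/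
def singleLetterRegion (W : Channel X (Y₁ × Y₂ × Z)) : Set (ℝ × ℝ) :=
  {R | 0 ≤ R.1 ∧ 0 ≤ R.2 ∧
    ∃ (kT kU : ℕ) (PT : Fin kT → ℝ) (PU : Channel (Fin kT) (Fin kU)) (PX : Channel (Fin kU) X),
      PT ∈ stdSimplex ℝ (Fin kT) ∧
      R.2 ≤ condMutualInfo (auxDist PT PU PX W)
              (fun ω => ω.2.1) (fun ω => ω.2.2.2.2.1) (fun ω => ω.1)
          - condMutualInfo (auxDist PT PU PX W)
              (fun ω => ω.2.1) (fun ω => ω.2.2.2.2.2) (fun ω => ω.1) ∧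
      R.1 + R.2 ≤ condMutualInfo (auxDist PT PU PX W)
              (fun ω => ω.2.2.1) (fun ω => ω.2.2.2.1) (fun ω => (ω.2.2.2.2.2, ω.2.1, ω.1))
          + condMutualInfo (auxDist PT PU PX W)
              (fun ω => ω.2.1) (fun ω => ω.2.2.2.2.1) (fun ω => ω.1)
          - condMutualInfo (auxDist PT PU PX W)
              (fun ω => ω.2.1) (fun ω => ω.2.2.2.2.2) (fun ω => ω.1)}

end WBC

end

end WiretapBC

set_option linter.unusedSectionVars false

namespace WiretapBC

noncomputable section


/-! The calculus uses unnormalised input masses. Conditioning on an event just restricts the mass,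
and a family `m k` is an auxiliary variable with joint mass `m k a`. Differences of output entropies
of two kernels (`entDiff`, `infoDiff`) are homogeneous of degree one, so no normalisation is needed,
and "less noisy" becomes superadditivity of `H(Y₁) - H(Y₂)` (`IsLessNoisy.outSuperadd`). A degraded
output satisfies the same inequality (`outSuperadd_compKernel`).

Converse. With `U = W₂`, Fano's inequality and the leakage condition bound the rates by the
`n`-letter quantities `I(W₂; Y₂ⁿ) - I(W₂; Zⁿ)` and `I(Xⁿ; Y₁ⁿ | W₂) - I(Xⁿ; Zⁿ | W₂)`
(`Code.converse`). The induction `exists_mem_convexHull_auxValues` reduces them to single letters: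
it peels off one letter at a time by the telescoping identities `entDiff_tensor` and
`infoDiff_tensor`, so that letter `i` is conditioned on the earlier `Y₂`-outputs and the later
`Z`-outputs. For the second quantity the telescoping produces earlier `Y₁`-outputs instead;
`sum_infoDiff_sliceFst_le` exchanges them for `Y₂`-outputs, by the less-noisy assumption together
with degradedness. The conditioning variables act as the time-sharing variable `T`, and the values
for all `T` and `U` form the convex hull of a compact set, so limits of codes stay inside the region
(`IsAchievable.mem_rateRegion`).

Achievability. For a time-sharing word, a random superposition codebook has cloud centres carrying
`W₂`, as much of `W₁` as fits, and local randomness of rate `I(U; Z | T)`; the satellites carry the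
rest of `W₁` and local randomness of rate `I(X; Z | U, T)`. Both decoders use maximum likelihood.
The error and leakage averages reduce to log-likelihood ratios of i.i.d. letters (`exists_code`),
and second moments suffice for the limit (`isAchievable_of_layers`). User 1 can also resolve the
clouds because `I(U; Y₂ | T) ≤ I(U; Y₁ | T)`.

Both directions involve only the marginals to `Y₁`, `Y₂` and `Z`. For a Markov chain `X - Y₁ - Z`
one has `I(X; Y₁ | Z, U, T) = I(X; Y₁ | U, T) - I(X; Z | U, T)` (`condMutualInfo_X`), so the same
region is obtained from any channel with these marginals and this Markov property, in particular the
cascade. -/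

/-! ### Output entropies of unnormalised mass functions -/

section OutputEntropy

variable {α α' β β' γ κ : Type*} [Fintype α] [Fintype α'] [Fintype β] [Fintype β'] [Fintype γ]
  [Fintype κ]

/-- The output mass function of the kernel `K` for the input mass function `m`. -/
def push (K : α → β → ℝ) (m : α → ℝ) (b : β) : ℝ := ∑ a, m a * K a b

/-- `-∑ v(b) log v(b)` for the output mass function `v`. -/
def outEnt (K : α → β → ℝ) (m : α → ℝ) : ℝ := ∑ b, Real.negMulLog (push K m b)

/-- The output entropy of `K` for a deterministic input. -/
def rowEnt (K : α → β → ℝ) (a : α) : ℝ := ∑ b, Real.negMulLog (K a b)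

theorem push_nonneg {K : α → β → ℝ} (hK : ∀ a, K a ∈ stdSimplex ℝ β) {m : α → ℝ}
    (hm : ∀ a, 0 ≤ m a) (b : β) : 0 ≤ push K m b :=
  Finset.sum_nonneg fun a _ => mul_nonneg (hm a) ((hK a).1 b)

theorem sum_push {K : α → β → ℝ} (hK : ∀ a, K a ∈ stdSimplex ℝ β) (m : α → ℝ) :
    ∑ b, push K m b = ∑ a, m a := by
  simp only [push]
  rw [Finset.sum_comm]
  simp [← Finset.mul_sum, (hK _).2]

theorem push_mem_stdSimplex {K : α → β → ℝ} (hK : ∀ a, K a ∈ stdSimplex ℝ β) {m : α → ℝ}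
    (hm : m ∈ stdSimplex ℝ α) : push K m ∈ stdSimplex ℝ β :=
  ⟨push_nonneg hK hm.1, by rw [sum_push hK, hm.2]⟩

theorem push_add (K : α → β → ℝ) (m m' : α → ℝ) (b : β) :
    push K (m + m') b = push K m b + push K m' b := by
  simp [push, add_mul, Finset.sum_add_distrib]

theorem push_smul (K : α → β → ℝ) (c : ℝ) (m : α → ℝ) (b : β) :
    push K (c • m) b = c * push K m b := by
  simp [push, Finset.mul_sum, mul_assoc]

theorem push_sum (K : α → β → ℝ) (m : κ → α → ℝ) (b : β) :
    push K (∑ k, m k) b = ∑ k, push K (m k) b := by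
  simp only [push, Finset.sum_apply, Finset.sum_mul]
  exact Finset.sum_comm

/-- The correction term involves only the total mass of `m`, not the kernel, because the rows sum to
one. It cancels in every difference of two output entropies, which makes `entDiff` and `infoDiff`
homogeneous of degree one. -/
theorem outEnt_smul {K : α → β → ℝ} (hK : ∀ a, K a ∈ stdSimplex ℝ β) (c : ℝ) (m : α → ℝ) :
    outEnt K (c • m) = c * outEnt K m + (∑ a, m a) * Real.negMulLog c := by
  simp only [outEnt, push_smul, Real.negMulLog_mul, Finset.sum_add_distrib, ← Finset.mul_sum,
    ← Finset.sum_mul, sum_push hK]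
  ring

@[simp] theorem outEnt_zero (K : α → β → ℝ) : outEnt K (0 : α → ℝ) = 0 := by
  simp [outEnt, push]

theorem outEnt_single [DecidableEq α] {K : α → β → ℝ} (hK : ∀ a, K a ∈ stdSimplex ℝ β) (c : ℝ)
    (a : α) : outEnt K (Pi.single a c) = c * rowEnt K a + Real.negMulLog c := by
  have h : ∀ b, push K (Pi.single a c) b = c * K a b := fun b => by
    simp [push, Pi.single_apply]
  simp only [outEnt, h, Real.negMulLog_mul, Finset.sum_add_distrib, ← Finset.mul_sum,
    ← Finset.sum_mul, (hK a).2, rowEnt]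
  ring

theorem continuous_outEnt (K : α → β → ℝ) : Continuous (outEnt K) := by
  unfold outEnt push
  exact continuous_finsetSum _ fun b _ => Real.continuous_negMulLog.comp (by fun_prop)

/-- Jensen's inequality for `negMulLog`. -/
theorem sum_negMulLog_le {w s : κ → ℝ} (hw : w ∈ stdSimplex ℝ κ) (hs : ∀ k, 0 ≤ s k) :
    ∑ k, w k * Real.negMulLog (s k) ≤ Real.negMulLog (∑ k, w k * s k) := by
  have := Real.concaveOn_negMulLog.le_map_sum (t := Finset.univ) (w := w) (p := s)
    (fun i _ => hw.1 i) hw.2 (fun i _ => hs i)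
  simpa using this

theorem outEnt_concave {K : α → β → ℝ} (hK : ∀ a, K a ∈ stdSimplex ℝ β) {w : κ → ℝ}
    (hw : w ∈ stdSimplex ℝ κ) {m : κ → α → ℝ} (hm : ∀ k a, 0 ≤ m k a) :
    ∑ k, w k * outEnt K (m k) ≤ outEnt K (∑ k, w k • m k) := by
  simp only [outEnt, Finset.mul_sum, push_sum, push_smul]
  rw [Finset.sum_comm]
  exact Finset.sum_le_sum fun b _ => sum_negMulLog_le hw fun k => push_nonneg hK (hm k) b

/-- `x log (x / c) ≥ x - c`, without division. -/
theorem sub_le_mul_log_sub {x c : ℝ} (hx : 0 ≤ x) (hc : 0 ≤ c) (h : c = 0 → x = 0) :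
    x - c ≤ x * Real.log x - x * Real.log c := by
  rcases hx.eq_or_lt with rfl | hx
  · simpa using hc
  rcases hc.eq_or_lt with rfl | hc
  · exact absurd (h rfl) hx.ne'
  have := Real.log_le_sub_one_of_pos (div_pos hc hx)
  rw [Real.log_div hc.ne' hx.ne'] at this
  have h2 : x * (c / x - 1) = c - x := by field_simp
  nlinarith

/-- Gibbs' inequality. -/
theorem gibbs {x c : κ → ℝ} (hx : ∀ k, 0 ≤ x k) (hc : ∀ k, 0 ≤ c k) (h : ∀ k, c k = 0 → x k = 0)
    (hs : ∑ k, c k ≤ ∑ k, x k) :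
    ∑ k, Real.negMulLog (x k) ≤ - ∑ k, x k * Real.log (c k) := by
  have := Finset.sum_le_sum fun k (_ : k ∈ Finset.univ) => sub_le_mul_log_sub (hx k) (hc k) (h k)
  simp only [Finset.sum_sub_distrib] at this
  simp only [Real.negMulLog, neg_mul, Finset.sum_neg_distrib]
  linarith

/-- The entropy of an unnormalised mass function. -/
def massEnt (x : κ → ℝ) : ℝ := ∑ k, Real.negMulLog (x k) - Real.negMulLog (∑ k, x k)

theorem massEnt_eq (x : κ → ℝ) :
    massEnt x = - ∑ k, x k * (Real.log (x k) - Real.log (∑ k, x k)) := by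
  simp only [massEnt, Real.negMulLog, mul_sub, Finset.sum_sub_distrib, ← Finset.sum_mul, neg_mul,
    Finset.sum_neg_distrib]
  ring

/-- Gibbs' inequality against `c` rescaled to the mass of `x`; domination by `c` ensures that `x`
vanishes where `c` does. The bound is linear in `x`, so with `c = x + y` the bounds for `x` and for
`y` add up to `massEnt (x + y)`. -/
theorem massEnt_le {x c : κ → ℝ} (hx : ∀ k, 0 ≤ x k) (hxc : ∀ k, x k ≤ c k) :
    massEnt x ≤ - ∑ k, x k * (Real.log (c k) - Real.log (∑ k, c k)) := by
  have hc : ∀ k, 0 ≤ c k := fun k => (hx k).trans (hxc k)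
  have hcs : 0 ≤ ∑ k, c k := Finset.sum_nonneg fun k _ => hc k
  rcases hcs.eq_or_lt with h0 | hpos
  · have h1 : ∀ k, x k = 0 := fun k => le_antisymm
      ((hxc k).trans ((Finset.sum_eq_zero_iff_of_nonneg fun k _ => hc k).1 h0.symm k
        (Finset.mem_univ k)).le) (hx k)
    simp [massEnt, h1]
  set S := ∑ k, x k with hS
  have hS0 : 0 ≤ S := Finset.sum_nonneg fun k _ => hx k
  rcases hS0.eq_or_lt with h0 | hSpos
  · have h1 : ∀ k, x k = 0 := fun k =>
      (Finset.sum_eq_zero_iff_of_nonneg fun k _ => hx k).1 h0.symm k (Finset.mem_univ k)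
    simp [massEnt, h1]
  have hg := gibbs (x := x) (c := fun k => S / (∑ k, c k) * c k) hx
    (fun k => mul_nonneg (by positivity) (hc k))
    (fun k h => by
      have : c k = 0 := by
        rcases mul_eq_zero.1 h with h | h
        · exact absurd h (by positivity)
        · exact h
      exact le_antisymm ((hxc k).trans this.le) (hx k))
    (by rw [← Finset.mul_sum, div_mul_cancel₀ _ hpos.ne'])
  have h2 : ∀ k, x k * Real.log (S / (∑ k, c k) * c k) =
      x k * (Real.log (c k) - Real.log (∑ k, c k)) + x k * Real.log S := by
    intro k
    rcases (hc k).eq_or_lt with h | h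
    · have : x k = 0 := le_antisymm ((hxc k).trans h.symm.le) (hx k)
      simp [this]
    · rw [Real.log_mul (by positivity) h.ne', Real.log_div hSpos.ne' hpos.ne']
      ring
  simp only [h2, Finset.sum_add_distrib, ← Finset.sum_mul] at hg
  simp only [massEnt, Real.negMulLog] at hg ⊢
  rw [← hS] at hg ⊢
  linarith

/-- Concavity of entropy in homogeneous form: forgetting which of the two parts occurred cannot
decrease the entropy. -/
theorem massEnt_superadd {x y : κ → ℝ} (hx : ∀ k, 0 ≤ x k) (hy : ∀ k, 0 ≤ y k) :
    massEnt x + massEnt y ≤ massEnt (x + y) := by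
  have h1 := massEnt_le (c := x + y) hx (fun k => by simpa using hy k)
  have h2 := massEnt_le (c := x + y) hy (fun k => by simpa using hx k)
  rw [massEnt_eq (x + y)]
  simp only [Pi.add_apply, add_mul, Finset.sum_add_distrib] at *
  linarith

/-! ### The less-noisy order as superadditivity. -/

/-- `m ↦ H(A) - H(B)` is superadditive, i.e. the output of `A` is less noisy than that of `B`. -/
def OutSuperadd (A : α → β → ℝ) (B : α → γ → ℝ) : Prop :=
  ∀ m m' : α → ℝ, (∀ a, 0 ≤ m a) → (∀ a, 0 ≤ m' a) →
    (outEnt A m - outEnt B m) + (outEnt A m' - outEnt B m') ≤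
      outEnt A (m + m') - outEnt B (m + m')

theorem OutSuperadd.sum {A : α → β → ℝ} {B : α → γ → ℝ} (h : OutSuperadd A B)
    {m : κ → α → ℝ} (hm : ∀ k a, 0 ≤ m k a) (s : Finset κ) :
    ∑ k ∈ s, (outEnt A (m k) - outEnt B (m k)) ≤
      outEnt A (∑ k ∈ s, m k) - outEnt B (∑ k ∈ s, m k) := by
  classical
  induction s using Finset.induction_on with
  | empty => simp
  | insert k s hk ih =>
    rw [Finset.sum_insert hk, Finset.sum_insert hk]
    have := h (m k) (∑ k ∈ s, m k) (hm k)
      (fun a => by rw [Finset.sum_apply]; exact Finset.sum_nonneg fun k _ => hm k a)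
    linarith

/-- The composition of two kernels. -/
def compKernel (A : α → β → ℝ) (Q : β → γ → ℝ) (a : α) (c : γ) : ℝ := ∑ b, A a b * Q b c

theorem compKernel_mem {A : α → β → ℝ} {Q : β → γ → ℝ} (hA : ∀ a, A a ∈ stdSimplex ℝ β)
    (hQ : ∀ b, Q b ∈ stdSimplex ℝ γ) (a : α) : compKernel A Q a ∈ stdSimplex ℝ γ :=
  push_mem_stdSimplex hQ (hA a)

theorem push_compKernel (A : α → β → ℝ) (Q : β → γ → ℝ) (m : α → ℝ) (c : γ) :
    push (compKernel A Q) m c = push Q (push A m) c := by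
  simp only [push, compKernel, Finset.mul_sum, Finset.sum_mul]
  rw [Finset.sum_comm]
  simp [mul_assoc]

/-- The entropy of `(b, c)` when `b` has mass function `v` and `c` is the output of `Q`. -/
theorem sum_negMulLog_joint {Q : β → γ → ℝ} (hQ : ∀ b, Q b ∈ stdSimplex ℝ γ) (v : β → ℝ) :
    ∑ b, ∑ c, Real.negMulLog (v b * Q b c) =
      ∑ b, Real.negMulLog (v b) + ∑ b, v b * rowEnt Q b := by
  simp only [Real.negMulLog_mul, Finset.sum_add_distrib, ← Finset.mul_sum, ← Finset.sum_mul,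
    (hQ _).2, rowEnt, one_mul]

/-- The chain rule in both orders gives `H(b) - H(c) = H(b | c) - H(c | b)`. The first term is a sum
of superadditive terms `massEnt`, the second is linear in `m`; hence the difference is
superadditive. -/
theorem outEnt_sub_outEnt_compKernel (A : α → β → ℝ) {Q : β → γ → ℝ}
    (hQ : ∀ b, Q b ∈ stdSimplex ℝ γ) (m : α → ℝ) :
    outEnt A m - outEnt (compKernel A Q) m =
      ∑ c, massEnt (fun b => push A m b * Q b c) - ∑ b, push A m b * rowEnt Q b := by
  have := sum_negMulLog_joint hQ (push A m)
  simp only [massEnt, Finset.sum_sub_distrib]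
  rw [Finset.sum_comm, this]
  simp only [outEnt, push_compKernel]
  simp only [push]
  ring

/-- A degraded output is noisier. -/
theorem outSuperadd_compKernel {A : α → β → ℝ} {Q : β → γ → ℝ} (hA : ∀ a, A a ∈ stdSimplex ℝ β)
    (hQ : ∀ b, Q b ∈ stdSimplex ℝ γ) : OutSuperadd A (compKernel A Q) := by
  intro m m' hm hm'
  simp only [outEnt_sub_outEnt_compKernel A hQ, push_add, add_mul, Finset.sum_add_distrib]
  have : ∀ c, massEnt (fun b => push A m b * Q b c) + massEnt (fun b => push A m' b * Q b c) ≤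
      massEnt (fun b => push A m b * Q b c + push A m' b * Q b c) := fun c =>
    massEnt_superadd (fun b => mul_nonneg (push_nonneg hA hm b) ((hQ b).1 c))
      (fun b => mul_nonneg (push_nonneg hA hm' b) ((hQ b).1 c))
  have := Finset.sum_le_sum fun c (_ : c ∈ Finset.univ) => this c
  rw [Finset.sum_add_distrib] at this
  linarith

/-- `H(B) - H(C)` of the outputs. -/
def entDiff (B : α → β → ℝ) (C : α → γ → ℝ) (m : α → ℝ) : ℝ := outEnt B m - outEnt C m

/-- `I(X; A) - I(X; C)` for the input mass function `m`. -/
def infoDiff (A : α → β → ℝ) (C : α → γ → ℝ) (m : α → ℝ) : ℝ :=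
  outEnt A m - outEnt C m - ∑ a, m a * (rowEnt A a - rowEnt C a)

theorem entDiff_smul {B : α → β → ℝ} {C : α → γ → ℝ} (hB : ∀ a, B a ∈ stdSimplex ℝ β)
    (hC : ∀ a, C a ∈ stdSimplex ℝ γ) (c : ℝ) (m : α → ℝ) :
    entDiff B C (c • m) = c * entDiff B C m := by
  simp only [entDiff, outEnt_smul hB, outEnt_smul hC]
  ring

theorem infoDiff_smul {B : α → β → ℝ} {C : α → γ → ℝ} (hB : ∀ a, B a ∈ stdSimplex ℝ β)
    (hC : ∀ a, C a ∈ stdSimplex ℝ γ) (c : ℝ) (m : α → ℝ) :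
    infoDiff B C (c • m) = c * infoDiff B C m := by
  simp only [infoDiff, outEnt_smul hB, outEnt_smul hC, Pi.smul_apply, smul_eq_mul, mul_assoc,
    ← Finset.mul_sum]
  ring

theorem continuous_entDiff (B : α → β → ℝ) (C : α → γ → ℝ) : Continuous (entDiff B C) :=
  (continuous_outEnt B).sub (continuous_outEnt C)

theorem continuous_infoDiff (B : α → β → ℝ) (C : α → γ → ℝ) : Continuous (infoDiff B C) :=
  (continuous_entDiff B C).sub (by fun_prop)

/-- `I(V; A) - I(V; C) ≤ I(X; A) - I(X; C)` if `V - X - (A, C)` and `C` is noisier than `A`. -/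
theorem entDiff_sub_sum_le_infoDiff {A : α → β → ℝ} {C : α → γ → ℝ}
    (hA : ∀ a, A a ∈ stdSimplex ℝ β) (hC : ∀ a, C a ∈ stdSimplex ℝ γ) (h : OutSuperadd A C)
    {m : κ → α → ℝ} (hm : ∀ k a, 0 ≤ m k a) :
    entDiff A C (∑ k, m k) - ∑ k, entDiff A C (m k) ≤ infoDiff A C (∑ k, m k) := by
  classical
  -- Superadditivity for the decomposition of `m k` into point masses, i.e. `I(X; C | V = k) ≤ I(X;
  -- A | V = k)` up to scaling.
  have key : ∀ k, ∑ a, m k a * (rowEnt A a - rowEnt C a) ≤ entDiff A C (m k) := by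
    intro k
    have h1 := h.sum (m := fun a : α => Pi.single (M := fun _ => ℝ) a (m k a))
      (fun a a' => by by_cases e : a' = a <;> simp [e, hm]) Finset.univ
    rw [Finset.univ_sum_single (m k)] at h1
    refine le_trans (Finset.sum_le_sum fun a _ => ?_) h1
    rw [outEnt_single hA, outEnt_single hC]
    linarith
  have := Finset.sum_le_sum fun k (_ : k ∈ Finset.univ) => key k
  rw [Finset.sum_comm] at this
  simp only [← Finset.sum_mul] at this
  simp only [infoDiff, Finset.sum_apply]
  simp only [entDiff] at *
  linarith

end OutputEntropy


/-! ### Product kernels -/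

section ProductKernel

variable {α α' β β' γ γ' κ Ω : Type*} [Fintype α] [Fintype α'] [Fintype β] [Fintype β'] [Fintype γ]
  [Fintype γ'] [Fintype κ] [Fintype Ω]

/-- `∑ ω, ∏ i, g i (ω i) = ∏ i, ∑ a, g i a`. -/
theorem sum_prod_pi {ι : Type*} [Fintype ι] [DecidableEq ι] (g : ι → Ω → ℝ) :
    ∑ ω : ι → Ω, ∏ i, g i (ω i) = ∏ i, ∑ a, g i a := by
  rw [Finset.prod_univ_sum, Fintype.piFinset_univ]

/-- The `n`-fold memoryless extension of a kernel. -/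
def powKernel (n : ℕ) (K : α → β → ℝ) (x : Fin n → α) (y : Fin n → β) : ℝ := ∏ i, K (x i) (y i)

theorem powKernel_mem {K : α → β → ℝ} (hK : ∀ a, K a ∈ stdSimplex ℝ β) (n : ℕ) (x : Fin n → α) :
    powKernel n K x ∈ stdSimplex ℝ (Fin n → β) := by
  refine ⟨fun y => Finset.prod_nonneg fun i _ => (hK _).1 _, ?_⟩
  unfold powKernel
  rw [sum_prod_pi fun i b => K (x i) b]
  simp [(hK _).2]

theorem powKernel_compKernel (n : ℕ) (A : α → β → ℝ) (Q : β → γ → ℝ) :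
    powKernel n (compKernel A Q) = compKernel (powKernel n A) (powKernel n Q) := by
  funext x z
  simp only [powKernel, compKernel, ← Finset.prod_mul_distrib]
  rw [sum_prod_pi fun i b => A (x i) b * Q b (z i)]

/-- The product of two kernels. -/
def tensorKernel (K' : α' → β' → ℝ) (K : α → β → ℝ) (x : α' × α) (y : β' × β) : ℝ :=
  K' x.1 y.1 * K x.2 y.2

/-- The mass function of the second input jointly with the output `y` of the first. -/
def sliceFst (K' : α' → β' → ℝ) (m : α' × α → ℝ) (y : β') (x : α) : ℝ := ∑ x', m (x', x) * K' x' y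

/-- The mass function of the first input jointly with the output `y` of the second. -/
def sliceSnd (K : α → β → ℝ) (m : α' × α → ℝ) (y : β) (x' : α') : ℝ := ∑ x, m (x', x) * K x y

theorem sliceFst_nonneg {K' : α' → β' → ℝ} (hK : ∀ a, K' a ∈ stdSimplex ℝ β') {m : α' × α → ℝ}
    (hm : ∀ a, 0 ≤ m a) (y : β') (x : α) : 0 ≤ sliceFst K' m y x :=
  Finset.sum_nonneg fun a _ => mul_nonneg (hm _) ((hK a).1 _)

theorem sliceSnd_nonneg {K : α → β → ℝ} (hK : ∀ a, K a ∈ stdSimplex ℝ β) {m : α' × α → ℝ}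
    (hm : ∀ a, 0 ≤ m a) (y : β) (x : α') : 0 ≤ sliceSnd K m y x :=
  Finset.sum_nonneg fun a _ => mul_nonneg (hm _) ((hK a).1 _)

theorem sliceFst_sum (K' : α' → β' → ℝ) (m : κ → α' × α → ℝ) (y : β') :
    sliceFst K' (∑ k, m k) y = ∑ k, sliceFst K' (m k) y := by
  funext x
  simp only [sliceFst, Finset.sum_apply, Finset.sum_mul]
  exact Finset.sum_comm

theorem sliceSnd_sum (K : α → β → ℝ) (m : κ → α' × α → ℝ) (y : β) :
    sliceSnd K (∑ k, m k) y = ∑ k, sliceSnd K (m k) y := by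
  funext x
  simp only [sliceSnd, Finset.sum_apply, Finset.sum_mul]
  exact Finset.sum_comm

theorem sum_sliceFst {K' : α' → β' → ℝ} (hK : ∀ a, K' a ∈ stdSimplex ℝ β') (m : α' × α → ℝ)
    (x : α) : ∑ y, sliceFst K' m y x = ∑ x', m (x', x) := by
  simp only [sliceFst]
  rw [Finset.sum_comm]
  simp [← Finset.mul_sum, (hK _).2]

theorem sum_sliceSnd {K : α → β → ℝ} (hK : ∀ a, K a ∈ stdSimplex ℝ β) (m : α' × α → ℝ)
    (x' : α') : ∑ y, sliceSnd K m y x' = ∑ x, m (x', x) := by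
  simp only [sliceSnd]
  rw [Finset.sum_comm]
  simp [← Finset.mul_sum, (hK _).2]

theorem sum_sum_sliceFst {K' : α' → β' → ℝ} (hK : ∀ a, K' a ∈ stdSimplex ℝ β') (m : α' × α → ℝ) :
    ∑ y, ∑ x, sliceFst K' m y x = ∑ x, m x := by
  rw [Finset.sum_comm]
  simp only [sum_sliceFst hK]
  rw [Fintype.sum_prod_type_right]

theorem sum_sum_sliceSnd {K : α → β → ℝ} (hK : ∀ a, K a ∈ stdSimplex ℝ β) (m : α' × α → ℝ) :
    ∑ y, ∑ x, sliceSnd K m y x = ∑ x, m x := by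
  rw [Finset.sum_comm]
  simp only [sum_sliceSnd hK]
  rw [Fintype.sum_prod_type]

theorem outEnt_tensor_fst (K' : α' → β' → ℝ) (K : α → β → ℝ) (m : α' × α → ℝ) :
    outEnt (tensorKernel K' K) m = ∑ y, outEnt K (sliceFst K' m y) := by
  simp only [outEnt, Fintype.sum_prod_type]
  refine Finset.sum_congr rfl fun y' _ => Finset.sum_congr rfl fun y _ => congrArg _ ?_
  simp only [push, tensorKernel, sliceFst, Finset.sum_mul, Fintype.sum_prod_type]
  rw [Finset.sum_comm]
  simp only [mul_assoc]

theorem outEnt_tensor_snd (K' : α' → β' → ℝ) (K : α → β → ℝ) (m : α' × α → ℝ) :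
    outEnt (tensorKernel K' K) m = ∑ y, outEnt K' (sliceSnd K m y) := by
  simp only [outEnt, Fintype.sum_prod_type_right]
  refine Finset.sum_congr rfl fun y' _ => Finset.sum_congr rfl fun y _ => congrArg _ ?_
  simp only [push, tensorKernel, sliceSnd, Finset.sum_mul, Fintype.sum_prod_type]
  refine Finset.sum_congr rfl fun _ _ => Finset.sum_congr rfl fun _ _ => ?_
  ring

theorem rowEnt_tensor {K' : α' → β' → ℝ} {K : α → β → ℝ} (hK' : ∀ a, K' a ∈ stdSimplex ℝ β')
    (hK : ∀ a, K a ∈ stdSimplex ℝ β) (x : α' × α) :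
    rowEnt (tensorKernel K' K) x = rowEnt K' x.1 + rowEnt K x.2 := by
  simp only [rowEnt, tensorKernel, Fintype.sum_prod_type, Real.negMulLog_mul,
    Finset.sum_add_distrib, ← Finset.mul_sum, ← Finset.sum_mul, (hK _).2, (hK' _).2, one_mul]

/-- Insert the mixed kernel `tensorKernel B' C`. Each of the two resulting differences changes a
single factor and is a sum over the output of the unchanged one. Iterated over the letters, this
telescoping plays the role of the Csiszár sum identity. -/
theorem entDiff_tensor (B' : α' → β' → ℝ) (B : α → β → ℝ) (C' : α' → γ' → ℝ) (C : α → γ → ℝ)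
    (m : α' × α → ℝ) :
    entDiff (tensorKernel B' B) (tensorKernel C' C) m =
      ∑ y, entDiff B C (sliceFst B' m y) + ∑ z, entDiff B' C' (sliceSnd C m z) := by
  simp only [entDiff, Finset.sum_sub_distrib, ← outEnt_tensor_fst, ← outEnt_tensor_snd]
  ring

theorem infoDiff_tensor {A' : α' → β' → ℝ} {A : α → β → ℝ} {C' : α' → γ' → ℝ} {C : α → γ → ℝ}
    (hA' : ∀ a, A' a ∈ stdSimplex ℝ β') (hA : ∀ a, A a ∈ stdSimplex ℝ β)
    (hC' : ∀ a, C' a ∈ stdSimplex ℝ γ') (hC : ∀ a, C a ∈ stdSimplex ℝ γ) (m : α' × α → ℝ) :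
    infoDiff (tensorKernel A' A) (tensorKernel C' C) m =
      ∑ y, infoDiff A C (sliceFst A' m y) + ∑ z, infoDiff A' C' (sliceSnd C m z) := by
  have h1 : ∑ y, ∑ x, sliceFst A' m y x * (rowEnt A x - rowEnt C x) =
      ∑ x, m x * (rowEnt A x.2 - rowEnt C x.2) := by
    rw [Finset.sum_comm, Fintype.sum_prod_type_right]
    simp only [← Finset.sum_mul, sum_sliceFst hA']
  have h2 : ∑ z, ∑ x, sliceSnd C m z x * (rowEnt A' x - rowEnt C' x) =
      ∑ x, m x * (rowEnt A' x.1 - rowEnt C' x.1) := by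
    rw [Finset.sum_comm, Fintype.sum_prod_type]
    simp only [← Finset.sum_mul, sum_sliceSnd hC]
  simp only [infoDiff, Finset.sum_sub_distrib, ← outEnt_tensor_fst, ← outEnt_tensor_snd, h1, h2,
    rowEnt_tensor hA' hA, rowEnt_tensor hC' hC]
  simp only [mul_add, mul_sub, Finset.sum_add_distrib, Finset.sum_sub_distrib]
  ring

/-- Conditioning on the output of the noisier channel leaves more uncertainty about a degraded
pair. -/
theorem sum_infoDiff_sliceFst_le {A' : α' → β' → ℝ} {B' : α' → γ' → ℝ} {A : α → β → ℝ}
    {Q : β → γ → ℝ} (hA' : ∀ a, A' a ∈ stdSimplex ℝ β') (hB' : ∀ a, B' a ∈ stdSimplex ℝ γ')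
    (hA : ∀ a, A a ∈ stdSimplex ℝ β) (hQ : ∀ b, Q b ∈ stdSimplex ℝ γ) (h : OutSuperadd A' B')
    {m : α' × α → ℝ} (hm : ∀ a, 0 ≤ m a) :
    ∑ y, infoDiff A (compKernel A Q) (sliceFst A' m y) ≤
      ∑ y, infoDiff A (compKernel A Q) (sliceFst B' m y) := by
  -- For fixed degraded letter `z`, the letter `y` is the auxiliary variable of the less-noisy
  -- inequality: `I(y; B' | z) ≤ I(y; A' | z)`. The sub-masses `Q y z • sliceSnd A m y` add up to
  -- the slice at `z`.
  have h1 : ∀ z, ∑ y, Q y z * (outEnt A' (sliceSnd A m y) - outEnt B' (sliceSnd A m y)) ≤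
      outEnt A' (sliceSnd (compKernel A Q) m z) - outEnt B' (sliceSnd (compKernel A Q) m z) := by
    intro z
    have := h.sum (m := fun y => Q y z • sliceSnd A m y)
      (fun y a => mul_nonneg ((hQ y).1 z) (sliceSnd_nonneg hA hm y a)) Finset.univ
    have e : ∑ y, Q y z • sliceSnd A m y = sliceSnd (compKernel A Q) m z := by
      funext x
      simp only [Finset.sum_apply, Pi.smul_apply, smul_eq_mul, sliceSnd, compKernel,
        Finset.mul_sum]
      rw [Finset.sum_comm]
      refine Finset.sum_congr rfl fun _ _ => Finset.sum_congr rfl fun _ _ => ?_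
      ring
    rw [e] at this
    refine le_trans (le_of_eq (Finset.sum_congr rfl fun y _ => ?_)) this
    rw [outEnt_smul hA', outEnt_smul hB']
    ring
  have h2 := Finset.sum_le_sum fun z (_ : z ∈ Finset.univ) => h1 z
  rw [Finset.sum_comm] at h2
  simp only [← Finset.sum_mul, (hQ _).2, one_mul, Finset.sum_sub_distrib,
    ← outEnt_tensor_snd] at h2
  -- The terms linear in the mass see only the marginal of the second input, which is the same for
  -- both ways of slicing.
  have e1 : ∑ y, ∑ x, sliceFst A' m y x * (rowEnt A x - rowEnt (compKernel A Q) x) =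
      ∑ y, ∑ x, sliceFst B' m y x * (rowEnt A x - rowEnt (compKernel A Q) x) := by
    rw [Finset.sum_comm, Finset.sum_comm (γ := γ')]
    simp only [← Finset.sum_mul, sum_sliceFst hA', sum_sliceFst hB']
  simp only [infoDiff, Finset.sum_sub_distrib, ← outEnt_tensor_fst, e1]
  linarith

/-! ### Splitting off the first letter -/

/-- The mass function of a word, as a function of the first letter and of the rest. -/
def consMass {n : ℕ} (m : (Fin (n + 1) → α) → ℝ) (x : α × (Fin n → α)) : ℝ := m (Fin.cons x.1 x.2)

theorem sum_consEquiv {n : ℕ} (F : (Fin (n + 1) → α) → ℝ) :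
    ∑ x, F x = ∑ p : α × (Fin n → α), F (Fin.cons p.1 p.2) :=
  (Fintype.sum_equiv (Fin.consEquiv fun _ => α) _ _ fun _ => rfl).symm

theorem powKernel_cons {n : ℕ} (K : α → β → ℝ) (p : α × (Fin n → α)) (q : β × (Fin n → β)) :
    powKernel (n + 1) K (Fin.cons p.1 p.2) (Fin.cons q.1 q.2) =
      tensorKernel K (powKernel n K) p q := by
  simp [powKernel, tensorKernel, Fin.prod_univ_succ]

theorem outEnt_powKernel_succ {n : ℕ} (K : α → β → ℝ) (m : (Fin (n + 1) → α) → ℝ) :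
    outEnt (powKernel (n + 1) K) m = outEnt (tensorKernel K (powKernel n K)) (consMass m) := by
  simp only [outEnt, push]
  rw [sum_consEquiv]
  refine Finset.sum_congr rfl fun q _ => congrArg _ ?_
  rw [sum_consEquiv]
  simp only [powKernel_cons, consMass]

theorem rowEnt_powKernel_succ {n : ℕ} (K : α → β → ℝ) (p : α × (Fin n → α)) :
    rowEnt (powKernel (n + 1) K) (Fin.cons p.1 p.2) =
      rowEnt (tensorKernel K (powKernel n K)) p := by
  simp only [rowEnt]
  rw [sum_consEquiv]
  simp only [powKernel_cons]

theorem entDiff_powKernel_succ {n : ℕ} (B : α → β → ℝ) (C : α → γ → ℝ)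
    (m : (Fin (n + 1) → α) → ℝ) :
    entDiff (powKernel (n + 1) B) (powKernel (n + 1) C) m =
      ∑ y, entDiff (powKernel n B) (powKernel n C) (sliceFst B (consMass m) y) +
        ∑ z, entDiff B C (sliceSnd (powKernel n C) (consMass m) z) := by
  rw [← entDiff_tensor]
  simp only [entDiff, outEnt_powKernel_succ]

theorem infoDiff_powKernel_succ {n : ℕ} {A : α → β → ℝ} {C : α → γ → ℝ}
    (hA : ∀ a, A a ∈ stdSimplex ℝ β) (hC : ∀ a, C a ∈ stdSimplex ℝ γ)
    (m : (Fin (n + 1) → α) → ℝ) :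
    infoDiff (powKernel (n + 1) A) (powKernel (n + 1) C) m =
      ∑ y, infoDiff (powKernel n A) (powKernel n C) (sliceFst A (consMass m) y) +
        ∑ z, infoDiff A C (sliceSnd (powKernel n C) (consMass m) z) := by
  rw [← infoDiff_tensor hA (powKernel_mem hA n) hC (powKernel_mem hC n)]
  simp only [infoDiff, outEnt_powKernel_succ]
  rw [sum_consEquiv]
  simp only [rowEnt_powKernel_succ, consMass]

end ProductKernel

/-! ### The compact set of single-letter values -/

section Convexity

/-- The convex hull of a compact set in a finite-dimensional space is compact. -/
theorem isCompact_convexHull' {E : Type*} [NormedAddCommGroup E] [NormedSpace ℝ E]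
    [FiniteDimensional ℝ E] {s : Set E} (hs : IsCompact s) : IsCompact (convexHull ℝ s) := by
  classical
  rcases s.eq_empty_or_nonempty with rfl | ⟨x0, hx0⟩
  · simp
  -- Carathéodory's bound on the number of points. Shorter combinations are padded with weight zero
  -- at `x0`, so that the hull is the continuous image of one compact parameter space.
  let d := Module.finrank ℝ E + 1
  let F : (Fin d → ℝ) × (Fin d → E) → E := fun p => ∑ i, p.1 i • p.2 i
  have hF : Continuous F := by fun_prop
  have : convexHull ℝ s = F '' (stdSimplex ℝ (Fin d) ×ˢ Set.univ.pi fun _ => s) := by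
    apply Set.Subset.antisymm
    · intro x hx
      obtain ⟨ι, _, z, w, hz, hind, hw, hw1, rfl⟩ := eq_pos_convex_span_of_mem_convexHull hx
      have hcard : Fintype.card ι ≤ Fintype.card (Fin d) := by
        rw [Fintype.card_fin]
        exact hind.card_le_finrank_succ.trans (Nat.succ_le_succ (Submodule.finrank_le _))
      obtain ⟨e⟩ := Function.Embedding.nonempty_of_card_le hcard
      have hsum : ∀ {M : Type _} [AddCommMonoid M] (g : ι → M),
          ∑ j, Function.extend e g (fun _ => 0) j = ∑ i, g i := by
        intro M _ g
        rw [← Finset.sum_subset (Finset.subset_univ (Finset.univ.map e))]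
        · simp [e.injective.extend_apply]
        · intro j _ hj
          apply Function.extend_apply'
          rintro ⟨i, rfl⟩
          exact hj (by simp)
      refine ⟨(Function.extend e w fun _ => 0, Function.extend e z fun _ => x0),
        ⟨⟨fun j => ?_, ?_⟩, fun j _ => ?_⟩, ?_⟩
      · by_cases hj : ∃ i, e i = j
        · obtain ⟨i, rfl⟩ := hj
          simpa [e.injective.extend_apply] using (hw i).le
        · simp [Function.extend_apply' _ _ _ hj]
      · rw [hsum w, hw1]
      · by_cases hj : ∃ i, e i = j
        · obtain ⟨i, rfl⟩ := hj
          simpa [e.injective.extend_apply] using hz ⟨i, rfl⟩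
        · simpa [Function.extend_apply' _ _ _ hj] using hx0
      · change ∑ j, _ = _
        rw [← Finset.sum_subset (Finset.subset_univ (Finset.univ.map e))]
        · simp [e.injective.extend_apply]
        · intro j _ hj
          have : ¬ ∃ i, e i = j := by
            rintro ⟨i, rfl⟩
            exact hj (by simp)
          simp [Function.extend_apply' _ _ _ this]
    · rintro _ ⟨⟨w, z⟩, ⟨⟨hw0, hw1⟩, hz⟩, rfl⟩
      exact (convex_convexHull ℝ s).sum_mem (fun i _ => hw0 i) hw1
        fun i _ => subset_convexHull ℝ s (hz i (Set.mem_univ i))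
  rw [this]
  exact ((isCompact_stdSimplex ℝ (Fin d)).prod (isCompact_univ_pi fun _ => hs)).image hF

variable {α β β' γ κ : Type*} [Fintype α] [Fintype β] [Fintype β'] [Fintype γ] [Fintype κ]

/-- The values `(q, H(B) - H(C), I(X; A) - I(X; C))` for all input laws `q`. -/
def lawGraph (A : α → β → ℝ) (B : α → β' → ℝ) (C : α → γ → ℝ) : Set ((α → ℝ) × ℝ × ℝ) :=
  (fun q => (q, entDiff B C q, infoDiff A C q)) '' stdSimplex ℝ α

/-- The pairs `(I(U; B) - I(U; C), I(X; A | U) - I(X; C | U))` for all finite `U - X - (A, B, C)`. -/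
def auxValues (A : α → β → ℝ) (B : α → β' → ℝ) (C : α → γ → ℝ) : Set (ℝ × ℝ) :=
  (fun v : (α → ℝ) × ℝ × ℝ => (entDiff B C v.1 - v.2.1, v.2.2)) ''
    convexHull ℝ (lawGraph A B C)

theorem isCompact_auxValues (A : α → β → ℝ) (B : α → β' → ℝ) (C : α → γ → ℝ) :
    IsCompact (auxValues A B C) := by
  have := continuous_entDiff B C
  have h2 := continuous_infoDiff A C
  refine (isCompact_convexHull' ((isCompact_stdSimplex ℝ α).image ?_)).image ?_ <;> fun_prop

theorem auxValues_nonempty [Nonempty α] (A : α → β → ℝ) (B : α → β' → ℝ) (C : α → γ → ℝ) :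
    (auxValues A B C).Nonempty := by
  classical
  obtain ⟨a⟩ := ‹Nonempty α›
  exact ((Set.Nonempty.image _ ⟨_, single_mem_stdSimplex ℝ a⟩).convexHull).image _

/-- Finitely many unnormalised input laws with total mass `c` have a value in `c • auxValues`. -/
theorem exists_mem_auxValues [Nonempty α] {A : α → β → ℝ} {B : α → β' → ℝ} {C : α → γ → ℝ}
    (hA : ∀ a, A a ∈ stdSimplex ℝ β) (hB : ∀ a, B a ∈ stdSimplex ℝ β')
    (hC : ∀ a, C a ∈ stdSimplex ℝ γ) {m : κ → α → ℝ} (hm : ∀ k a, 0 ≤ m k a) :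
    ∃ v ∈ auxValues A B C,
      entDiff B C (∑ k, m k) - ∑ k, entDiff B C (m k) = (∑ k, ∑ a, m k a) * v.1 ∧
      ∑ k, infoDiff A C (m k) = (∑ k, ∑ a, m k a) * v.2 := by
  classical
  have hz : ∀ k, ∑ a, m k a = 0 → m k = 0 := fun k h => by
    funext a
    exact (Finset.sum_eq_zero_iff_of_nonneg fun a _ => hm k a).1 h a (Finset.mem_univ a)
  have hc0 : 0 ≤ ∑ k, ∑ a, m k a := Finset.sum_nonneg fun k _ => Finset.sum_nonneg fun a _ => hm k a
  have e0 : entDiff B C (0 : α → ℝ) = 0 := by simp [entDiff]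
  have i0 : infoDiff A C (0 : α → ℝ) = 0 := by simp [infoDiff]
  rcases hc0.eq_or_lt with h0 | hpos
  · obtain ⟨v, hv⟩ := auxValues_nonempty A B C
    have : m = 0 := by
      funext k
      exact hz k ((Finset.sum_eq_zero_iff_of_nonneg fun k _ =>
        Finset.sum_nonneg fun a _ => hm k a).1 h0.symm k (Finset.mem_univ k))
    refine ⟨v, hv, ?_, ?_⟩ <;> simp [this, e0, i0]
  set c := ∑ k, ∑ a, m k a with hc
  obtain ⟨a0⟩ := ‹Nonempty α›
  -- The conditional law given `k`; where the mass vanishes it gets weight zero, so any law serves.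
  let q : κ → α → ℝ := fun k => if ∑ a, m k a = 0 then Pi.single a0 1 else (∑ a, m k a)⁻¹ • m k
  have hq : ∀ k, q k ∈ stdSimplex ℝ α := by
    intro k
    by_cases h : ∑ a, m k a = 0
    · simp only [q, if_pos h]
      exact single_mem_stdSimplex ℝ a0
    · simp only [q, if_neg h]
      refine ⟨fun a => mul_nonneg (inv_nonneg.2 (Finset.sum_nonneg fun a _ => hm k a)) (hm k a), ?_⟩
      simp only [Pi.smul_apply, smul_eq_mul, ← Finset.mul_sum]
      exact inv_mul_cancel₀ h
  have hmq : ∀ k, m k = (∑ a, m k a) • q k := by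
    intro k
    by_cases h : ∑ a, m k a = 0
    · rw [h, zero_smul, hz k h]
    · simp only [q, if_neg h]
      rw [smul_smul, mul_inv_cancel₀ h, one_smul]
  have hmem := (convex_convexHull ℝ (lawGraph A B C)).sum_mem (t := Finset.univ)
    (w := fun k => (∑ a, m k a) / c) (z := fun k => (q k, entDiff B C (q k), infoDiff A C (q k)))
    (fun k _ => div_nonneg (Finset.sum_nonneg fun a _ => hm k a) hc0)
    (by rw [← Finset.sum_div, ← hc, div_self hpos.ne'])
    (fun k _ => subset_convexHull ℝ _ ⟨q k, hq k, rfl⟩)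
  have e1 : ∑ k, ((∑ a, m k a) / c) • q k = c⁻¹ • ∑ k, m k := by
    rw [Finset.smul_sum]
    refine Finset.sum_congr rfl fun k _ => ?_
    conv_rhs => rw [hmq k, smul_smul]
    rw [div_eq_inv_mul]
  have e2 : ∑ k, ((∑ a, m k a) / c) * entDiff B C (q k) = c⁻¹ * ∑ k, entDiff B C (m k) := by
    rw [Finset.mul_sum]
    refine Finset.sum_congr rfl fun k _ => ?_
    conv_rhs => rw [hmq k, entDiff_smul hB hC]
    ring
  have e3 : ∑ k, ((∑ a, m k a) / c) * infoDiff A C (q k) = c⁻¹ * ∑ k, infoDiff A C (m k) := by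
    rw [Finset.mul_sum]
    refine Finset.sum_congr rfl fun k _ => ?_
    conv_rhs => rw [hmq k, infoDiff_smul hA hC]
    ring
  refine ⟨_, ⟨_, hmem, rfl⟩, ?_, ?_⟩
  · simp only [Prod.fst_sum, Prod.snd_sum, Prod.smul_fst, Prod.smul_snd, smul_eq_mul, e1, e2,
      entDiff_smul hB hC]
    field_simp
  · simp only [Prod.snd_sum, Prod.smul_snd, smul_eq_mul, e3]
    field_simp

/-- A sum of multiples of points of a convex set. -/
theorem exists_mem_convexHull_sum {s : Set (ℝ × ℝ)} (hs : s.Nonempty) {c : κ → ℝ}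
    (hc : ∀ k, 0 ≤ c k) {v : κ → ℝ × ℝ} (hv : ∀ k, v k ∈ convexHull ℝ s) :
    ∃ w ∈ convexHull ℝ s, ∑ k, c k * (v k).1 = (∑ k, c k) * w.1 ∧
      ∑ k, c k * (v k).2 = (∑ k, c k) * w.2 := by
  rcases (Finset.sum_nonneg fun k (_ : k ∈ Finset.univ) => hc k).eq_or_lt with h0 | hpos
  · obtain ⟨w, hw⟩ := hs
    have : ∀ k, c k = 0 := fun k =>
      (Finset.sum_eq_zero_iff_of_nonneg fun k _ => hc k).1 h0.symm k (Finset.mem_univ k)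
    exact ⟨w, subset_convexHull ℝ s hw, by simp [this], by simp [this]⟩
  · have := (convex_convexHull ℝ s).sum_mem (t := Finset.univ) (w := fun k => c k / ∑ k, c k)
      (z := v) (fun k _ => div_nonneg (hc k) hpos.le) (by rw [← Finset.sum_div, div_self hpos.ne'])
      (fun k _ => hv k)
    refine ⟨_, this, ?_, ?_⟩
    · simp only [Prod.fst_sum, Prod.smul_fst, smul_eq_mul, Finset.mul_sum]
      exact Finset.sum_congr rfl fun k _ => by field_simp
    · simp only [Prod.snd_sum, Prod.smul_snd, smul_eq_mul, Finset.mul_sum]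
      exact Finset.sum_congr rfl fun k _ => by field_simp

/-- Single-letterization: the `n`-letter values lie in `n` times the convex hull of the
single-letter values. -/
theorem exists_mem_convexHull_auxValues [Nonempty α] {A : α → β → ℝ} {B : α → β' → ℝ}
    {Q : β → γ → ℝ} (hA : ∀ a, A a ∈ stdSimplex ℝ β) (hB : ∀ a, B a ∈ stdSimplex ℝ β')
    (hQ : ∀ b, Q b ∈ stdSimplex ℝ γ) (hAB : OutSuperadd A B) (n : ℕ)
    {m : κ → (Fin n → α) → ℝ} (hm : ∀ k a, 0 ≤ m k a) :
    ∃ v ∈ convexHull ℝ (auxValues A B (compKernel A Q)),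
      entDiff (powKernel n B) (powKernel n (compKernel A Q)) (∑ k, m k) -
        ∑ k, entDiff (powKernel n B) (powKernel n (compKernel A Q)) (m k) =
          n * (∑ k, ∑ a, m k a) * v.1 ∧
      ∑ k, infoDiff (powKernel n A) (powKernel n (compKernel A Q)) (m k) ≤
        n * (∑ k, ∑ a, m k a) * v.2 := by
  set C := compKernel A Q with hCdef
  have hC : ∀ a, C a ∈ stdSimplex ℝ γ := compKernel_mem hA hQ
  have hne := auxValues_nonempty A B C
  induction n with
  | zero =>
    obtain ⟨v, hv⟩ := hne
    refine ⟨v, subset_convexHull ℝ _ hv, ?_, ?_⟩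
    · simp [entDiff, outEnt, push, powKernel]
    · simp [infoDiff, outEnt, push, powKernel, rowEnt]
  | succ n ih =>
    have hCn := powKernel_mem hC n
    have hm' : ∀ k p, 0 ≤ consMass (m k) p := fun k p => hm k _
    have hmass : ∀ k, ∑ p, consMass (m k) p = ∑ a, m k a := fun k => (sum_consEquiv (m k)).symm
    -- The remaining letters, conditioned on the `B`-output `y` of the first letter. The first
    -- letter is then treated conditionally on the `C`-outputs `z` of the remaining ones. Both
    -- conditioning variables are absorbed into the convex hull as time sharing.
    choose v hv hv1 hv2 using fun y => ih (m := fun k => sliceFst B (consMass (m k)) y)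
      (fun k a => sliceFst_nonneg hB (hm' k) y a)
    choose w hw hw1 hw2 using fun z => exists_mem_auxValues hA hB hC
      (m := fun k => sliceSnd (powKernel n C) (consMass (m k)) z)
      (fun k a => sliceSnd_nonneg hCn (hm' k) z a)
    set S := ∑ k, ∑ a, m k a with hS
    have hSv : ∑ y, ∑ k, ∑ a, sliceFst B (consMass (m k)) y a = S := by
      rw [Finset.sum_comm]
      simp only [sum_sum_sliceFst hB, hmass, hS]
    have hSw : ∑ z, ∑ k, ∑ a, sliceSnd (powKernel n C) (consMass (m k)) z a = S := by
      rw [Finset.sum_comm]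
      simp only [sum_sum_sliceSnd hCn, hmass, hS]
    obtain ⟨v', hv', hv'1, hv'2⟩ := exists_mem_convexHull_sum hne
      (c := fun y => ∑ k, ∑ a, sliceFst B (consMass (m k)) y a)
      (fun y => Finset.sum_nonneg fun k _ => Finset.sum_nonneg fun a _ =>
        sliceFst_nonneg hB (hm' k) y a) hv
    obtain ⟨w', hw', hw'1, hw'2⟩ := exists_mem_convexHull_sum hne
      (c := fun z => ∑ k, ∑ a, sliceSnd (powKernel n C) (consMass (m k)) z a)
      (fun y => Finset.sum_nonneg fun k _ => Finset.sum_nonneg fun a _ =>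
        sliceSnd_nonneg hCn (hm' k) y a) (fun z => subset_convexHull ℝ _ (hw z))
    rw [hSv] at hv'1 hv'2
    rw [hSw] at hw'1 hw'2
    -- Uniform time sharing over the letters: weight `n` for the remaining letters, weight one for
    -- the first.
    obtain ⟨u, hu, hu1, hu2⟩ := exists_mem_convexHull_sum hne (κ := Bool)
      (c := fun b => if b then (n : ℝ) else 1) (v := fun b => if b then v' else w')
      (fun b => by cases b <;> simp) (fun b => by cases b <;> simpa)
    simp only [Fintype.sum_bool, if_true, Bool.false_eq_true, if_false, one_mul] at hu1 hu2
    refine ⟨u, hu, ?_, ?_⟩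
    · have hcons : consMass (∑ k, m k) = ∑ k, consMass (m k) := by
        funext p; simp [consMass]
      simp only [entDiff_powKernel_succ, hcons, sliceFst_sum, sliceSnd_sum, Finset.sum_add_distrib]
      rw [Finset.sum_comm (γ := κ) (α := β'), Finset.sum_comm (γ := κ) (α := Fin n → γ)]
      have a1 := Finset.sum_congr rfl fun y (_ : y ∈ Finset.univ) => hv1 y
      have a2 := Finset.sum_congr rfl fun y (_ : y ∈ Finset.univ) => hw1 y
      rw [hw'1] at a2
      simp only [mul_assoc, ← Finset.mul_sum, hv'1] at a1
      simp only [Finset.sum_sub_distrib] at a1 a2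
      push_cast
      linear_combination a1 + a2 + S * hu1
    · calc ∑ k, infoDiff (powKernel (n + 1) A) (powKernel (n + 1) C) (m k)
          ≤ ∑ k, (∑ y, infoDiff (powKernel n A) (powKernel n C) (sliceFst B (consMass (m k)) y) +
              ∑ z, infoDiff A C (sliceSnd (powKernel n C) (consMass (m k)) z)) := by
            refine Finset.sum_le_sum fun k _ => ?_
            -- The telescoping conditions the remaining letters on the first `A`-output, whereas `v`
            -- was chosen for the `B`-output. The less-noisy assumption exchanges them, which turns
            -- this coordinate into an inequality.
            rw [infoDiff_powKernel_succ hA hC]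
            gcongr ?_ + _
            rw [hCdef, powKernel_compKernel]
            exact sum_infoDiff_sliceFst_le hA hB (powKernel_mem hA n) (powKernel_mem hQ n) hAB
              (hm' k)
        _ = ∑ y, ∑ k, infoDiff (powKernel n A) (powKernel n C) (sliceFst B (consMass (m k)) y) +
              ∑ z, ∑ k, infoDiff A C (sliceSnd (powKernel n C) (consMass (m k)) z) := by
            rw [Finset.sum_add_distrib, Finset.sum_comm (γ := κ) (α := β'),
              Finset.sum_comm (γ := κ) (α := Fin n → γ)]
        _ ≤ n * (S * v'.2) + S * w'.2 := by
            rw [← hw'2, ← hv'2, Finset.mul_sum]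
            refine add_le_add (Finset.sum_le_sum fun y _ => ?_) (Finset.sum_le_sum fun z _ => ?_)
            · exact (hv2 y).trans_eq (mul_assoc _ _ _)
            · exact (hw2 z).le
        _ = (n + 1 : ℕ) * S * u.2 := by
            push_cast
            linear_combination S * hu2

end Convexity


/-! ### Laws of random variables -/

section Laws

variable {Ω α β γ X U Y Y' : Type*} [Fintype Ω] [Fintype α] [Fintype β] [Fintype γ] [Fintype X]
  [Fintype U] [Fintype Y] [Fintype Y']

theorem probOf_apply (p : Ω → ℝ) (s : Ω → Prop) [DecidablePred s] :
    probOf p {ω | s ω} = ∑ ω, if s ω then p ω else 0 := by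
  simp [probOf, Set.indicator_apply]

theorem law_apply [DecidableEq α] (p : Ω → ℝ) (A : Ω → α) (a : α) :
    law p A a = ∑ ω, if A ω = a then p ω else 0 := by
  rw [law, probOf_apply]

theorem entropy_eq (p : Ω → ℝ) (A : Ω → α) :
    entropy p A = (∑ a, Real.negMulLog (law p A a)) / Real.log 2 := by
  rw [entropy, Finset.sum_div]

theorem mutualInfo_inputOutput [DecidableEq U] [DecidableEq Y] {K : X → Y → ℝ}
    (hK : ∀ x, K x ∈ stdSimplex ℝ Y) (P : U × X → ℝ) :
    mutualInfo (inputOutput P K) (fun ω => ω.1) (fun ω => ω.2.2) =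
      (∑ u, Real.negMulLog (∑ x, P (u, x)) + outEnt K (∑ u, fun x => P (u, x))
        - ∑ u, outEnt K (fun x => P (u, x))) / Real.log 2 := by
  have h1 : ∀ u, law (inputOutput P K) (fun ω => ω.1) u = ∑ x, P (u, x) := fun u => by
    simp [law_apply, inputOutput, Fintype.sum_prod_type, ← Finset.mul_sum, (hK _).2,
      Finset.sum_ite_irrel]
  have h2 : ∀ y, law (inputOutput P K) (fun ω => ω.2.2) y =
      push K (∑ u, fun x => P (u, x)) y := fun y => by
    simp [law_apply, inputOutput, Fintype.sum_prod_type, push_sum]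
    simp [push]
  have h3 : ∀ a : U × Y, law (inputOutput P K) (fun ω => (ω.1, ω.2.2)) a =
      push K (fun x => P (a.1, x)) a.2 := fun a => by
    simp [law_apply, inputOutput, Fintype.sum_prod_type, Prod.ext_iff, ite_and,
      Finset.sum_ite_irrel, push]
  simp only [mutualInfo, condEntropy, entropy_eq, h1, h2, h3]
  simp only [outEnt, Fintype.sum_prod_type]
  ring

/-- A binary `U` selecting between `m` and `m'`, normalised by their total mass. The entropy of `U`
occurs on both sides and cancels, and so do the mass terms of `outEnt_smul`. -/
theorem IsLessNoisy.outSuperadd {K : X → Y → ℝ} {L : X → Y' → ℝ}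
    (hK : ∀ x, K x ∈ stdSimplex ℝ Y) (hL : ∀ x, L x ∈ stdSimplex ℝ Y') (h : IsLessNoisy K L) :
    OutSuperadd K L := by
  classical
  intro m m' hm hm'
  have hc : 0 ≤ ∑ x, (m x + m' x) := Finset.sum_nonneg fun x _ => add_nonneg (hm x) (hm' x)
  rcases hc.eq_or_lt with h0 | hpos
  · have hz := (Finset.sum_eq_zero_iff_of_nonneg
      fun x _ => add_nonneg (hm x) (hm' x)).1 h0.symm
    have e1 : m = 0 := by
      funext x; have := hz x (Finset.mem_univ x); have := hm x; have := hm' x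
      simp only [Pi.zero_apply]; linarith
    have e2 : m' = 0 := by
      funext x; have := hz x (Finset.mem_univ x); have := hm x; have := hm' x
      simp only [Pi.zero_apply]; linarith
    simp [e1, e2]
  set c := ∑ x, (m x + m' x) with hcdef
  have h2 := h 2 (fun p => c⁻¹ * (if p.1 = 0 then m p.2 else m' p.2)) ⟨fun p => by
      have := hm p.2; have := hm' p.2
      by_cases e : p.1 = 0 <;> simp only [e, if_true, if_false] <;> positivity, by
      simp only [Fintype.sum_prod_type, Fin.sum_univ_two, ← Finset.mul_sum]
      simp only [if_true, one_ne_zero, if_false, ← Finset.sum_add_distrib]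
      exact inv_mul_cancel₀ hpos.ne'⟩
  rw [mutualInfo_inputOutput hK, mutualInfo_inputOutput hL,
    div_le_div_iff_of_pos_right (Real.log_pos one_lt_two)] at h2
  simp only [Fin.sum_univ_two, if_true, one_ne_zero, if_false] at h2
  have e1 : (fun x => c⁻¹ * m x) = c⁻¹ • m := rfl
  have e2 : (fun x => c⁻¹ * m' x) = c⁻¹ • m' := rfl
  rw [e1, e2, ← smul_add] at h2
  have key : c⁻¹ * (outEnt K m - outEnt L m + (outEnt K m' - outEnt L m')) ≤
      c⁻¹ * (outEnt K (m + m') - outEnt L (m + m')) := by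
    simp only [outEnt_smul hK, outEnt_smul hL] at h2
    linarith
  exact le_of_mul_le_mul_left key (inv_pos.2 hpos)

/-- The marginal of the kernel `K` under the map `π` of the outputs. -/
def marg [DecidableEq β] (K : X → Ω → ℝ) (π : Ω → β) (x : X) (b : β) : ℝ :=
  ∑ ω, if π ω = b then K x ω else 0

theorem marg_mem [DecidableEq β] {K : X → Ω → ℝ} (hK : ∀ x, K x ∈ stdSimplex ℝ Ω) (π : Ω → β)
    (x : X) : marg K π x ∈ stdSimplex ℝ β := by
  refine ⟨fun b => Finset.sum_nonneg fun ω _ => ?_, ?_⟩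
  · split_ifs
    · exact (hK x).1 ω
    · exact le_rfl
  · simp only [marg]
    rw [Finset.sum_comm]
    simp [(hK x).2]

/-- The output of a memoryless channel, seen through a letterwise map. -/
theorem sum_prod_mul_comp [DecidableEq β] {n : ℕ} (K : X → Ω → ℝ) (π : Ω → β) (x : Fin n → X)
    (G : (Fin n → β) → ℝ) :
    ∑ ω : Fin n → Ω, (∏ i, K (x i) (ω i)) * G (fun i => π (ω i)) =
      ∑ b, powKernel n (marg K π) x b * G b := by
  have h1 : ∀ b : Fin n → β, powKernel n (marg K π) x b =
      ∑ ω : Fin n → Ω, if (fun i => π (ω i)) = b then ∏ i, K (x i) (ω i) else 0 := by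
    intro b
    simp only [powKernel, marg]
    rw [← sum_prod_pi fun i ω => if π ω = b i then K (x i) ω else 0]
    refine Finset.sum_congr rfl fun ω _ => ?_
    simp [Finset.prod_ite_zero, funext_iff]
  simp only [h1, Finset.sum_mul]
  rw [Finset.sum_comm]
  simp [ite_mul]

end Laws

/-! ### Codes -/

section Codes

variable {X Y₁ Y₂ Z β δ : Type*} [Fintype X] [Fintype Y₁] [Fintype Y₂] [Fintype Z] [Fintype β]
  [Fintype δ] {M₁ M₂ n : ℕ}

theorem toY₁_eq_marg [DecidableEq Y₁] (W : Channel X (Y₁ × Y₂ × Z)) :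
    W.toY₁ = marg W.prob (fun y => y.1) := by
  funext x y
  simp only [Channel.toY₁, marg, Fintype.sum_prod_type]
  rw [Finset.sum_eq_single y] <;> simp +contextual

theorem toY₂_eq_marg [DecidableEq Y₂] (W : Channel X (Y₁ × Y₂ × Z)) :
    W.toY₂ = marg W.prob (fun y => y.2.1) := by
  funext x y
  simp only [Channel.toY₂, marg, Fintype.sum_prod_type]
  refine Finset.sum_congr rfl fun y₁ _ => ?_
  rw [Finset.sum_eq_single y] <;> simp +contextual

theorem toZ_eq_marg [DecidableEq Z] (W : Channel X (Y₁ × Y₂ × Z)) :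
    W.toZ = marg W.prob (fun y => y.2.2) := by
  funext x y
  simp [Channel.toZ, marg, Fintype.sum_prod_type]

theorem toY₁_mem (W : Channel X (Y₁ × Y₂ × Z)) (x : X) : W.toY₁ x ∈ stdSimplex ℝ Y₁ := by
  classical
  rw [toY₁_eq_marg]
  exact marg_mem W.mem_simplex _ x

theorem toY₂_mem (W : Channel X (Y₁ × Y₂ × Z)) (x : X) : W.toY₂ x ∈ stdSimplex ℝ Y₂ := by
  classical
  rw [toY₂_eq_marg]
  exact marg_mem W.mem_simplex _ x

theorem toZ_mem (W : Channel X (Y₁ × Y₂ × Z)) (x : X) : W.toZ x ∈ stdSimplex ℝ Z := by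
  classical
  rw [toZ_eq_marg]
  exact marg_mem W.mem_simplex _ x

/-- The joint mass function of the message pair `w` and the channel input. -/
def Code.mass (c : Code X Y₁ Y₂ M₁ M₂ n) (w : Fin M₁ × Fin M₂) (x : Fin n → X) : ℝ :=
  1 / ((M₁ : ℝ) * (M₂ : ℝ)) * c.enc.prob w x

theorem Code.mass_nonneg (c : Code X Y₁ Y₂ M₁ M₂ n) (w : Fin M₁ × Fin M₂) (x : Fin n → X) :
    0 ≤ c.mass w x :=
  mul_nonneg (by positivity) ((c.enc.mem_simplex w).1 x)

theorem Code.sum_mass (c : Code X Y₁ Y₂ M₁ M₂ n) (w : Fin M₁ × Fin M₂) :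
    ∑ x, c.mass w x = 1 / ((M₁ : ℝ) * (M₂ : ℝ)) := by
  simp only [Code.mass, ← Finset.mul_sum, (c.enc.mem_simplex w).2, mul_one]

theorem Code.sum_sum_mass (c : Code X Y₁ Y₂ M₁ M₂ n) (h₁ : 0 < M₁) (h₂ : 0 < M₂) :
    ∑ w, ∑ x, c.mass w x = 1 := by
  simp only [Code.sum_mass]
  have : (M₁ : ℝ) ≠ 0 := by positivity
  have : (M₂ : ℝ) ≠ 0 := by positivity
  simp
  field_simp

/-- The channel enters such expectations only through the marginal kernel of `π`; this is why the
capacity region depends on the three marginals alone. -/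
theorem Code.sum_dist [DecidableEq β] (c : Code X Y₁ Y₂ M₁ M₂ n) (W : Channel X (Y₁ × Y₂ × Z))
    (π : Y₁ × Y₂ × Z → β) (G : Fin M₁ × Fin M₂ → (Fin n → β) → ℝ) :
    ∑ ω, c.dist W ω * G ω.1 (fun i => π (ω.2.2 i)) =
      ∑ w, ∑ b, push (powKernel n (marg W.prob π)) (c.mass w) b * G w b := by
  rw [Fintype.sum_prod_type]
  refine Finset.sum_congr rfl fun w _ => ?_
  rw [Fintype.sum_prod_type]
  simp only [Code.dist, mul_assoc, ← Finset.mul_sum, sum_prod_mul_comp]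
  simp only [push, Finset.sum_mul]
  rw [Finset.sum_comm]
  simp only [Finset.mul_sum, Code.mass, mul_assoc]

theorem Code.probOf_dist [DecidableEq β] (c : Code X Y₁ Y₂ M₁ M₂ n)
    (W : Channel X (Y₁ × Y₂ × Z)) (π : Y₁ × Y₂ × Z → β)
    (s : Fin M₁ × Fin M₂ → (Fin n → β) → Prop) [∀ w b, Decidable (s w b)] :
    probOf (c.dist W) {ω | s ω.1 (fun i => π (ω.2.2 i))} =
      ∑ w, ∑ b, if s w b then push (powKernel n (marg W.prob π)) (c.mass w) b else 0 := by
  have := c.sum_dist W π (fun w b => if s w b then 1 else 0)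
  simp only [mul_ite, mul_one, mul_zero] at this
  rw [probOf_apply, this]

theorem Code.leakage_eq (c : Code X Y₁ Y₂ M₁ M₂ n) (W : Channel X (Y₁ × Y₂ × Z)) (h₁ : 0 < M₁)
    (h₂ : 0 < M₂) :
    c.leakage W = (Real.log M₁ + Real.log M₂ + outEnt (powKernel n W.toZ) (∑ w, c.mass w)
      - ∑ w, outEnt (powKernel n W.toZ) (c.mass w)) / Real.log 2 := by
  classical
  have hC := toZ_mem W
  rw [toZ_eq_marg] at hC ⊢
  set π : Y₁ × Y₂ × Z → Z := fun y => y.2.2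
  have hCn := powKernel_mem hC n
  have l1 : ∀ w, law (c.dist W) (fun ω => ω.1) w = 1 / ((M₁ : ℝ) * M₂) := fun w => by
    rw [law, c.probOf_dist W π (fun w' _ => w' = w)]
    simp [Finset.sum_ite_irrel, sum_push hCn, c.sum_mass]
  have l2 : ∀ z, law (c.dist W) (fun ω i => (ω.2.2 i).2.2) z =
      push (powKernel n (marg W.prob π)) (∑ w, c.mass w) z := fun z => by
    rw [law, c.probOf_dist W π (fun _ z' => z' = z), push_sum]
    simp
  have l3 : ∀ a : (Fin M₁ × Fin M₂) × (Fin n → Z),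
      law (c.dist W) (fun ω => (ω.1, fun i => (ω.2.2 i).2.2)) a =
      push (powKernel n (marg W.prob π)) (c.mass a.1) a.2 := fun a => by
    rw [law, c.probOf_dist W π (fun w z => (w, z) = a)]
    have h : ∀ w z, (w, z) = a ↔ w = a.1 ∧ z = a.2 := fun w z => Prod.ext_iff
    simp only [h, ite_and]
    simp [Finset.sum_ite_irrel]
  simp only [Code.leakage, mutualInfo, condEntropy, entropy_eq, l1, l2, l3]
  have hM₁ : (M₁ : ℝ) ≠ 0 := by positivity
  have hM₂ : (M₂ : ℝ) ≠ 0 := by positivity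
  have e : ∑ _w : Fin M₁ × Fin M₂, Real.negMulLog (1 / ((M₁ : ℝ) * M₂)) =
      Real.log M₁ + Real.log M₂ := by
    rw [one_div, Real.negMulLog, Real.log_inv, Real.log_mul hM₁ hM₂]
    simp
    field_simp
    ring
  rw [e]
  simp only [outEnt, Fintype.sum_prod_type]
  ring

/-- Since the messages are uniform, the equivocation condition follows from the rate and leakage
conditions. -/
theorem Code.equivocation_eq (c : Code X Y₁ Y₂ M₁ M₂ n) (W : Channel X (Y₁ × Y₂ × Z))
    (h₁ : 0 < M₁) (h₂ : 0 < M₂) :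
    c.equivocation W = Real.logb 2 M₁ + Real.logb 2 M₂ - c.leakage W := by
  classical
  have l1 : entropy (c.dist W) (fun ω => ω.1) = Real.logb 2 M₁ + Real.logb 2 M₂ := by
    have hCn := powKernel_mem (marg_mem W.mem_simplex fun y : Y₁ × Y₂ × Z => y.2.2) n
    have l1 : ∀ w, law (c.dist W) (fun ω => ω.1) w = 1 / ((M₁ : ℝ) * M₂) := fun w => by
      rw [law, c.probOf_dist W (fun y => y.2.2) (fun w' _ => w' = w)]
      simp [Finset.sum_ite_irrel, sum_push hCn, c.sum_mass]
    have hM₁ : (M₁ : ℝ) ≠ 0 := by positivity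
    have hM₂ : (M₂ : ℝ) ≠ 0 := by positivity
    simp only [entropy_eq, l1]
    rw [one_div, Real.negMulLog, Real.log_inv, Real.log_mul hM₁ hM₂]
    simp [Real.logb]
    field_simp
    ring
  rw [Code.leakage, mutualInfo, l1, Code.equivocation]
  ring

/-- The error event involves `Y₁` and `Y₂` jointly and is not determined by the marginals. The
converse needs only the error of each user separately, and the achievability the union bound
`Code.errorProb_le`. -/
theorem Code.errorProb_ge₁ [DecidableEq Y₁] (c : Code X Y₁ Y₂ M₁ M₂ n)
    (W : Channel X (Y₁ × Y₂ × Z)) :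
    (∑ w, ∑ b, if c.dec₁ b ≠ some w.1 then push (powKernel n W.toY₁) (c.mass w) b else 0) ≤
      c.errorProb W := by
  classical
  rw [toY₁_eq_marg, ← c.probOf_dist W (fun y => y.1) (fun w b => c.dec₁ b ≠ some w.1)]
  refine Finset.sum_le_sum fun ω _ => Set.indicator_le_indicator_of_subset ?_ ?_ ω
  · exact fun ω h => Or.inl h
  · intro ω
    exact mul_nonneg (c.mass_nonneg ω.1 ω.2.1)
      (Finset.prod_nonneg fun i _ => (W.mem_simplex _).1 _)

theorem Code.errorProb_ge₂ [DecidableEq Y₂] (c : Code X Y₁ Y₂ M₁ M₂ n)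
    (W : Channel X (Y₁ × Y₂ × Z)) :
    (∑ w, ∑ b, if c.dec₂ b ≠ some w.2 then push (powKernel n W.toY₂) (c.mass w) b else 0) ≤
      c.errorProb W := by
  classical
  rw [toY₂_eq_marg, ← c.probOf_dist W (fun y => y.2.1) (fun w b => c.dec₂ b ≠ some w.2)]
  refine Finset.sum_le_sum fun ω _ => Set.indicator_le_indicator_of_subset ?_ ?_ ω
  · exact fun ω h => Or.inr h
  · intro ω
    exact mul_nonneg (c.mass_nonneg ω.1 ω.2.1)
      (Finset.prod_nonneg fun i _ => (W.mem_simplex _).1 _)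

theorem Code.errorProb_le (c : Code X Y₁ Y₂ M₁ M₂ n) (W : Channel X (Y₁ × Y₂ × Z)) :
    c.errorProb W ≤
      (∑ w, ∑ b, if c.dec₁ b ≠ some w.1 then push (powKernel n W.toY₁) (c.mass w) b else 0) +
      ∑ w, ∑ b, if c.dec₂ b ≠ some w.2 then push (powKernel n W.toY₂) (c.mass w) b else 0 := by
  classical
  rw [toY₁_eq_marg, toY₂_eq_marg,
    ← c.probOf_dist W (fun y => y.1) (fun w b => c.dec₁ b ≠ some w.1),
    ← c.probOf_dist W (fun y => y.2.1) (fun w b => c.dec₂ b ≠ some w.2)]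
  simp only [Code.errorProb, probOf_apply]
  rw [← Finset.sum_add_distrib]
  refine Finset.sum_le_sum fun ω _ => ?_
  have : 0 ≤ c.dist W ω := mul_nonneg (c.mass_nonneg ω.1 ω.2.1)
      (Finset.prod_nonneg fun i _ => (W.mem_simplex _).1 _)
  split_ifs <;> simp_all

/-! ### Fano's inequality and the converse for one code. -/

/-- Fano's inequality for an unnormalised mass function and a guess `d`. -/
theorem fano {M : ℕ} (x : Fin M → ℝ) (hx : ∀ w, 0 ≤ x w) (d : Option (Fin M)) :
    massEnt x ≤ Real.log 2 * ∑ w, x w + Real.log M * ∑ w, if d ≠ some w then x w else 0 := by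
  rcases Nat.eq_zero_or_pos M with rfl | hM
  · simp [massEnt]
  have hM' : (1 : ℝ) ≤ M := by exact_mod_cast hM
  set S := ∑ w, x w with hS
  rcases (Finset.sum_nonneg fun w (_ : w ∈ Finset.univ) => hx w).eq_or_lt with h0 | hpos
  · have h1 : ∀ w, x w = 0 := fun w =>
      (Finset.sum_eq_zero_iff_of_nonneg fun k _ => hx k).1 h0.symm w (Finset.mem_univ w)
    simp [massEnt, hS, h1]
  -- Half of the reference mass on the guess and half spread uniformly: a correct guess costs at
  -- most `log 2`, any other value `log (2 M)`. If an error is declared, the total is only one half,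
  -- which is still admissible.
  let q : Fin M → ℝ := fun w => 1 / 2 * (if d = some w then 1 else 0) + 1 / (2 * M)
  have hq : ∀ w, 0 < q w := fun w => by
    simp only [q]
    split_ifs <;> positivity
  have hsq : ∑ w, q w ≤ 1 := by
    simp only [q, Finset.sum_add_distrib, ← Finset.mul_sum]
    have h1 : ∑ w : Fin M, (if d = some w then (1 : ℝ) else 0) ≤ 1 := by
      cases d with
      | none => simp
      | some w0 => simp
    have h2 : ∑ _w : Fin M, 1 / (2 * (M : ℝ)) = 1 / 2 := by
      simp; field_simp
    linarith
  have hg := gibbs (c := fun w => S * q w) hx (fun w => mul_nonneg hpos.le (hq w).le)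
    (fun w h => absurd h (mul_pos hpos (hq w)).ne')
    (by rw [← Finset.mul_sum]; nlinarith)
  have h2 : ∀ w, x w * Real.log (S * q w) ≥
      x w * Real.log S - (Real.log 2 * x w + Real.log M * if d ≠ some w then x w else 0) := by
    intro w
    rw [Real.log_mul hpos.ne' (hq w).ne']
    by_cases h : d = some w
    · have : Real.log (1 / 2) ≤ Real.log (q w) := Real.log_le_log (by norm_num) (by
        simp only [q, h, if_true, mul_one]
        exact le_add_of_nonneg_right (by positivity))
      rw [one_div, Real.log_inv] at this
      simp only [h, ne_eq, not_true_eq_false, if_false]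
      nlinarith [hx w]
    · have : Real.log (1 / (2 * M)) ≤ Real.log (q w) := Real.log_le_log (by positivity) (by
        simp [q, h])
      rw [one_div, Real.log_inv, Real.log_mul two_ne_zero (by positivity)] at this
      simp only [h, ne_eq, not_false_eq_true, if_true]
      nlinarith [hx w]
  have h3 := Finset.sum_le_sum fun w (_ : w ∈ Finset.univ) => h2 w
  simp only [Finset.sum_sub_distrib, Finset.sum_add_distrib, ← Finset.mul_sum, ← Finset.sum_mul,
    ← hS] at h3
  simp only [massEnt, Real.negMulLog, ← hS] at hg ⊢
  linarith

/-- The converse bounds for a single code. -/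
theorem Code.converse [Nonempty X] (c : Code X Y₁ Y₂ M₁ M₂ n) (W : Channel X (Y₁ × Y₂ × Z))
    (Q : Channel Y₁ Z) (hless : IsLessNoisy W.toY₁ W.toY₂)
    (hdeg : IsDegradedThrough W.toZ W.toY₁ Q) (h₁ : 0 < M₁) (h₂ : 0 < M₂) :
    ∃ v ∈ convexHull ℝ (auxValues W.toY₁ W.toY₂ W.toZ),
      (1 - c.errorProb W) * Real.log M₂ ≤ n * v.1 + Real.log 2 + Real.log 2 * c.leakage W ∧
      (1 - c.errorProb W) * (Real.log M₁ + Real.log M₂) ≤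
        n * (v.1 + v.2) + 2 * Real.log 2 + Real.log 2 * c.leakage W := by
  classical
  have hA := toY₁_mem W
  have hB := toY₂_mem W
  have hC := toZ_mem W
  have hAC : W.toZ = compKernel W.toY₁ Q.prob := by
    funext x z
    exact hdeg x z
  have hAn := powKernel_mem hA n
  have hBn := powKernel_mem hB n
  have hCn := powKernel_mem hC n
  have hM₁ : (1 : ℝ) ≤ M₁ := by exact_mod_cast h₁
  have hM₂ : (1 : ℝ) ≤ M₂ := by exact_mod_cast h₂
  have hl₁ := Real.log_nonneg hM₁
  have hl₂ := Real.log_nonneg hM₂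
  -- The second message is the `n`-letter auxiliary variable: below, `n * v.1` is `I(W₂; Y₂ⁿ) -
  -- I(W₂; Zⁿ)` and `n * v.2` bounds `I(Xⁿ; Y₁ⁿ | W₂) - I(Xⁿ; Zⁿ | W₂)`, in nats.
  let m₂ : Fin M₂ → (Fin n → X) → ℝ := fun w₂ => ∑ w₁, c.mass (w₁, w₂)
  have hm₂ : ∀ w₂ x, 0 ≤ m₂ w₂ x := fun w₂ x => by
    simp only [m₂, Finset.sum_apply]
    exact Finset.sum_nonneg fun w₁ _ => c.mass_nonneg _ _
  have hsum : ∑ w₂, m₂ w₂ = ∑ w, c.mass w := by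
    rw [Fintype.sum_prod_type_right]
  obtain ⟨v, hv, hv1, hv2⟩ := exists_mem_convexHull_auxValues hA hB Q.mem_simplex
    (hless.outSuperadd hA hB) n hm₂
  rw [← hAC] at hv hv1 hv2
  have hmass : ∑ w₂, ∑ x, m₂ w₂ x = 1 := by
    rw [← c.sum_sum_mass h₁ h₂, Finset.sum_comm, Finset.sum_comm (γ := Fin M₁ × Fin M₂)]
    refine Finset.sum_congr rfl fun x _ => ?_
    rw [← Finset.sum_apply, ← Finset.sum_apply, hsum]
  rw [hmass, mul_one] at hv1 hv2
  rw [hsum] at hv1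
  refine ⟨v, hv, ?_⟩
  have hleak := c.leakage_eq W h₁ h₂
  rw [eq_div_iff (Real.log_pos one_lt_two).ne'] at hleak
  -- The left side is `H(W₂ | Y₂ⁿ)`.
  have hfano₂ : ∑ w₂, outEnt (powKernel n W.toY₂) (m₂ w₂)
      - outEnt (powKernel n W.toY₂) (∑ w, c.mass w) ≤
        Real.log 2 + Real.log M₂ * c.errorProb W := by
    have h := Finset.sum_le_sum fun y (_ : y ∈ Finset.univ) =>
      fano (fun w₂ => push (powKernel n W.toY₂) (m₂ w₂) y)
        (fun w₂ => push_nonneg hBn (hm₂ w₂) y) (c.dec₂ y)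
    simp only [massEnt, Finset.sum_sub_distrib, Finset.sum_add_distrib, ← Finset.mul_sum,
      ← push_sum, hsum, sum_push hBn] at h
    have e1 : ∑ x, (∑ w, c.mass w) x = 1 := by
      simp only [Finset.sum_apply]
      rw [Finset.sum_comm, c.sum_sum_mass h₁ h₂]
    rw [e1, mul_one, Finset.sum_comm] at h
    have e2 : ∑ y, ∑ w₂, (if c.dec₂ y ≠ some w₂ then push (powKernel n W.toY₂) (m₂ w₂) y else 0) ≤
        c.errorProb W := by
      refine le_trans (le_of_eq ?_) (c.errorProb_ge₂ W)
      rw [Fintype.sum_prod_type_right, Finset.sum_comm]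
      refine Finset.sum_congr rfl fun w₂ _ => ?_
      rw [Finset.sum_comm]
      refine Finset.sum_congr rfl fun y _ => ?_
      simp only [m₂, push_sum]
      split_ifs <;> simp
    have := mul_le_mul_of_nonneg_left e2 hl₂
    simp only [outEnt]
    linarith
  -- The left side is `H(W₁ | W₂, Y₁ⁿ)`.
  have hfano₁ : ∑ w, outEnt (powKernel n W.toY₁) (c.mass w)
      - ∑ w₂, outEnt (powKernel n W.toY₁) (m₂ w₂) ≤
        Real.log 2 + Real.log M₁ * c.errorProb W := by
    have h := Finset.sum_le_sum fun w₂ (_ : w₂ ∈ Finset.univ) =>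
      Finset.sum_le_sum fun y (_ : y ∈ Finset.univ) =>
      fano (fun w₁ => push (powKernel n W.toY₁) (c.mass (w₁, w₂)) y)
        (fun w₁ => push_nonneg hAn (c.mass_nonneg _) y) (c.dec₁ y)
    simp only [massEnt, Finset.sum_sub_distrib, Finset.sum_add_distrib, ← Finset.mul_sum,
      ← push_sum, sum_push hAn] at h
    have e1 : ∑ w₂, ∑ x, (∑ w₁, c.mass (w₁, w₂)) x = 1 := hmass
    rw [e1, mul_one] at h
    have e2 : ∑ w₂, ∑ y, ∑ w₁, (if c.dec₁ y ≠ some w₁ then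
        push (powKernel n W.toY₁) (c.mass (w₁, w₂)) y else 0) ≤ c.errorProb W := by
      refine le_trans (le_of_eq ?_) (c.errorProb_ge₁ W)
      rw [Fintype.sum_prod_type_right]
      refine Finset.sum_congr rfl fun w₂ _ => ?_
      rw [Finset.sum_comm]
    have e3 : ∑ w, outEnt (powKernel n W.toY₁) (c.mass w) = ∑ w₂, ∑ y, ∑ w₁,
        Real.negMulLog (push (powKernel n W.toY₁) (c.mass (w₁, w₂)) y) := by
      rw [Fintype.sum_prod_type_right]
      refine Finset.sum_congr rfl fun w₂ _ => ?_
      simp only [outEnt]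
      rw [Finset.sum_comm]
    have := mul_le_mul_of_nonneg_left e2 hl₁
    rw [e3]
    simp only [outEnt, m₂]
    linarith
  -- `H(W₁ | W₂, Zⁿ) ≤ log M₁`, equivalently `I(W₂; Zⁿ)` is at most the leakage.
  have hconc : ∑ w, outEnt (powKernel n W.toZ) (c.mass w)
      - ∑ w₂, outEnt (powKernel n W.toZ) (m₂ w₂) ≤ Real.log M₁ := by
    have h : ∀ w₂, ∑ w₁, outEnt (powKernel n W.toZ) (c.mass (w₁, w₂)) - Real.log M₁ / M₂ ≤
        outEnt (powKernel n W.toZ) (m₂ w₂) := by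
      intro w₂
      have := outEnt_concave hCn (κ := Fin M₁) (w := fun _ => (M₁ : ℝ)⁻¹)
        ⟨fun _ => by positivity, by simp [(zero_lt_one.trans_le hM₁).ne']⟩
        (m := fun w₁ => (M₁ : ℝ) • c.mass (w₁, w₂))
        (fun w₁ a => mul_nonneg (by positivity) (c.mass_nonneg _ _))
      simp only [smul_smul, inv_mul_cancel₀ (zero_lt_one.trans_le hM₁).ne', one_smul,
        outEnt_smul hCn, c.sum_mass] at this
      refine le_trans (le_of_eq ?_) this
      have hM₁' : (M₁ : ℝ) ≠ 0 := by positivity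
      have hM₂' : (M₂ : ℝ) ≠ 0 := by positivity
      rw [← Finset.mul_sum, Finset.sum_add_distrib, ← Finset.mul_sum]
      simp [Real.negMulLog]
      field_simp
      ring
    have h := Finset.sum_le_sum fun w (_ : w ∈ Finset.univ) => h w
    rw [Finset.sum_sub_distrib] at h
    rw [Fintype.sum_prod_type_right]
    have : ∑ _w : Fin M₂, Real.log M₁ / M₂ = Real.log M₁ := by
      have hM₂' : (M₂ : ℝ) ≠ 0 := by positivity
      simp
      field_simp
    linarith
  -- Given `W₂`, passing from `W₁` to the input `Xⁿ` can only increase the advantage of `Y₁ⁿ` over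
  -- `Zⁿ`, as `Zⁿ` is degraded.
  have hinfo : ∑ w₂, entDiff (powKernel n W.toY₁) (powKernel n W.toZ) (m₂ w₂)
      - ∑ w, entDiff (powKernel n W.toY₁) (powKernel n W.toZ) (c.mass w) ≤
      ∑ w₂, infoDiff (powKernel n W.toY₁) (powKernel n W.toZ) (m₂ w₂) := by
    rw [Fintype.sum_prod_type_right, ← Finset.sum_sub_distrib]
    refine Finset.sum_le_sum fun w₂ _ => entDiff_sub_sum_le_infoDiff hAn hCn ?_
      fun w₁ => c.mass_nonneg _
    rw [hAC, powKernel_compKernel]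
    exact outSuperadd_compKernel hAn (powKernel_mem Q.mem_simplex n)
  simp only [entDiff, Finset.sum_sub_distrib] at hv1 hinfo
  constructor <;> linarith

end Codes


/-! ### The single-letter region: closedness, the asymptotic converse, and its expression by
marginals. -/

section RateRegion

variable {X Y₁ Y₂ Z : Type*} [Fintype X] [Fintype Y₁] [Fintype Y₂] [Fintype Z]

/-- The single-letter region, in terms of the marginal channels and of a convex hull. -/
def rateRegion (A : X → Y₁ → ℝ) (B : X → Y₂ → ℝ) (C : X → Z → ℝ) : Set (ℝ × ℝ) :=
  {R | 0 ≤ R.1 ∧ 0 ≤ R.2 ∧ ∃ v ∈ convexHull ℝ (auxValues A B C),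
    R.2 * Real.log 2 ≤ v.1 ∧ (R.1 + R.2) * Real.log 2 ≤ v.1 + v.2}

/-- The witnesses lie in a compact hull, so a subsequence of them converges along with the rates. -/
theorem isClosed_rateRegion (A : X → Y₁ → ℝ) (B : X → Y₂ → ℝ) (C : X → Z → ℝ) :
    IsClosed (rateRegion A B C) := by
  refine IsSeqClosed.isClosed fun r R hr hR => ?_
  have h1 := (continuous_fst.tendsto R).comp hR
  have h2 := (continuous_snd.tendsto R).comp hR
  choose v hv ha hb using fun n => (hr n).2.2
  obtain ⟨w, hw, φ, hφ, hlim⟩ :=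
    (isCompact_convexHull' (isCompact_auxValues A B C)).tendsto_subseq hv
  have hφ' := hφ.tendsto_atTop
  have l1 := (continuous_fst.tendsto w).comp hlim
  have l2 := (continuous_snd.tendsto w).comp hlim
  refine ⟨ge_of_tendsto' h1 fun n => (hr n).1, ge_of_tendsto' h2 fun n => (hr n).2.1, w, hw, ?_, ?_⟩
  · exact le_of_tendsto_of_tendsto' ((h2.mul_const _).comp hφ') l1 fun n => ha _
  · exact le_of_tendsto_of_tendsto' (((h1.add h2).mul_const _).comp hφ') (l1.add l2)
      fun n => hb _

theorem eventually_lt_of_le_liminf_coe {r : ℝ} {u : ℕ → ℝ}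
    (h : (r : EReal) ≤ liminf (fun n => (u n : EReal)) atTop) :
    ∀ c < r, ∀ᶠ n in atTop, c < u n := by
  intro c hc
  have : (c : EReal) < liminf (fun n => (u n : EReal)) atTop :=
    lt_of_lt_of_le (EReal.coe_lt_coe_iff.2 hc) h
  filter_upwards [eventually_lt_of_lt_liminf this] with n hn
  exact EReal.coe_lt_coe_iff.1 hn

/-- The bounds for single codes, divided by `n`. A limit point `w` of the witnesses is fixed before
the slack `ε` in the rates, so one witness serves for all `ε`. -/
theorem IsAchievable.mem_rateRegion [Nonempty X] {W : Channel X (Y₁ × Y₂ × Z)} {Q : Channel Y₁ Z}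
    (hless : IsLessNoisy W.toY₁ W.toY₂) (hdeg : IsDegradedThrough W.toZ W.toY₁ Q) {R : ℝ × ℝ}
    (hR : IsAchievable W R) : R ∈ rateRegion W.toY₁ W.toY₂ W.toZ := by
  obtain ⟨h₁, h₂, M₁, M₂, c, hM, hr₁, hr₂, herr, -, hleak⟩ := hR
  have hlog2 := Real.log_pos one_lt_two
  choose v hv hv1 hv2 using fun n => (c n).converse W Q hless hdeg (hM n).1 (hM n).2
  have herr' : ∀ᶠ n in atTop, (c n).errorProb W < 1 := herr.eventually (gt_mem_nhds one_pos)
  have hinv : Tendsto (fun n : ℕ => (1 : ℝ) / n) atTop (𝓝 0) := tendsto_one_div_atTop_nhds_zero_nat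
  have key : ∀ c₁ < R.1, ∀ c₂ < R.2,
      ∀ᶠ n : ℕ in atTop,
        (1 - (c n).errorProb W) * (c₂ * Real.log 2) - Real.log 2 * (1 / n)
          - Real.log 2 * ((c n).leakage W / n) ≤ (v n).1 ∧
        (1 - (c n).errorProb W) * ((c₁ + c₂) * Real.log 2) - 2 * Real.log 2 * (1 / n)
          - Real.log 2 * ((c n).leakage W / n) ≤ (v n).1 + (v n).2 := by
    intro c₁ hc₁ c₂ hc₂
    filter_upwards [eventually_lt_of_le_liminf_coe hr₁ c₁ hc₁, eventually_lt_of_le_liminf_coe hr₂ c₂ hc₂,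
      herr', eventually_gt_atTop 0] with n e₁ e₂ e₃ hn
    have hn' : (0 : ℝ) < n := by exact_mod_cast hn
    rw [lt_div_iff₀ hn', Real.logb, lt_div_iff₀ hlog2] at e₁ e₂
    have hp : 0 ≤ 1 - (c n).errorProb W := by linarith
    have f₁ := mul_le_mul_of_nonneg_left e₁.le hp
    have f₂ := mul_le_mul_of_nonneg_left e₂.le hp
    have g₁ := hv1 n
    have g₂ := hv2 n
    constructor
    · refine le_of_mul_le_mul_left ?_ hn'
      have : (n : ℝ) * ((1 - (c n).errorProb W) * (c₂ * Real.log 2) - Real.log 2 * (1 / n)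
          - Real.log 2 * ((c n).leakage W / n)) =
          (1 - (c n).errorProb W) * (c₂ * n * Real.log 2) - Real.log 2
          - Real.log 2 * (c n).leakage W := by
        field_simp
      rw [this]
      linarith
    · refine le_of_mul_le_mul_left ?_ hn'
      have : (n : ℝ) * ((1 - (c n).errorProb W) * ((c₁ + c₂) * Real.log 2)
          - 2 * Real.log 2 * (1 / n) - Real.log 2 * ((c n).leakage W / n)) =
          (1 - (c n).errorProb W) * (c₁ * n * Real.log 2)
          + (1 - (c n).errorProb W) * (c₂ * n * Real.log 2) - 2 * Real.log 2
          - Real.log 2 * (c n).leakage W := by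
        field_simp
      rw [this]
      linarith
  obtain ⟨w, hw, φ, hφ, hlim⟩ := (isCompact_convexHull'
    (isCompact_auxValues W.toY₁ W.toY₂ W.toZ)).tendsto_subseq hv
  have hφ' := hφ.tendsto_atTop
  have l1 := (continuous_fst.tendsto w).comp hlim
  have l2 := (continuous_snd.tendsto w).comp hlim
  have main : ∀ ε > 0, (R.2 - ε) * Real.log 2 ≤ w.1 ∧
      (R.1 - ε + (R.2 - ε)) * Real.log 2 ≤ w.1 + w.2 := by
    intro ε hε
    have hk := hφ'.eventually (key (R.1 - ε) (by linarith) (R.2 - ε) (by linarith))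
    have t : ∀ s k : ℝ, Tendsto (fun n : ℕ => (1 - (c n).errorProb W) * s - k * (1 / n)
          - Real.log 2 * ((c n).leakage W / n)) atTop (𝓝 s) := by
      intro s k
      have := (((herr.const_sub 1).mul_const s).sub (hinv.const_mul k)).sub
        (hleak.const_mul (Real.log 2))
      simpa using this
    exact ⟨le_of_tendsto_of_tendsto ((t _ _).comp hφ') l1 (hk.mono fun n h => h.1),
      le_of_tendsto_of_tendsto ((t _ _).comp hφ') (l1.add l2) (hk.mono fun n h => h.2)⟩
  refine ⟨h₁, h₂, w, hw, ?_, ?_⟩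
  · refine le_of_forall_pos_le_add fun ε hε => ?_
    have := (main (ε / Real.log 2) (by positivity)).1
    rw [sub_mul, div_mul_cancel₀ _ hlog2.ne'] at this
    linarith
  · refine le_of_forall_pos_le_add fun ε hε => ?_
    have := (main (ε / 2 / Real.log 2) (by positivity)).2
    rw [add_mul, sub_mul, sub_mul, div_mul_cancel₀ _ hlog2.ne'] at this
    linarith

/-! ### The single-letter region in terms of the marginal channels -/

variable {kT kU : ℕ}

/-- The joint mass function of `(T, U, X)`. -/
def auxMass (PT : Fin kT → ℝ) (PU : Channel (Fin kT) (Fin kU)) (PX : Channel (Fin kU) X)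
    (t : Fin kT) (u : Fin kU) (x : X) : ℝ := PT t * PU.prob t u * PX.prob u x

theorem law_auxDist {β δ : Type*} [Fintype β] [Fintype δ] [DecidableEq β] [DecidableEq δ] (PT : Fin kT → ℝ)
    (PU : Channel (Fin kT) (Fin kU)) (PX : Channel (Fin kU) X) (W : Channel X (Y₁ × Y₂ × Z))
    (π : Y₁ × Y₂ × Z → β) (F : Fin kT → Fin kU → X → β → δ) (d : δ) :
    law (auxDist PT PU PX W) (fun ω => F ω.1 ω.2.1 ω.2.2.1 (π ω.2.2.2)) d =
      ∑ t, ∑ u, ∑ x, ∑ b, if F t u x b = d then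
        auxMass PT PU PX t u x * marg W.prob π x b else 0 := by
  rw [law_apply, Fintype.sum_prod_type]
  refine Finset.sum_congr rfl fun t _ => ?_
  rw [Fintype.sum_prod_type]
  refine Finset.sum_congr rfl fun u _ => ?_
  rw [Fintype.sum_prod_type]
  refine Finset.sum_congr rfl fun x _ => ?_
  simp only [auxDist, auxMass, marg, Finset.mul_sum]
  have h : ∀ b, (if F t u x b = d then ∑ y, PT t * PU.prob t u * PX.prob u x *
      (if π y = b then W.prob x y else 0) else 0) = ∑ y, if π y = b then
        (if F t u x b = d then PT t * PU.prob t u * PX.prob u x * W.prob x y else 0) else 0 := by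
    intro b
    split_ifs <;> simp
  simp only [h]
  rw [Finset.sum_comm]
  simp

variable (PT : Fin kT → ℝ) (PU : Channel (Fin kT) (Fin kU)) (PX : Channel (Fin kU) X)
  (W : Channel X (Y₁ × Y₂ × Z))

theorem sum_prod_reverse {α β κ τ : Type*} [Fintype α] [Fintype β] [Fintype κ] [Fintype τ]
    (F : α → β → κ → τ → ℝ) :
    ∑ p : α × β × κ × τ, F p.1 p.2.1 p.2.2.1 p.2.2.2 = ∑ t, ∑ k, ∑ a, ∑ b, F a b k t := by
  rw [Finset.sum_comm, ← Fintype.sum_prod_type' (f := fun k t => ∑ a, ∑ b, F a b k t),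
    Finset.sum_comm, Fintype.sum_prod_type]
  refine Finset.sum_congr rfl fun a _ => ?_
  rw [Finset.sum_comm, Fintype.sum_prod_type]

/-- `H(U | T)` is left unexpanded: it does not depend on `π` and cancels in `condMutualInfo_U_sub`.
-/
theorem condMutualInfo_U_T {β : Type*} [Fintype β] [DecidableEq β] (π : Y₁ × Y₂ × Z → β) :
    condMutualInfo (auxDist PT PU PX W) (fun ω => ω.2.1) (fun ω => π ω.2.2.2) (fun ω => ω.1) =
      condEntropy (auxDist PT PU PX W) (fun ω => ω.2.1) (fun ω => ω.1) +
      (∑ t, outEnt (marg W.prob π) (∑ u, auxMass PT PU PX t u)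
        - ∑ t, ∑ u, outEnt (marg W.prob π) (auxMass PT PU PX t u)) / Real.log 2 := by
  have l1 : ∀ a : Fin kU × β × Fin kT,
      law (auxDist PT PU PX W) (fun ω => (ω.2.1, π ω.2.2.2, ω.1)) a =
        push (marg W.prob π) (auxMass PT PU PX a.2.2 a.1) a.2.1 := by
    rintro ⟨u, b, t⟩
    rw [law_auxDist PT PU PX W π (fun t u _ b => (u, b, t))]
    simp only [Prod.mk.injEq, ite_and]
    simp [Finset.sum_ite_irrel, push]
  have l2 : ∀ a : β × Fin kT, law (auxDist PT PU PX W) (fun ω => (π ω.2.2.2, ω.1)) a =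
        push (marg W.prob π) (∑ u, auxMass PT PU PX a.2 u) a.1 := by
    rintro ⟨b, t⟩
    rw [law_auxDist PT PU PX W π (fun t _ _ b => (b, t)), push_sum]
    simp only [Prod.mk.injEq, ite_and]
    simp [Finset.sum_ite_irrel, push]
  rw [condMutualInfo]
  conv_lhs => arg 2; rw [condEntropy]
  simp only [entropy_eq, l1, l2]
  simp only [outEnt, Fintype.sum_prod_type]
  have e1 : ∑ x : Fin kU, ∑ b : β, ∑ t : Fin kT,
      Real.negMulLog (push (marg W.prob π) (auxMass PT PU PX t x) b) = ∑ t, ∑ u, ∑ b,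
      Real.negMulLog (push (marg W.prob π) (auxMass PT PU PX t u) b) := by
    rw [Finset.sum_comm (γ := Fin kT)]
    refine Finset.sum_congr rfl fun u _ => ?_
    rw [Finset.sum_comm]
  rw [e1, Finset.sum_comm (γ := β)]
  ring

theorem condMutualInfo_U_sub :
    condMutualInfo (auxDist PT PU PX W)
        (fun ω => ω.2.1) (fun ω => ω.2.2.2.2.1) (fun ω => ω.1)
      - condMutualInfo (auxDist PT PU PX W)
        (fun ω => ω.2.1) (fun ω => ω.2.2.2.2.2) (fun ω => ω.1) =
      (∑ t, (entDiff W.toY₂ W.toZ (∑ u, auxMass PT PU PX t u)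
        - ∑ u, entDiff W.toY₂ W.toZ (auxMass PT PU PX t u))) / Real.log 2 := by
  classical
  rw [condMutualInfo_U_T PT PU PX W (fun y => y.2.1), condMutualInfo_U_T PT PU PX W (fun y => y.2.2),
    toY₂_eq_marg, toZ_eq_marg]
  simp only [entDiff, Finset.sum_sub_distrib]
  ring

/-- By the Markov property, `H(Z | Y₁)` is the same with or without conditioning on `X`, so it
cancels. What remains is `I(X; Y₁ | U, T) - I(X; Z | U, T)`, a function of the two marginals. -/
theorem condMutualInfo_X (Q : Channel Y₁ Z)
    (hQ : ∀ x y₁ z, W.toY₁Z x y₁ z = W.toY₁ x y₁ * Q.prob y₁ z) :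
    condMutualInfo (auxDist PT PU PX W)
        (fun ω => ω.2.2.1) (fun ω => ω.2.2.2.1) (fun ω => (ω.2.2.2.2.2, ω.2.1, ω.1)) =
      (∑ t, ∑ u, infoDiff W.toY₁ W.toZ (auxMass PT PU PX t u)) / Real.log 2 := by
  classical
  have hA := toY₁_mem W
  have hC := toZ_mem W
  have hV : ∀ x b, marg W.prob (fun y => (y.1, y.2.2)) x b = W.toY₁ x b.1 * Q.prob b.1 b.2 := by
    rintro x ⟨y, z⟩
    rw [← hQ]
    simp only [marg, Channel.toY₁Z, Fintype.sum_prod_type, Prod.mk.injEq, ite_and]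
    simp [Finset.sum_ite_irrel]
  have l1 : ∀ a : X × Z × Fin kU × Fin kT,
      law (auxDist PT PU PX W) (fun ω => (ω.2.2.1, ω.2.2.2.2.2, ω.2.1, ω.1)) a =
        auxMass PT PU PX a.2.2.2 a.2.2.1 a.1 * W.toZ a.1 a.2.1 := by
    rintro ⟨x, z, u, t⟩
    rw [law_auxDist PT PU PX W (fun y => y.2.2) (fun t u x z => (x, z, u, t)), toZ_eq_marg]
    simp only [Prod.mk.injEq, ite_and]
    simp [Finset.sum_ite_irrel]
  have l2 : ∀ a : Z × Fin kU × Fin kT,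
      law (auxDist PT PU PX W) (fun ω => (ω.2.2.2.2.2, ω.2.1, ω.1)) a =
        push W.toZ (auxMass PT PU PX a.2.2 a.2.1) a.1 := by
    rintro ⟨z, u, t⟩
    rw [law_auxDist PT PU PX W (fun y => y.2.2) (fun t u x z => (z, u, t)), toZ_eq_marg]
    simp only [Prod.mk.injEq, ite_and]
    simp [Finset.sum_ite_irrel, push]
  have l3 : ∀ a : X × Y₁ × Z × Fin kU × Fin kT,
      law (auxDist PT PU PX W) (fun ω => (ω.2.2.1, ω.2.2.2.1, ω.2.2.2.2.2, ω.2.1, ω.1)) a =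
        auxMass PT PU PX a.2.2.2.2 a.2.2.2.1 a.1 * W.toY₁ a.1 a.2.1 * Q.prob a.2.1 a.2.2.1 := by
    rintro ⟨x, y, z, u, t⟩
    rw [law_auxDist PT PU PX W (fun y => (y.1, y.2.2)) (fun t u x b => (x, b.1, b.2, u, t))]
    simp only [hV, Fintype.sum_prod_type, Prod.mk.injEq, ite_and]
    simp [Finset.sum_ite_irrel, mul_assoc]
  have l4 : ∀ a : Y₁ × Z × Fin kU × Fin kT,
      law (auxDist PT PU PX W) (fun ω => (ω.2.2.2.1, ω.2.2.2.2.2, ω.2.1, ω.1)) a =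
        push W.toY₁ (auxMass PT PU PX a.2.2.2 a.2.2.1) a.1 * Q.prob a.1 a.2.1 := by
    rintro ⟨y, z, u, t⟩
    rw [law_auxDist PT PU PX W (fun y => (y.1, y.2.2)) (fun t u x b => (b.1, b.2, u, t))]
    simp only [hV, Fintype.sum_prod_type, Prod.mk.injEq, ite_and]
    simp [Finset.sum_ite_irrel, push, mul_assoc, Finset.sum_mul]
  simp only [condMutualInfo, condEntropy, entropy_eq, l1, l2, l3, l4]
  set m := auxMass PT PU PX with hm
  have s1 : ∑ a : X × Z × Fin kU × Fin kT,
      Real.negMulLog (m a.2.2.2 a.2.2.1 a.1 * W.toZ a.1 a.2.1) =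
      ∑ t, ∑ u, (∑ x, Real.negMulLog (m t u x) + ∑ x, m t u x * rowEnt W.toZ x) := by
    simp only [← sum_negMulLog_joint hC]
    exact sum_prod_reverse fun x z u t => Real.negMulLog (m t u x * W.toZ x z)
  have s2 : ∑ a : Z × Fin kU × Fin kT, Real.negMulLog (push W.toZ (m a.2.2 a.2.1) a.1) =
      ∑ t, ∑ u, outEnt W.toZ (m t u) := by
    simp only [outEnt]
    rw [Fintype.sum_prod_type_right, Fintype.sum_prod_type_right]
  have s3 : ∑ a : X × Y₁ × Z × Fin kU × Fin kT, Real.negMulLog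
      (m a.2.2.2.2 a.2.2.2.1 a.1 * W.toY₁ a.1 a.2.1 * Q.prob a.2.1 a.2.2.1) =
      ∑ t, ∑ u, (∑ x, Real.negMulLog (m t u x) + ∑ x, m t u x * rowEnt W.toY₁ x +
        ∑ y, push W.toY₁ (m t u) y * rowEnt Q.prob y) := by
    have e : ∀ t u, ∑ x, ∑ y, ∑ z, Real.negMulLog (m t u x * W.toY₁ x y * Q.prob y z) =
        ∑ x, Real.negMulLog (m t u x) + ∑ x, m t u x * rowEnt W.toY₁ x +
        ∑ y, push W.toY₁ (m t u) y * rowEnt Q.prob y := by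
      intro t u
      simp only [sum_negMulLog_joint Q.mem_simplex, Finset.sum_add_distrib,
        sum_negMulLog_joint hA, push, Finset.sum_mul]
      rw [Finset.sum_comm (γ := Y₁)]
    simp only [← e]
    rw [Fintype.sum_prod_type]
    refine (Finset.sum_congr rfl fun x _ => sum_prod_reverse fun y z u t =>
      Real.negMulLog (m t u x * W.toY₁ x y * Q.prob y z)).trans ?_
    rw [Finset.sum_comm]
    refine Finset.sum_congr rfl fun t _ => ?_
    rw [Finset.sum_comm]
  have s4 : ∑ a : Y₁ × Z × Fin kU × Fin kT,
      Real.negMulLog (push W.toY₁ (m a.2.2.2 a.2.2.1) a.1 * Q.prob a.1 a.2.1) =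
      ∑ t, ∑ u, (outEnt W.toY₁ (m t u) + ∑ y, push W.toY₁ (m t u) y * rowEnt Q.prob y) := by
    simp only [outEnt, ← sum_negMulLog_joint Q.mem_simplex]
    exact sum_prod_reverse fun y z u t =>
      Real.negMulLog (push W.toY₁ (m t u) y * Q.prob y z)
  rw [s1, s2, s3, s4]
  simp only [infoDiff, mul_sub, Finset.sum_sub_distrib, Finset.sum_add_distrib]
  ring

/-- The rates allowed by a choice of the auxiliary laws. -/
theorem mem_singleLetterRegion_iff (Q : Channel Y₁ Z)
    (hQ : ∀ x y₁ z, W.toY₁Z x y₁ z = W.toY₁ x y₁ * Q.prob y₁ z) (R : ℝ × ℝ) :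
    R ∈ singleLetterRegion W ↔ 0 ≤ R.1 ∧ 0 ≤ R.2 ∧
      ∃ (kT kU : ℕ) (PT : Fin kT → ℝ) (PU : Channel (Fin kT) (Fin kU)) (PX : Channel (Fin kU) X),
        PT ∈ stdSimplex ℝ (Fin kT) ∧
        R.2 * Real.log 2 ≤ ∑ t, (entDiff W.toY₂ W.toZ (∑ u, auxMass PT PU PX t u)
          - ∑ u, entDiff W.toY₂ W.toZ (auxMass PT PU PX t u)) ∧
        (R.1 + R.2) * Real.log 2 ≤ ∑ t, (entDiff W.toY₂ W.toZ (∑ u, auxMass PT PU PX t u)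
          - ∑ u, entDiff W.toY₂ W.toZ (auxMass PT PU PX t u)) +
          ∑ t, ∑ u, infoDiff W.toY₁ W.toZ (auxMass PT PU PX t u) := by
  have hlog := Real.log_pos one_lt_two
  simp only [singleLetterRegion, Set.mem_ofPred_eq, add_sub_assoc, condMutualInfo_U_sub,
    condMutualInfo_X _ _ _ _ Q hQ, ← add_div, le_div_iff₀ hlog]
  simp only [add_comm (∑ t, ∑ u, _)]

theorem auxMass_eq_smul (t : Fin kT) (u : Fin kU) :
    auxMass PT PU PX t u = (PT t * PU.prob t u) • PX.prob u := rfl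

/-- Every point of the convex hull of the single-letter values is given by auxiliary laws. -/
theorem exists_auxMass_of_mem_convexHull {A : X → Y₁ → ℝ} {B : X → Y₂ → ℝ} {C : X → Z → ℝ}
    (hA : ∀ a, A a ∈ stdSimplex ℝ Y₁) (hB : ∀ a, B a ∈ stdSimplex ℝ Y₂)
    (hC : ∀ a, C a ∈ stdSimplex ℝ Z) {v : ℝ × ℝ} (hv : v ∈ convexHull ℝ (auxValues A B C)) :
    ∃ (kT kU : ℕ) (PT : Fin kT → ℝ) (PU : Channel (Fin kT) (Fin kU)) (PX : Channel (Fin kU) X),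
      PT ∈ stdSimplex ℝ (Fin kT) ∧
      v.1 = ∑ t, (entDiff B C (∑ u, auxMass PT PU PX t u)
          - ∑ u, entDiff B C (auxMass PT PU PX t u)) ∧
      v.2 = ∑ t, ∑ u, infoDiff A C (auxMass PT PU PX t u) := by
  classical
  -- The weights of the outer hull become the law of `T`; those of the hull inside `auxValues`
  -- become the law of `U` given `T`.
  obtain ⟨τ, _, w, z, hw, hw1, hz, rfl⟩ := mem_convexHull_iff_exists_fintype.1 hv
  choose s hs hsz using hz
  choose ι hι w' z' hw' hw'1 hz' hs' using fun t => mem_convexHull_iff_exists_fintype.1 (hs t)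
  choose q hq hqz using hz'
  let eT := Fintype.equivFin τ
  -- `U` ranges over a disjoint union, so its value determines `t`; this is what allows the input
  -- law to depend on `U` alone.
  let eU := Fintype.equivFin (Σ t, ι t)
  let PT : Fin (Fintype.card τ) → ℝ := fun t => w (eT.symm t)
  let wU : τ → (Σ t, ι t) → ℝ := fun t p => if h : p.1 = t then w' t (h ▸ p.2) else 0
  have hwU : ∀ (t : τ) (F : (Σ t, ι t) → ℝ), ∑ p, wU t p * F p = ∑ i, w' t i * F ⟨t, i⟩ := by
    intro t F
    rw [Fintype.sum_sigma, Finset.sum_eq_single t]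
    · simp [wU]
    · intro t' _ ht'
      simp [wU, ht']
    · simp
  let PU : Channel (Fin (Fintype.card τ)) (Fin (Fintype.card (Σ t, ι t))) :=
    { prob := fun t u => wU (eT.symm t) (eU.symm u)
      mem_simplex := fun t => ⟨fun u => by
          simp only [wU]
          split_ifs
          · exact hw' _ _
          · exact le_rfl, by
          rw [Equiv.sum_comp eU.symm (wU (eT.symm t))]
          have := hwU (eT.symm t) (fun _ => 1)
          simpa [hw'1] using this⟩ }
  let PX : Channel (Fin (Fintype.card (Σ t, ι t))) X :=
    { prob := fun u => q (eU.symm u).1 (eU.symm u).2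
      mem_simplex := fun u => hq _ _ }
  have hPU : ∀ t (F : (Σ t, ι t) → ℝ), ∑ u, PU.prob t u * F (eU.symm u) =
      ∑ i, w' (eT.symm t) i * F ⟨eT.symm t, i⟩ := fun t F => by
    rw [← hwU, ← Equiv.sum_comp eU.symm]
  have hmix : ∀ t, ∑ u, auxMass PT PU PX t u =
      w (eT.symm t) • ∑ i, w' (eT.symm t) i • q (eT.symm t) i := fun t => by
    funext x
    have := hPU t (fun p => q p.1 p.2 x)
    simp only [Finset.sum_apply, Pi.smul_apply, smul_eq_mul, ← this, Finset.mul_sum]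
    exact Finset.sum_congr rfl fun u _ => mul_assoc _ _ _
  have hs1 : ∀ t, (s t).1 = ∑ i, w' t i • q t i := fun t => by
    rw [← hs' t]
    simp only [Prod.fst_sum, Prod.smul_fst, ← hqz]
  have hs2 : ∀ t, (s t).2.1 = ∑ i, w' t i * entDiff B C (q t i) := fun t => by
    rw [← hs' t]
    simp only [Prod.fst_sum, Prod.snd_sum, Prod.smul_fst, Prod.smul_snd, ← hqz, smul_eq_mul]
  have hs3 : ∀ t, (s t).2.2 = ∑ i, w' t i * infoDiff A C (q t i) := fun t => by
    rw [← hs' t]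
    simp only [Prod.snd_sum, Prod.smul_snd, ← hqz, smul_eq_mul]
  refine ⟨_, _, PT, PU, PX, ⟨fun t => hw _, ?_⟩, ?_, ?_⟩
  · simp only [PT]
    rw [Equiv.sum_comp eT.symm w, hw1]
  · simp only [Prod.fst_sum, Prod.smul_fst, smul_eq_mul, ← hsz]
    rw [← Equiv.sum_comp eT.symm]
    refine Finset.sum_congr rfl fun t _ => ?_
    rw [hmix, entDiff_smul hB hC, hs1, hs2, mul_sub]
    congr 1
    have := hPU t (fun p => entDiff B C (q p.1 p.2))
    simp only [auxMass_eq_smul, entDiff_smul hB hC, ← this, Finset.mul_sum]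
    exact Finset.sum_congr rfl fun u _ => (mul_assoc _ _ _).symm
  · simp only [Prod.snd_sum, Prod.smul_snd, smul_eq_mul, ← hsz]
    rw [← Equiv.sum_comp eT.symm]
    refine Finset.sum_congr rfl fun t _ => ?_
    rw [hs3]
    have := hPU t (fun p => infoDiff A C (q p.1 p.2))
    simp only [auxMass_eq_smul, infoDiff_smul hA hC, ← this, Finset.mul_sum]
    exact Finset.sum_congr rfl fun u _ => (mul_assoc _ _ _).symm

theorem rateRegion_subset_singleLetterRegion (Q : Channel Y₁ Z)
    (hQ : ∀ x y₁ z, W.toY₁Z x y₁ z = W.toY₁ x y₁ * Q.prob y₁ z) :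
    rateRegion W.toY₁ W.toY₂ W.toZ ⊆ singleLetterRegion W := by
  rintro R ⟨h₁, h₂, v, hv, e₁, e₂⟩
  obtain ⟨kT, kU, PT, PU, PX, hPT, f₁, f₂⟩ :=
    exists_auxMass_of_mem_convexHull (toY₁_mem W) (toY₂_mem W) (toZ_mem W) hv
  rw [mem_singleLetterRegion_iff W Q hQ]
  exact ⟨h₁, h₂, kT, kU, PT, PU, PX, hPT, f₁ ▸ e₁, f₁ ▸ f₂ ▸ e₂⟩

end RateRegion


/-! ### Expectations under finite laws and their products -/

section Expect

variable {Ω ι κ U X J : Type*} [Fintype Ω] [Fintype ι] [Fintype κ] [Fintype U] [Fintype X]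
  [Fintype J]

/-- The expectation of `G` under the mass function `p`. -/
def expect (p G : Ω → ℝ) : ℝ := ∑ ω, p ω * G ω

theorem expect_add (p G H : Ω → ℝ) :
    expect p (fun ω => G ω + H ω) = expect p G + expect p H := by
  simp [expect, mul_add, Finset.sum_add_distrib]

theorem expect_sub (p G H : Ω → ℝ) :
    expect p (fun ω => G ω - H ω) = expect p G - expect p H := by
  simp [expect, mul_sub, Finset.sum_sub_distrib]

theorem expect_const_mul (p G : Ω → ℝ) (c : ℝ) :
    expect p (fun ω => c * G ω) = c * expect p G := by
  simp only [expect, Finset.mul_sum]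
  exact Finset.sum_congr rfl fun _ _ => by ring

theorem expect_mul_const (p G : Ω → ℝ) (c : ℝ) :
    expect p (fun ω => G ω * c) = expect p G * c := by
  simp only [expect, Finset.sum_mul]
  exact Finset.sum_congr rfl fun _ _ => by ring

theorem expect_sum {α : Type*} (s : Finset α) (p : Ω → ℝ) (G : α → Ω → ℝ) :
    expect p (fun ω => ∑ a ∈ s, G a ω) = ∑ a ∈ s, expect p (G a) := by
  simp only [expect, Finset.mul_sum]
  exact Finset.sum_comm

theorem expect_const {p : Ω → ℝ} (hp : p ∈ stdSimplex ℝ Ω) (c : ℝ) :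
    expect p (fun _ => c) = c := by
  simp [expect, ← Finset.sum_mul, hp.2]

theorem expect_mono {p : Ω → ℝ} (hp : p ∈ stdSimplex ℝ Ω) {G H : Ω → ℝ}
    (h : ∀ ω, 0 < p ω → G ω ≤ H ω) : expect p G ≤ expect p H := by
  refine Finset.sum_le_sum fun ω _ => ?_
  rcases (hp.1 ω).eq_or_lt with h0 | h0
  · simp [← h0]
  · exact mul_le_mul_of_nonneg_left (h ω h0) h0.le

theorem expect_nonneg {p : Ω → ℝ} (hp : p ∈ stdSimplex ℝ Ω) {G : Ω → ℝ} (h : ∀ ω, 0 ≤ G ω) :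
    0 ≤ expect p G := Finset.sum_nonneg fun ω _ => mul_nonneg (hp.1 ω) (h ω)

theorem exists_le_expect {p : Ω → ℝ} (hp : p ∈ stdSimplex ℝ Ω) (G : Ω → ℝ) :
    ∃ ω, G ω ≤ expect p G := by
  by_contra! h
  have h1 : ∃ ω ∈ (Finset.univ : Finset Ω), 0 < p ω := by
    by_contra! h0
    have := Finset.sum_nonpos h0
    rw [hp.2] at this
    linarith
  obtain ⟨ω₀, -, h0⟩ := h1
  have : ∑ ω, p ω * expect p G < ∑ ω, p ω * G ω :=
    Finset.sum_lt_sum (fun ω _ => mul_le_mul_of_nonneg_left (h ω).le (hp.1 ω))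
      ⟨ω₀, Finset.mem_univ _, mul_lt_mul_of_pos_left (h ω₀) h0⟩
  rw [← Finset.sum_mul, hp.2, one_mul] at this
  exact lt_irrefl _ this

/-- The law of an i.i.d. family. -/
def piLaw (p : Ω → ℝ) (ω : ι → Ω) : ℝ := ∏ i, p (ω i)

theorem piLaw_mem {p : Ω → ℝ} (hp : p ∈ stdSimplex ℝ Ω) [DecidableEq ι] :
    (piLaw p : (ι → Ω) → ℝ) ∈ stdSimplex ℝ (ι → Ω) := by
  refine ⟨fun ω => Finset.prod_nonneg fun i _ => hp.1 _, ?_⟩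
  simp only [piLaw]
  rw [sum_prod_pi fun (_ : ι) ω => p ω]
  simp [hp.2]

theorem expect_piLaw_apply_mul [DecidableEq ι] {p : Ω → ℝ} (hp : p ∈ stdSimplex ℝ Ω) {a b : ι}
    (hab : a ≠ b) (f g : Ω → ℝ) :
    expect (piLaw p) (fun ω => f (ω a) * g (ω b)) = expect p f * expect p g := by
  have h1 : ∀ ω : ι → Ω, piLaw p ω * (f (ω a) * g (ω b)) =
      ∏ i, (p (ω i) * ((if i = a then f (ω i) else 1) * (if i = b then g (ω i) else 1))) := by
    intro ω
    rw [Finset.prod_mul_distrib, Finset.prod_mul_distrib]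
    simp [piLaw]
  have h2 : ∀ i, ∑ x, (p x * ((if i = a then f x else 1) * (if i = b then g x else 1))) =
      (if i = a then expect p f else 1) * (if i = b then expect p g else 1) := by
    intro i
    by_cases ha : i = a
    · have hb : i ≠ b := fun h => hab (ha.symm.trans h)
      simp [ha, hab, expect]
    · by_cases hb : i = b
      · simp [hb, hab.symm, expect]
      · simp [ha, hb, hp.2]
  simp only [expect, h1] at *
  rw [sum_prod_pi fun (i : ι) x =>
    p x * ((if i = a then f x else 1) * (if i = b then g x else 1))]
  simp only [h2, Finset.prod_mul_distrib]
  simp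

theorem expect_piLaw_apply [DecidableEq ι] {p : Ω → ℝ} (hp : p ∈ stdSimplex ℝ Ω) (a : ι)
    (f : Ω → ℝ) : expect (piLaw p) (fun ω => f (ω a)) = expect p f := by
  have h1 : ∀ ω : ι → Ω, piLaw p ω * f (ω a) = ∏ i, (p (ω i) * (if i = a then f (ω i) else 1)) := by
    intro ω
    rw [Finset.prod_mul_distrib]
    simp [piLaw]
  have h2 : ∀ i, ∑ x, (p x * (if i = a then f x else 1)) = if i = a then expect p f else 1 := by
    intro i
    by_cases ha : i = a
    · simp [ha, expect]
    · simp [ha, hp.2]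
  simp only [expect, h1] at *
  rw [sum_prod_pi fun (i : ι) x => p x * (if i = a then f x else 1)]
  simp only [h2]
  simp

/-! ### Random superposition codebooks -/

/-- The law of a cloud centre with its satellites. -/
def cloudLaw (pU : U → ℝ) (pX : U → X → ℝ) (c : U × (J → X)) : ℝ := pU c.1 * piLaw (pX c.1) c.2

variable {pU : U → ℝ} {pX : U → X → ℝ}

theorem expect_cloudLaw (pU : U → ℝ) (pX : U → X → ℝ) (G : U × (J → X) → ℝ) [DecidableEq J] :
    expect (cloudLaw pU pX) G = expect pU fun u => expect (piLaw (pX u)) fun x => G (u, x) := by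
  simp only [expect, cloudLaw, Fintype.sum_prod_type, Finset.mul_sum, mul_assoc]

theorem cloudLaw_mem [DecidableEq J] (hU : pU ∈ stdSimplex ℝ U)
    (hX : ∀ u, pX u ∈ stdSimplex ℝ X) :
    (cloudLaw pU pX : U × (J → X) → ℝ) ∈ stdSimplex ℝ (U × (J → X)) := by
  refine ⟨fun c => mul_nonneg (hU.1 _) ((piLaw_mem (hX _)).1 _), ?_⟩
  have := expect_cloudLaw (J := J) pU pX fun _ => 1
  simp only [expect_const (piLaw_mem (hX _)), expect_const hU] at this
  simpa [expect] using this

theorem expect_cloudLaw_apply [DecidableEq J] (hX : ∀ u, pX u ∈ stdSimplex ℝ X) (j : J)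
    (F : U → X → ℝ) : expect (cloudLaw pU pX) (fun c => F c.1 (c.2 j)) =
      expect pU fun u => expect (pX u) (F u) := by
  rw [expect_cloudLaw]
  simp only [expect_piLaw_apply (hX _)]

theorem expect_cloudLaw_apply_mul [DecidableEq J] (hX : ∀ u, pX u ∈ stdSimplex ℝ X) {j j' : J}
    (hj : j ≠ j') (F : U → X → ℝ) (K : X → ℝ) :
    expect (cloudLaw pU pX) (fun c => F c.1 (c.2 j) * K (c.2 j')) =
      expect pU fun u => expect (pX u) (F u) * expect (pX u) K := by
  rw [expect_cloudLaw]
  simp only [expect_piLaw_apply_mul (hX _) hj (F _) K]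

variable {I : Type*} [Fintype I]

/-- The law of a random superposition codebook. -/
abbrev codebookLaw (pU : U → ℝ) (pX : U → X → ℝ) : (I → U × (J → X)) → ℝ :=
  piLaw (cloudLaw pU pX)

/-- The total weight of the codewords in `A × B` other than `(i, j)`. -/
def interference [DecidableEq I] [DecidableEq J] (K : X → ℝ) (A : Finset I) (B : Finset J) (i : I)
    (j : J) (cb : I → U × (J → X)) : ℝ :=
  ∑ j' ∈ B.erase j, K ((cb i).2 j') + ∑ i' ∈ A.erase i, ∑ j' ∈ B, K ((cb i').2 j')

theorem add_interference [DecidableEq I] [DecidableEq J] (K : X → ℝ) {A : Finset I} {B : Finset J}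
    {i : I} {j : J} (hi : i ∈ A) (hj : j ∈ B) (cb : I → U × (J → X)) :
    K ((cb i).2 j) + interference K A B i j cb = ∑ i' ∈ A, ∑ j' ∈ B, K ((cb i').2 j') := by
  rw [interference, ← add_assoc, Finset.add_sum_erase B (fun j' => K ((cb i).2 j')) hj,
    Finset.add_sum_erase A (fun i' => ∑ j' ∈ B, K ((cb i').2 j')) hi]

theorem interference_nonneg [DecidableEq I] [DecidableEq J] {K : X → ℝ} (hK : ∀ x, 0 ≤ K x)
    (A : Finset I) (B : Finset J) (i : I) (j : J) (cb : I → U × (J → X)) :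
    0 ≤ interference K A B i j cb :=
  add_nonneg (Finset.sum_nonneg fun _ _ => hK _)
    (Finset.sum_nonneg fun _ _ => Finset.sum_nonneg fun _ _ => hK _)

/-- The expected interference, given the cloud centre `u`. -/
def meanInterference (pU : U → ℝ) (pX : U → X → ℝ) (K : X → ℝ) (a b : ℕ) (u : U) : ℝ :=
  ((b : ℝ) - 1) * expect (pX u) K + ((a : ℝ) - 1) * b * expect pU fun u => expect (pX u) K

/-- Satellites of the same cloud are independent of the selected one given its centre, and those of
other clouds are independent of the pair; these are the two terms of `meanInterference`. By
linearity only pairwise independence enters. -/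
theorem expect_mul_interference [DecidableEq I] [DecidableEq J] (hU : pU ∈ stdSimplex ℝ U)
    (hX : ∀ u, pX u ∈ stdSimplex ℝ X) (K : X → ℝ) {A : Finset I} {B : Finset J}
    {i : I} {j : J} (hi : i ∈ A) (hj : j ∈ B) (F : U → X → ℝ) :
    expect (codebookLaw pU pX)
        (fun cb => F (cb i).1 ((cb i).2 j) * interference K A B i j cb) =
      expect pU fun u => expect (pX u) fun x =>
        F u x * meanInterference pU pX K A.card B.card u := by
  have hC := cloudLaw_mem (J := J) hU hX
  simp only [interference, mul_add, Finset.mul_sum, expect_add, expect_sum]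
  have h1 : ∀ j' ∈ B.erase j, expect (codebookLaw pU pX) (fun cb : I → U × (J → X) =>
      F (cb i).1 ((cb i).2 j) * K ((cb i).2 j')) =
        expect pU fun u => expect (pX u) (F u) * expect (pX u) K := by
    intro j' hj'
    rw [expect_piLaw_apply hC i fun c => F c.1 (c.2 j) * K (c.2 j'),
      expect_cloudLaw_apply_mul hX (Finset.ne_of_mem_erase hj').symm]
  have h2 : ∀ i' ∈ A.erase i, ∀ j' ∈ B, expect (codebookLaw pU pX) (fun cb : I → U × (J → X) =>
      F (cb i).1 ((cb i).2 j) * K ((cb i').2 j')) =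
        (expect pU fun u => expect (pX u) (F u)) * expect pU fun u => expect (pX u) K := by
    intro i' hi' j' _
    rw [expect_piLaw_apply_mul hC (Finset.ne_of_mem_erase hi').symm (fun c => F c.1 (c.2 j))
      (fun c => K (c.2 j')), expect_cloudLaw_apply hX j F, expect_cloudLaw_apply hX j' fun _ => K]
  rw [Finset.sum_congr rfl h1,
    Finset.sum_congr rfl fun i' hi' => Finset.sum_congr rfl fun j' hj' => h2 i' hi' j' hj']
  simp only [Finset.sum_const, nsmul_eq_mul, Finset.card_erase_of_mem hi,
    Finset.card_erase_of_mem hj, Nat.cast_sub (Finset.card_pos.2 ⟨i, hi⟩),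
    Nat.cast_sub (Finset.card_pos.2 ⟨j, hj⟩), Nat.cast_one, meanInterference, mul_add,
    expect_add, expect_mul_const]
  rw [← expect_const_mul]
  congr 1
  · congr 1; funext u; ring
  · ring

theorem expect_codebookLaw_apply [DecidableEq I] [DecidableEq J] (hU : pU ∈ stdSimplex ℝ U)
    (hX : ∀ u, pX u ∈ stdSimplex ℝ X) (i : I) (j : J) (F : U → X → ℝ) :
    expect (codebookLaw pU pX) (fun cb => F (cb i).1 ((cb i).2 j)) =
      expect pU fun u => expect (pX u) (F u) := by
  rw [expect_piLaw_apply (cloudLaw_mem hU hX) i fun c => F c.1 (c.2 j), expect_cloudLaw_apply hX]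

theorem meanInterference_nonneg (hU : pU ∈ stdSimplex ℝ U)
    (hX : ∀ u, pX u ∈ stdSimplex ℝ X) {K : X → ℝ} (hK : ∀ x, 0 ≤ K x) {a b : ℕ} (ha : 1 ≤ a)
    (hb : 1 ≤ b) (u : U) : 0 ≤ meanInterference pU pX K a b u := by
  have ha' : (1 : ℝ) ≤ a := by exact_mod_cast ha
  have hb' : (1 : ℝ) ≤ b := by exact_mod_cast hb
  have h1 := expect_nonneg (hX u) hK
  have h2 := expect_nonneg hU fun u => expect_nonneg (hX u) hK
  have : 0 ≤ (b : ℝ) - 1 := by linarith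
  have : 0 ≤ (a : ℝ) - 1 := by linarith
  unfold meanInterference
  positivity

/-- The expected probability of confusing the codeword `(i, j)` with another one. -/
theorem expect_min_interference_le [DecidableEq I] [DecidableEq J] (hU : pU ∈ stdSimplex ℝ U)
    (hX : ∀ u, pX u ∈ stdSimplex ℝ X) {K : X → ℝ} (A : Finset I) (B : Finset J)
    {i : I} {j : J} (hi : i ∈ A) (hj : j ∈ B) :
    expect (codebookLaw pU pX)
        (fun cb => min (K ((cb i).2 j)) (interference K A B i j cb)) ≤
      expect pU fun u => expect (pX u) fun x =>
        min (K x) (meanInterference pU pX K A.card B.card u) := by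
  let c := meanInterference pU pX K A.card B.card
  -- Jensen's inequality for the concave `min`, made linear: the branch of the minimum is chosen
  -- from `(u, x)` alone, by comparison with the mean interference, and the choice is exact after
  -- averaging.
  let χ : U → X → ℝ := fun u x => if c u ≤ K x then 1 else 0
  have hC := cloudLaw_mem (J := J) hU hX
  calc expect (codebookLaw pU pX) (fun cb => min (K ((cb i).2 j)) (interference K A B i j cb))
      ≤ expect (codebookLaw pU pX) (fun cb =>
          χ (cb i).1 ((cb i).2 j) * interference K A B i j cb +
          (fun u x => (1 - χ u x) * K x) (cb i).1 ((cb i).2 j)) := by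
        refine expect_mono (piLaw_mem hC) fun cb _ => ?_
        simp only [χ]
        split_ifs <;> simp
    _ = expect pU fun u => expect (pX u) fun x => χ u x * c u + (1 - χ u x) * K x := by
        rw [expect_add, expect_mul_interference hU hX K hi hj,
          expect_codebookLaw_apply hU hX i j (fun u x => (1 - χ u x) * K x), ← expect_add]
        simp only [← expect_add]
        rfl
    _ = _ := by
        congr 1; funext u; congr 1; funext x
        simp only [χ]
        split_ifs with h
        · rw [min_eq_right h]; ring
        · rw [min_eq_left (not_le.1 h).le]; ring

/-- The expected value of `S log S`, where `S` is the total weight of the codewords in `A × B`. -/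
theorem expect_mul_log_sum_le [DecidableEq I] [DecidableEq J] (hU : pU ∈ stdSimplex ℝ U)
    (hX : ∀ u, pX u ∈ stdSimplex ℝ X) {K : X → ℝ} (hK : ∀ x, 0 ≤ K x) (A : Finset I)
    (B : Finset J) :
    expect (codebookLaw pU pX) (fun cb => (∑ i ∈ A, ∑ j ∈ B, K ((cb i).2 j)) *
        Real.log (∑ i ∈ A, ∑ j ∈ B, K ((cb i).2 j))) ≤
      A.card * B.card * expect pU fun u => expect (pX u) fun x =>
        K x * Real.log (K x + meanInterference pU pX K A.card B.card u) := by
  let c := meanInterference pU pX K A.card B.card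
  have hC := cloudLaw_mem (J := J) hU hX
  -- `F u x` is the slope of `s ↦ K x * log (K x + s)` at the mean interference `s = c u`. The
  -- tangent line bounds this concave function, is linear in the interference, and loses nothing
  -- after averaging.
  let F : U → X → ℝ := fun u x => K x / (K x + c u)
  have key : ∀ i ∈ A, ∀ j ∈ B, expect (codebookLaw pU pX) (fun cb => K ((cb i).2 j) *
        Real.log (∑ i ∈ A, ∑ j ∈ B, K ((cb i).2 j))) ≤
      expect pU fun u => expect (pX u) fun x => K x * Real.log (K x + c u) := by
    intro i hi j hj
    have hc : ∀ u, 0 ≤ c u := meanInterference_nonneg hU hX hK (Finset.card_pos.2 ⟨i, hi⟩)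
      (Finset.card_pos.2 ⟨j, hj⟩)
    calc _ ≤ expect (codebookLaw pU pX) (fun cb =>
          F (cb i).1 ((cb i).2 j) * interference K A B i j cb +
          (fun u x => K x * Real.log (K x + c u) + F u x * K x - K x)
            (cb i).1 ((cb i).2 j)) := by
          refine expect_mono (piLaw_mem hC) fun cb _ => ?_
          rw [← add_interference K hi hj]
          have hs := interference_nonneg hK A B i j cb
          set s := interference K A B i j cb
          set k := K ((cb i).2 j)
          set c' := c (cb i).1
          rcases (hK ((cb i).2 j)).eq_or_lt with h0 | h0
          · have : k = 0 := h0.symm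
            simp only [F]
            simp [← h0, this]
          · have hk : 0 < k := h0
            have hc' : 0 ≤ c' := hc _
            have := Real.log_le_sub_one_of_pos (div_pos (add_pos_of_pos_of_nonneg hk hs)
              (add_pos_of_pos_of_nonneg hk hc'))
            rw [Real.log_div (by positivity) (by positivity)] at this
            have h3 := mul_le_mul_of_nonneg_left this hk.le
            have h4 : k * ((k + s) / (k + c') - 1) =
              k / (k + c') * s + k / (k + c') * k - k := by field_simp; ring
            simp only [F]
            linarith
      _ = expect pU fun u => expect (pX u) fun x =>
            F u x * c u + (K x * Real.log (K x + c u) + F u x * K x - K x) := by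
          rw [expect_add, expect_mul_interference hU hX K hi hj,
            expect_codebookLaw_apply hU hX i j
              (fun u x => K x * Real.log (K x + c u) + F u x * K x - K x), ← expect_add]
          simp only [← expect_add]
          rfl
      _ = _ := by
          congr 1; funext u; congr 1; funext x
          rcases (hK x).eq_or_lt with h0 | h0
          · simp [F, ← h0]
          · have : K x + c u ≠ 0 := (add_pos_of_pos_of_nonneg h0 (hc u)).ne'
            simp only [F]
            field_simp
            ring
  calc _ = ∑ i ∈ A, ∑ j ∈ B, expect (codebookLaw pU pX) (fun cb => K ((cb i).2 j) *
        Real.log (∑ i ∈ A, ∑ j ∈ B, K ((cb i).2 j))) := by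
        simp only [← expect_sum, Finset.sum_mul]
    _ ≤ _ := by
        refine (Finset.sum_le_sum fun i hi => Finset.sum_le_sum fun j hj =>
          key i hi j hj).trans_eq ?_
        simp [mul_assoc, c]

end Expect


/-! ### Existence of a good codebook -/

section OneShot

variable {U X Y Y₁ Y₂ Z I J : Type*} [Fintype U] [Fintype X] [Fintype Y] [Fintype Y₁] [Fintype Y₂]
  [Fintype Z] [Fintype I] [Fintype J] {pU : U → ℝ} {pX : U → X → ℝ}

theorem le_interference [DecidableEq I] [DecidableEq J] {K : X → ℝ} (hK : ∀ x, 0 ≤ K x)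
    {i i' : I} {j j' : J} (h : (i', j') ≠ (i, j)) (cb : I → U × (J → X)) :
    K ((cb i').2 j') ≤ interference K Finset.univ Finset.univ i j cb := by
  by_cases hi : i' = i
  · subst hi
    have hj : j' ≠ j := fun e => h (by rw [e])
    refine le_add_of_le_of_nonneg ?_
      (Finset.sum_nonneg fun _ _ => Finset.sum_nonneg fun _ _ => hK _)
    exact Finset.single_le_sum (f := fun j' => K ((cb i').2 j')) (fun _ _ => hK _)
      (Finset.mem_erase.2 ⟨hj, Finset.mem_univ _⟩)
  · refine le_add_of_nonneg_of_le (Finset.sum_nonneg fun _ _ => hK _) ?_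
    refine le_trans ?_ (Finset.single_le_sum (f := fun i' => ∑ j', K ((cb i').2 j'))
      (fun _ _ => Finset.sum_nonneg fun _ _ => hK _)
      (Finset.mem_erase.2 ⟨hi, Finset.mem_univ _⟩))
    exact Finset.single_le_sum (f := fun j' => K ((cb i').2 j')) (fun _ _ => hK _)
      (Finset.mem_univ _)

/-- The error weight of a decoder for the pair `(i, j)`. -/
def pairErr [DecidableEq I] [DecidableEq J] (A : X → Y → ℝ) (cb : I → U × (J → X))
    (d : Y → I × J) : ℝ := ∑ i, ∑ j, ∑ y, if d y ≠ (i, j) then A ((cb i).2 j) y else 0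

/-- The error weight of a decoder for the cloud index `i`. -/
def cloudErr [DecidableEq I] (B : X → Y → ℝ) (cb : I → U × (J → X))
    (d : Y → I) : ℝ := ∑ i, ∑ j, ∑ y, if d y ≠ i then B ((cb i).2 j) y else 0

/-- Maximum likelihood decoding of the codeword. -/
theorem exists_decoder_pair [DecidableEq I] [DecidableEq J] [Nonempty I] [Nonempty J]
    (hU : pU ∈ stdSimplex ℝ U) (hX : ∀ u, pX u ∈ stdSimplex ℝ X) {A : X → Y → ℝ}
    (hA : ∀ x, A x ∈ stdSimplex ℝ Y) :
    ∃ d : (I → U × (J → X)) → Y → I × J,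
      expect (codebookLaw pU pX) (fun cb => pairErr A cb (d cb)) ≤
        Fintype.card I * Fintype.card J * ∑ y, expect pU fun u => expect (pX u) fun x =>
          min (A x y) (meanInterference pU pX (fun x => A x y) (Fintype.card I)
            (Fintype.card J) u) := by
  have : ∀ (cb : I → U × (J → X)) (y : Y), ∃ k : I × J, ∀ k' : I × J,
      A ((cb k'.1).2 k'.2) y ≤ A ((cb k.1).2 k.2) y := fun cb y => by
    obtain ⟨k, -, hk⟩ := Finset.exists_max_image (Finset.univ : Finset (I × J))
      (fun k => A ((cb k.1).2 k.2) y) Finset.univ_nonempty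
    exact ⟨k, fun k' => hk k' (Finset.mem_univ _)⟩
  choose d hd using this
  refine ⟨d, ?_⟩
  calc _ ≤ expect (codebookLaw pU pX) (fun cb => ∑ i : I, ∑ j : J, ∑ y,
        min (A ((cb i).2 j) y) (interference (fun x => A x y) Finset.univ Finset.univ i j cb)) := by
        refine expect_mono (piLaw_mem (cloudLaw_mem hU hX)) fun cb _ => ?_
        refine Finset.sum_le_sum fun i _ => Finset.sum_le_sum fun j _ =>
          Finset.sum_le_sum fun y _ => ?_
        -- After an error the decoded codeword is a competitor at least as likely as the true one,
        -- and its likelihood is part of the interference.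
        split_ifs with h
        · exact le_min le_rfl ((hd cb y (i, j)).trans
            (le_interference (K := fun x => A x y) (fun x => (hA x).1 y) h cb))
        · exact le_min ((hA _).1 y) (interference_nonneg (fun x => (hA x).1 y) _ _ _ _ _)
    _ ≤ ∑ _i : I, ∑ _j : J, ∑ y, expect pU fun u => expect (pX u) fun x =>
          min (A x y) (meanInterference pU pX (fun x => A x y) (Fintype.card I)
            (Fintype.card J) u) := by
        simp only [expect_sum]
        exact Finset.sum_le_sum fun i _ => Finset.sum_le_sum fun j _ =>
          Finset.sum_le_sum fun y _ => expect_min_interference_le hU hX (K := fun x => A x y) _ _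
            (Finset.mem_univ _) (Finset.mem_univ _)
    _ = _ := by simp [mul_assoc]

/-- Maximum likelihood decoding of the cloud centre. -/
theorem exists_decoder_cloud [DecidableEq I] [DecidableEq J] [Nonempty I]
    (hU : pU ∈ stdSimplex ℝ U) (hX : ∀ u, pX u ∈ stdSimplex ℝ X) {B : X → Y → ℝ}
    (hB : ∀ x, B x ∈ stdSimplex ℝ Y) :
    ∃ d : (I → U × (J → X)) → Y → I,
      expect (codebookLaw pU pX) (fun cb => cloudErr B cb (d cb)) ≤
        Fintype.card I * Fintype.card J * ∑ y, expect pU fun u =>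
          min (push B (pX u) y) (((Fintype.card I : ℝ) - 1) *
            expect pU fun u => push B (pX u) y) := by
  have : ∀ (cb : I → U × (J → X)) (y : Y), ∃ i, ∀ i',
      push B (pX (cb i').1) y ≤ push B (pX (cb i).1) y := fun cb y => by
    obtain ⟨k, -, hk⟩ := Finset.exists_max_image (Finset.univ : Finset I)
      (fun i => push B (pX (cb i).1) y) Finset.univ_nonempty
    exact ⟨k, fun k' => hk k' (Finset.mem_univ _)⟩
  choose d hd using this
  have hC := cloudLaw_mem (J := J) hU hX
  have hpush : ∀ u y, 0 ≤ push B (pX u) y := fun u y => push_nonneg hB (hX u).1 y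
  refine ⟨d, ?_⟩
  have key : ∀ i j y, expect (codebookLaw pU pX) (fun cb : I → U × (J → X) =>
      if d cb y ≠ i then B ((cb i).2 j) y else 0) ≤ expect pU fun u =>
          min (push B (pX u) y) (((Fintype.card I : ℝ) - 1) *
            expect pU fun u => push B (pX u) y) := by
    intro i j y
    set c := ((Fintype.card I : ℝ) - 1) * expect pU fun u => push B (pX u) y with hc
    -- The branch of the minimum is again selected in advance; positivity is required because `F₁`
    -- divides by the cloud average.
    let χ : U → ℝ := fun u => if 0 < push B (pX u) y ∧ c ≤ push B (pX u) y then 1 else 0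
    -- The decoder compares cloud averages, but the error is weighted by the likelihood of the
    -- satellite. Dividing by the cloud average reconciles the two, and averaging over the satellite
    -- removes the quotient.
    let F₁ : U → X → ℝ := fun u x => χ u / push B (pX u) y * B x y
    let F₂ : U → X → ℝ := fun u x => (1 - χ u) * B x y
    have e1 : ∀ u, expect (pX u) (fun x => B x y) = push B (pX u) y := fun u => rfl
    calc _ ≤ expect (codebookLaw pU pX) (fun cb : I → U × (J → X) =>
          ∑ i' ∈ Finset.univ.erase i, F₁ (cb i).1 ((cb i).2 j) * push B (pX (cb i').1) y
            + F₂ (cb i).1 ((cb i).2 j)) := by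
          refine expect_mono (piLaw_mem hC) fun cb _ => ?_
          rw [← Finset.mul_sum]
          have hb := (hB ((cb i).2 j)).1 y
          have hs : 0 ≤ ∑ i' ∈ Finset.univ.erase i, push B (pX (cb i').1) y :=
            Finset.sum_nonneg fun _ _ => hpush _ _
          by_cases hχ : 0 < push B (pX (cb i).1) y ∧ c ≤ push B (pX (cb i).1) y
          · simp only [F₁, F₂, χ, if_pos hχ, sub_self, zero_mul, add_zero]
            split_ifs with h
            · have h1 : push B (pX (cb i).1) y ≤
                  ∑ i' ∈ Finset.univ.erase i, push B (pX (cb i').1) y :=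
                (hd cb y i).trans (Finset.single_le_sum (f := fun i' => push B (pX (cb i').1) y)
                  (fun _ _ => hpush _ _) (Finset.mem_erase.2 ⟨h, Finset.mem_univ _⟩))
              calc B ((cb i).2 j) y = 1 / push B (pX (cb i).1) y * B ((cb i).2 j) y *
                    push B (pX (cb i).1) y := by field_simp [hχ.1.ne']
                _ ≤ _ := mul_le_mul_of_nonneg_left h1
                    (mul_nonneg (one_div_nonneg.2 hχ.1.le) hb)
            · exact mul_nonneg (mul_nonneg (one_div_nonneg.2 hχ.1.le) hb) hs
          · simp only [F₁, F₂, χ, if_neg hχ, zero_div, zero_mul, sub_zero, one_mul, zero_add]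
            split_ifs
            · exact le_rfl
            · exact hb
      _ = expect pU fun u => χ u / push B (pX u) y * push B (pX u) y * c
            + (1 - χ u) * push B (pX u) y := by
          rw [expect_add, expect_sum, expect_codebookLaw_apply hU hX i j F₂]
          have : ∀ i' ∈ Finset.univ.erase i, expect (codebookLaw pU pX)
              (fun cb : I → U × (J → X) =>
                F₁ (cb i).1 ((cb i).2 j) * push B (pX (cb i').1) y) =
              (expect pU fun u => expect (pX u) (F₁ u)) * expect pU fun u => push B (pX u) y := by
            intro i' hi'
            rw [expect_piLaw_apply_mul hC (Finset.ne_of_mem_erase hi').symm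
              (fun c => F₁ c.1 (c.2 j)) (fun c => push B (pX c.1) y),
              expect_cloudLaw_apply hX j F₁, expect_cloudLaw_apply hX j fun u _ => push B (pX u) y]
            simp only [expect_const (hX _)]
          rw [Finset.sum_congr rfl this]
          simp only [Finset.sum_const, nsmul_eq_mul, Finset.card_erase_of_mem (Finset.mem_univ i),
            F₁, F₂,
            expect_const_mul, e1, Finset.card_univ, expect_add, expect_mul_const,
            Nat.cast_pred (Fintype.card_pos (α := I))]
          rw [hc]
          ring
      _ ≤ _ := by
          refine expect_mono hU fun u _ => ?_
          have hc0 : 0 ≤ c := mul_nonneg (sub_nonneg.2 (by exact_mod_cast Fintype.card_pos))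
            (expect_nonneg hU fun u => hpush u y)
          by_cases hχ : 0 < push B (pX u) y ∧ c ≤ push B (pX u) y
          · simp only [χ, if_pos hχ, min_eq_right hχ.2]
            field_simp [hχ.1.ne']
            simp
          · simp only [χ, if_neg hχ, zero_div, zero_mul, sub_zero, one_mul, zero_add]
            refine le_min le_rfl ?_
            by_contra! h
            exact hχ ⟨lt_of_le_of_lt hc0 h, h.le⟩
  calc _ = ∑ i : I, ∑ j : J, ∑ y, expect (codebookLaw pU pX) (fun cb : I → U × (J → X) =>
        if d cb y ≠ i then B ((cb i).2 j) y else 0) := by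
        simp only [cloudErr, expect_sum]
    _ ≤ ∑ _i : I, ∑ _j : J, ∑ y, expect pU fun u =>
          min (push B (pX u) y) (((Fintype.card I : ℝ) - 1) *
            expect pU fun u => push B (pX u) y) :=
        Finset.sum_le_sum fun i _ => Finset.sum_le_sum fun j _ =>
          Finset.sum_le_sum fun y _ => key i j y
    _ = _ := by simp [mul_assoc]

/-! ### Leakage of a random codebook and choice of a good one. -/

variable {V V' L L' : Type*} [Fintype V] [Fintype V'] [Fintype L] [Fintype L']

/-- The total weight of the codewords for the message `(v, v')`. -/
def msgSum (C : X → Z → ℝ) (cb : V × L → U × (V' × L' → X)) (v : V) (v' : V') (z : Z) : ℝ :=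
  ∑ l, ∑ l', C ((cb (v, l)).2 (v', l')) z

/-- The information about the messages contained in the output of `C`. -/
def codebookLeak (C : X → Z → ℝ) (cb : V × L → U × (V' × L' → X)) : ℝ :=
  ∑ z, Real.negMulLog ((∑ v, ∑ v', msgSum C cb v v' z) /
      (Fintype.card (V × L) * Fintype.card (V' × L')))
    - Real.log (Fintype.card L * Fintype.card L')
    + (∑ v, ∑ v', ∑ z, msgSum C cb v v' z * Real.log (msgSum C cb v v' z)) /
      (Fintype.card (V × L) * Fintype.card (V' × L'))

theorem sum_msgSum (C : X → Z → ℝ) (cb : V × L → U × (V' × L' → X)) (z : Z) :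
    ∑ v, ∑ v', msgSum C cb v v' z = ∑ i, ∑ j, C ((cb i).2 j) z := by
  simp only [msgSum, Fintype.sum_prod_type]
  refine Finset.sum_congr rfl fun v _ => ?_
  rw [Finset.sum_comm]

/-- Jensen's inequality for the entropy of the total output, whose mean is the exact output law, and
`expect_mul_log_sum_le` for the sub-codebook of local randomness belonging to each message pair. -/
theorem expect_codebookLeak_le [Nonempty V] [Nonempty V'] [Nonempty L] [Nonempty L']
    [DecidableEq V] [DecidableEq V'] [DecidableEq L] [DecidableEq L']
    (hU : pU ∈ stdSimplex ℝ U) (hX : ∀ u, pX u ∈ stdSimplex ℝ X) {C : X → Z → ℝ}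
    (hC : ∀ x, C x ∈ stdSimplex ℝ Z) :
    expect (codebookLaw pU pX) (fun cb : V × L → U × (V' × L' → X) => codebookLeak C cb) ≤
      ∑ z, Real.negMulLog (expect pU fun u => push C (pX u) z)
        - Real.log (Fintype.card L * Fintype.card L')
        + ∑ z, expect pU fun u => expect (pX u) fun x => C x z *
          Real.log (C x z + meanInterference pU pX (fun x => C x z) (Fintype.card L)
            (Fintype.card L') u) := by
  have hlaw := piLaw_mem (ι := V × L) (cloudLaw_mem (J := V' × L') hU hX)
  have hI : (0 : ℝ) < Fintype.card (V × L) := by exact_mod_cast Fintype.card_pos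
  have hJ : (0 : ℝ) < Fintype.card (V' × L') := by exact_mod_cast Fintype.card_pos
  simp only [codebookLeak, expect_add, expect_sub, expect_const hlaw]
  refine add_le_add (sub_le_sub_right ?_ _) ?_
  · rw [expect_sum]
    refine Finset.sum_le_sum fun z _ => ?_
    have h1 := sum_negMulLog_le hlaw
      (s := fun cb => (∑ v, ∑ v', msgSum C cb v v' z) /
        (Fintype.card (V × L) * Fintype.card (V' × L')))
      (fun cb => div_nonneg (Finset.sum_nonneg fun _ _ => Finset.sum_nonneg fun _ _ =>
        Finset.sum_nonneg fun _ _ => Finset.sum_nonneg fun _ _ => (hC _).1 z) (by positivity))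
    refine h1.trans_eq (congrArg _ ?_)
    change expect (codebookLaw pU pX) _ = _
    simp only [div_eq_mul_inv, expect_mul_const, sum_msgSum, expect_sum]
    have : ∀ (i : V × L) (j : V' × L'), expect (codebookLaw pU pX)
        (fun cb => C ((cb i).2 j) z) = expect pU fun u => push C (pX u) z := fun i j =>
      expect_codebookLaw_apply hU hX i j fun _ x => C x z
    simp only [this]
    simp only [Finset.sum_const, Finset.card_univ, nsmul_eq_mul]
    field_simp
  · simp only [div_eq_mul_inv, expect_mul_const, expect_sum]
    rw [← div_eq_mul_inv, div_le_iff₀ (by positivity)]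
    have h1 : ∀ v v' z, expect (codebookLaw pU pX) (fun cb : V × L → U × (V' × L' → X) =>
        msgSum C cb v v' z * Real.log (msgSum C cb v v' z)) ≤
        Fintype.card L * Fintype.card L' * expect pU fun u => expect (pX u) fun x => C x z *
          Real.log (C x z + meanInterference pU pX (fun x => C x z) (Fintype.card L)
            (Fintype.card L') u) := by
      intro v v' z
      have := expect_mul_log_sum_le hU hX (K := fun x => C x z) (fun x => (hC x).1 z)
        (({v} : Finset V) ×ˢ (Finset.univ : Finset L))
        (({v'} : Finset V') ×ˢ (Finset.univ : Finset L'))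
      simpa [Finset.sum_product, msgSum] using this
    refine (Finset.sum_le_sum fun v _ => Finset.sum_le_sum fun v' _ => Finset.sum_le_sum
      fun z _ => h1 v v' z).trans_eq ?_
    simp only [← Finset.mul_sum, Finset.sum_const, Finset.card_univ, nsmul_eq_mul,
      Fintype.card_prod, Nat.cast_mul]
    ring

/-- A superposition codebook which is good for both receivers and against the eavesdropper. -/
theorem exists_codebook [Nonempty V] [Nonempty V'] [Nonempty L] [Nonempty L']
    [DecidableEq V] [DecidableEq V'] [DecidableEq L] [DecidableEq L']
    (hU : pU ∈ stdSimplex ℝ U) (hX : ∀ u, pX u ∈ stdSimplex ℝ X) {A : X → Y₁ → ℝ}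
    (hA : ∀ x, A x ∈ stdSimplex ℝ Y₁) {B : X → Y₂ → ℝ} (hB : ∀ x, B x ∈ stdSimplex ℝ Y₂)
    {C : X → Z → ℝ} (hC : ∀ x, C x ∈ stdSimplex ℝ Z) {c : ℝ} (hc : 0 ≤ c) :
    ∃ (cb : V × L → U × (V' × L' → X)) (d₁ : Y₁ → (V × L) × (V' × L')) (d₂ : Y₂ → V × L),
      pairErr A cb d₁ / (Fintype.card (V × L) * Fintype.card (V' × L'))
        + cloudErr B cb d₂ / (Fintype.card (V × L) * Fintype.card (V' × L'))
        + c * codebookLeak C cb ≤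
      ∑ y, (expect pU fun u => expect (pX u) fun x =>
          min (A x y) (meanInterference pU pX (fun x => A x y) (Fintype.card (V × L))
            (Fintype.card (V' × L')) u))
      + ∑ y, (expect pU fun u =>
          min (push B (pX u) y) (((Fintype.card (V × L) : ℝ) - 1) *
            expect pU fun u => push B (pX u) y))
      + c * (∑ z, Real.negMulLog (expect pU fun u => push C (pX u) z)
        - Real.log (Fintype.card L * Fintype.card L')
        + ∑ z, expect pU fun u => expect (pX u) fun x => C x z *
          Real.log (C x z + meanInterference pU pX (fun x => C x z) (Fintype.card L)
            (Fintype.card L') u)) := by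
  have hlaw := piLaw_mem (ι := V × L) (cloudLaw_mem (J := V' × L') hU hX)
  have hI : (0 : ℝ) < Fintype.card (V × L) := by exact_mod_cast Fintype.card_pos
  have hJ : (0 : ℝ) < Fintype.card (V' × L') := by exact_mod_cast Fintype.card_pos
  obtain ⟨d₁, hd₁⟩ := exists_decoder_pair (I := V × L) (J := V' × L') hU hX hA
  obtain ⟨d₂, hd₂⟩ := exists_decoder_cloud (I := V × L) (J := V' × L') hU hX hB
  have hleak := expect_codebookLeak_le (V := V) (L := L) (V' := V') (L' := L') hU hX hC
  -- The three criteria are averaged as one sum, so one codebook serves for all. The criteria can be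
  -- separated afterwards because error and leakage of the resulting code are nonnegative.
  obtain ⟨cb, hcb⟩ := exists_le_expect hlaw fun cb =>
    pairErr A cb (d₁ cb) / (Fintype.card (V × L) * Fintype.card (V' × L'))
        + cloudErr B cb (d₂ cb) / (Fintype.card (V × L) * Fintype.card (V' × L'))
        + c * codebookLeak C cb
  refine ⟨cb, d₁ cb, d₂ cb, hcb.trans ?_⟩
  simp only [expect_add, expect_const_mul, div_eq_mul_inv, expect_mul_const]
  simp only [← div_eq_mul_inv]
  refine add_le_add (add_le_add ?_ ?_) (mul_le_mul_of_nonneg_left hleak hc)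
  · rw [div_le_iff₀ (by positivity), mul_comm (∑ y, _)]
    exact hd₁
  · rw [div_le_iff₀ (by positivity), mul_comm (∑ y, _)]
    exact hd₂

end OneShot


/-! ### The code defined by a codebook -/

section CodebookCode

variable {U X Y₁ Y₂ Z : Type*} [Fintype X] [Fintype Y₁] [Fintype Y₂] [Fintype Z]
  {M₂ a b l l' n : ℕ}

theorem sum_comm_three {α β γ : Type*} [Fintype α] [Fintype β] [Fintype γ]
    (f : α → β → γ → ℝ) : ∑ x, ∑ y, ∑ z, f x y z = ∑ y, ∑ z, ∑ x, f x y z := by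
  rw [Finset.sum_comm]
  exact Finset.sum_congr rfl fun y _ => Finset.sum_comm

/-- The codeword for the message pair `w` and the local randomness `(k, k')`. -/
def codeword (cb : (Fin M₂ × Fin a) × Fin l → U × (Fin b × Fin l' → Fin n → X))
    (w : Fin (a * b) × Fin M₂) (k : Fin l) (k' : Fin l') : Fin n → X :=
  (cb ((w.2, (finProdFinEquiv.symm w.1).1), k)).2 ((finProdFinEquiv.symm w.1).2, k')

open Classical in
/-- The code with a uniformly chosen codeword for each message pair. The second message and a part
of the first one select the cloud, the rest of the first message selects the satellite. -/
def codebookCode (hl : 0 < l) (hl' : 0 < l')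
    (cb : (Fin M₂ × Fin a) × Fin l → U × (Fin b × Fin l' → Fin n → X))
    (d₁ : (Fin n → Y₁) → ((Fin M₂ × Fin a) × Fin l) × (Fin b × Fin l'))
    (d₂ : (Fin n → Y₂) → (Fin M₂ × Fin a) × Fin l) : Code X Y₁ Y₂ (a * b) M₂ n where
  enc :=
    { prob := fun w x => (∑ k, ∑ k', if codeword cb w k k' = x then 1 else 0) / (l * l')
      mem_simplex := fun w => by
        have h1 : (l : ℝ) ≠ 0 := by positivity
        have h2 : (l' : ℝ) ≠ 0 := by positivity
        refine ⟨fun x => div_nonneg (Finset.sum_nonneg fun _ _ => Finset.sum_nonneg fun _ _ => ?_)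
          (by positivity), ?_⟩
        · split_ifs <;> norm_num
        · rw [← Finset.sum_div, sum_comm_three]
          simp [h1, h2] }
  dec₁ y := some (finProdFinEquiv ((d₁ y).1.1.2, (d₁ y).2.1))
  dec₂ y := some (d₂ y).1.1

variable (hl : 0 < l) (hl' : 0 < l')
  (cb : (Fin M₂ × Fin a) × Fin l → U × (Fin b × Fin l' → Fin n → X))
  (d₁ : (Fin n → Y₁) → ((Fin M₂ × Fin a) × Fin l) × (Fin b × Fin l'))
  (d₂ : (Fin n → Y₂) → (Fin M₂ × Fin a) × Fin l)

open Classical in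
theorem push_codebookCode_mass {Y : Type*} [Fintype Y] (K : (Fin n → X) → Y → ℝ)
    (w : Fin (a * b) × Fin M₂) (y : Y) :
    push K ((codebookCode hl hl' cb d₁ d₂).mass w) y =
      (∑ k, ∑ k', K (codeword cb w k k') y) / ((a * b : ℕ) * M₂ * (l * l')) := by
  simp only [push, Code.mass, codebookCode]
  have : ∀ x, 1 / (((a * b : ℕ) : ℝ) * M₂) * ((∑ k, ∑ k', if codeword cb w k k' = x then (1 : ℝ)
      else 0) / (l * l')) * K x y = (∑ k, ∑ k', if codeword cb w k k' = x then K x y else 0) /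
        ((a * b : ℕ) * M₂ * (l * l')) := by
    intro x
    have h1 : ∀ k k', (if codeword cb w k k' = x then K x y else 0) =
      (if codeword cb w k k' = x then (1 : ℝ) else 0) * K x y := fun k k' => by simp
    simp only [h1, ← Finset.sum_mul]
    rw [div_mul_div_comm, one_mul, div_mul_eq_mul_div]
  simp only [this, ← Finset.sum_div]
  congr 1
  rw [sum_comm_three]
  simp

theorem ite_zero_div_eq (p : Prop) [Decidable p] (x y : ℝ) :
    (if p then x else 0) / y = if p then x / y else 0 := by
  split_ifs <;> simp

/-- Sums over message pairs and local randomness are sums over the codebook. -/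
theorem sum_messages (F : (Fin M₂ × Fin a) × Fin l → Fin b × Fin l' → ℝ) :
    ∑ w : Fin (a * b) × Fin M₂, ∑ k, ∑ k', F ((w.2, (finProdFinEquiv.symm w.1).1), k)
      ((finProdFinEquiv.symm w.1).2, k') = ∑ i, ∑ j, F i j := by
  simp only [Fintype.sum_prod_type]
  rw [Finset.sum_comm]
  refine Finset.sum_congr rfl fun w₂ _ => ?_
  rw [Equiv.sum_comp finProdFinEquiv.symm fun p : Fin a × Fin b =>
    ∑ k, ∑ k', F ((w₂, p.1), k) (p.2, k'), Fintype.sum_prod_type]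
  refine Finset.sum_congr rfl fun v _ => ?_
  rw [Finset.sum_comm]

theorem codebookCode_errorProb_le (W : Channel X (Y₁ × Y₂ × Z)) :
    (codebookCode hl hl' cb d₁ d₂).errorProb W ≤
      pairErr (powKernel n W.toY₁) cb d₁ /
        (Fintype.card ((Fin M₂ × Fin a) × Fin l) * Fintype.card (Fin b × Fin l')) +
      cloudErr (powKernel n W.toY₂) cb d₂ /
        (Fintype.card ((Fin M₂ × Fin a) × Fin l) * Fintype.card (Fin b × Fin l')) := by
  have hcard : ((Fintype.card ((Fin M₂ × Fin a) × Fin l) * Fintype.card (Fin b × Fin l') : ℕ) : ℝ) =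
      (a * b : ℕ) * M₂ * (l * l') := by
    simp only [Fintype.card_prod, Fintype.card_fin]
    push_cast
    ring
  push_cast at hcard
  rw [hcard]
  refine ((codebookCode hl hl' cb d₁ d₂).errorProb_le W).trans (add_le_add ?_ ?_)
  · rw [pairErr, ← sum_messages, Finset.sum_div]
    refine Finset.sum_le_sum fun w _ => ?_
    rw [← sum_comm_three, Finset.sum_div]
    refine Finset.sum_le_sum fun y _ => ?_
    rw [push_codebookCode_mass, ← ite_zero_div_eq, Nat.cast_mul]
    refine div_le_div_of_nonneg_right ?_ (by positivity)
    split_ifs with h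
    · refine Finset.sum_le_sum fun k _ => Finset.sum_le_sum fun k' _ => ?_
      rw [if_pos]
      · rfl
      · intro e
        apply h
        change some (finProdFinEquiv ((d₁ y).1.1.2, (d₁ y).2.1)) = some w.1
        rw [e]
        exact congrArg some (finProdFinEquiv.apply_symm_apply w.1)
    · refine Finset.sum_nonneg fun k _ => Finset.sum_nonneg fun k' _ => ?_
      split_ifs
      · exact (powKernel_mem (toY₁_mem W) n _).1 _
      · exact le_rfl
  · have e : cloudErr (powKernel n W.toY₂) cb d₂ = ∑ i, ∑ j, ∑ y,
        if d₂ y ≠ i then powKernel n W.toY₂ ((cb i).2 j) y else 0 := rfl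
    rw [e, ← sum_messages (F := fun i j => ∑ y,
        if d₂ y ≠ i then powKernel n W.toY₂ ((cb i).2 j) y else 0), Finset.sum_div]
    refine Finset.sum_le_sum fun w _ => ?_
    rw [← sum_comm_three, Finset.sum_div]
    refine Finset.sum_le_sum fun y _ => ?_
    rw [push_codebookCode_mass, ← ite_zero_div_eq, Nat.cast_mul]
    refine div_le_div_of_nonneg_right ?_ (by positivity)
    split_ifs with h
    · refine Finset.sum_le_sum fun k _ => Finset.sum_le_sum fun k' _ => ?_
      rw [if_pos]
      · rfl
      · intro e
        apply h
        simp [codebookCode, e]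
    · refine Finset.sum_nonneg fun k _ => Finset.sum_nonneg fun k' _ => ?_
      split_ifs
      · exact (powKernel_mem (toY₂_mem W) n _).1 _
      · exact le_rfl

theorem codebookCode_leakage (W : Channel X (Y₁ × Y₂ × Z)) (h₂ : 0 < M₂) (ha : 0 < a)
    (hb : 0 < b) :
    (codebookCode hl hl' cb d₁ d₂).leakage W =
      codebookLeak (powKernel n W.toZ) cb / Real.log 2 := by
  have hCn := powKernel_mem (toZ_mem W) n
  rw [Code.leakage_eq _ W (Nat.mul_pos ha hb) h₂]
  congr 1
  set K := powKernel n W.toZ with hK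
  set D : ℝ := (a * b : ℕ) * M₂ * (l * l') with hD
  have hl₀ : (l : ℝ) ≠ 0 := by positivity
  have hl'₀ : (l' : ℝ) ≠ 0 := by positivity
  have ha₀ : (a : ℝ) ≠ 0 := by positivity
  have hb₀ : (b : ℝ) ≠ 0 := by positivity
  have hM₀ : (M₂ : ℝ) ≠ 0 := by positivity
  have hD0 : 0 < D := by rw [hD]; positivity
  have hcard : (Fintype.card ((Fin M₂ × Fin a) × Fin l) : ℝ) * Fintype.card (Fin b × Fin l') =
      D := by
    simp only [Fintype.card_prod, Fintype.card_fin, hD]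
    push_cast
    ring
  have hpush : ∀ w y, push K ((codebookCode hl hl' cb d₁ d₂).mass w) y =
      msgSum K cb (w.2, (finProdFinEquiv.symm w.1).1) (finProdFinEquiv.symm w.1).2 y / D :=
    fun w y => push_codebookCode_mass hl hl' cb d₁ d₂ K w y
  have hsum : ∀ G : Fin M₂ × Fin a → Fin b → ℝ, ∑ w : Fin (a * b) × Fin M₂,
      G (w.2, (finProdFinEquiv.symm w.1).1) (finProdFinEquiv.symm w.1).2 = ∑ v, ∑ v', G v v' := by
    intro G
    simp only [Fintype.sum_prod_type]
    rw [Finset.sum_comm]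
    refine Finset.sum_congr rfl fun w₂ _ => ?_
    rw [Equiv.sum_comp finProdFinEquiv.symm fun p : Fin a × Fin b => G (w₂, p.1) p.2,
      Fintype.sum_prod_type]
  have e1 : outEnt K (∑ w, (codebookCode hl hl' cb d₁ d₂).mass w) =
      ∑ z, Real.negMulLog ((∑ v, ∑ v', msgSum K cb v v' z) / D) := by
    simp only [outEnt, push_sum, hpush]
    refine Finset.sum_congr rfl fun z _ => ?_
    rw [← Finset.sum_div, hsum fun v v' => msgSum K cb v v' z]
  have hmass : ∑ v, ∑ v', ∑ z, msgSum K cb v v' z = D := by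
    simp only [msgSum]
    have : ∀ v v', ∑ z, ∑ k, ∑ k', K ((cb (v, k)).2 (v', k')) z = (l : ℝ) * l' := fun v v' => by
      rw [sum_comm_three]
      simp [(hCn _).2]
    simp only [this, hD]
    simp
    ring
  have e2 : ∑ w, outEnt K ((codebookCode hl hl' cb d₁ d₂).mass w) =
      Real.log D - (∑ v, ∑ v', ∑ z, msgSum K cb v v' z * Real.log (msgSum K cb v v' z)) / D := by
    have h1 : ∀ s : ℝ, Real.negMulLog (s / D) = s * Real.log D / D - s * Real.log s / D := by
      intro s
      rcases eq_or_ne s 0 with rfl | hs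
      · simp
      · rw [Real.negMulLog, Real.log_div hs hD0.ne']
        ring
    simp only [outEnt, hpush]
    rw [hsum fun v v' => ∑ z, Real.negMulLog (msgSum K cb v v' z / D)]
    simp only [h1, Finset.sum_sub_distrib, ← Finset.sum_div, ← Finset.sum_mul, hmass]
    field_simp
  rw [e1, e2, codebookLeak, hcard, hD]
  push_cast
  simp only [Fintype.card_fin]
  rw [Real.log_mul (mul_ne_zero (mul_ne_zero ha₀ hb₀) hM₀) (mul_ne_zero hl₀ hl'₀),
    Real.log_mul (mul_ne_zero ha₀ hb₀) hM₀, Real.log_mul ha₀ hb₀]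
  ring

theorem Code.leakage_nonneg {M₁ : ℕ} (c : Code X Y₁ Y₂ M₁ M₂ n) (W : Channel X (Y₁ × Y₂ × Z))
    (h₁ : 0 < M₁) (h₂ : 0 < M₂) : 0 ≤ c.leakage W := by
  have hCn := powKernel_mem (toZ_mem W) n
  rw [c.leakage_eq W h₁ h₂]
  refine div_nonneg ?_ (Real.log_nonneg one_le_two)
  have hM₁ : (M₁ : ℝ) ≠ 0 := by positivity
  have hM₂ : (M₂ : ℝ) ≠ 0 := by positivity
  have := outEnt_concave hCn (κ := Fin M₁ × Fin M₂) (w := fun _ => ((M₁ : ℝ) * M₂)⁻¹)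
    ⟨fun _ => by positivity, by simp; field_simp⟩
    (m := fun w => ((M₁ : ℝ) * M₂) • c.mass w)
    (fun w a => mul_nonneg (by positivity) (c.mass_nonneg _ _))
  simp only [smul_smul, inv_mul_cancel₀ (mul_ne_zero hM₁ hM₂), one_smul,
    outEnt_smul hCn, c.sum_mass] at this
  have e : ∑ w, ((M₁ : ℝ) * M₂)⁻¹ * (M₁ * M₂ * outEnt (powKernel n W.toZ) (c.mass w) +
      1 / (M₁ * M₂) * Real.negMulLog (M₁ * M₂)) =
      ∑ w, outEnt (powKernel n W.toZ) (c.mass w) - (Real.log M₁ + Real.log M₂) := by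
    rw [← Finset.mul_sum, Finset.sum_add_distrib, ← Finset.mul_sum]
    simp [Real.negMulLog, Real.log_mul hM₁ hM₂]
    field_simp
    ring
  rw [e] at this
  linarith

end CodebookCode

/-! ### Achievability from approximate achievability -/

section Diagonal

/-- A diagonal argument: if `P ε n` holds for all large `n`, for every `ε > 0`, then `P (e n) n` for
some `e n → 0`. -/
theorem exists_tendsto_zero {P : ℝ → ℕ → Prop} (hmono : ∀ ε ε' n, ε ≤ ε' → P ε n → P ε' n)
    (h : ∀ ε > 0, ∀ᶠ n in atTop, P ε n) :
    ∃ e : ℕ → ℝ, Tendsto e atTop (𝓝 0) ∧ ∀ᶠ n in atTop, P (e n) n := by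
  let S : ℕ → Set ℝ := fun n => {ε | 0 < ε ∧ P ε n}
  have hbdd : ∀ n, BddBelow (S n) := fun n => ⟨0, fun ε hε => hε.1.le⟩
  have h0 : ∀ n, 0 ≤ sInf (S n) := fun n => Real.sInf_nonneg fun ε hε => hε.1.le
  have hs : Tendsto (fun n => sInf (S n)) atTop (𝓝 0) := by
    rw [Metric.tendsto_atTop]
    intro ε hε
    obtain ⟨N, hN⟩ := eventually_atTop.1 (h (ε / 2) (by positivity))
    refine ⟨N, fun n hn => ?_⟩
    rw [Real.dist_eq, sub_zero, abs_of_nonneg (h0 n)]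
    have : sInf (S n) ≤ ε / 2 := csInf_le (hbdd n) ⟨by positivity, hN n hn⟩
    linarith
  -- The infimum need not be attained, so it is enlarged by a null sequence. For the indices with `S
  -- n` empty it has the default value `0`; these are excluded eventually, since `1` is admissible
  -- for large `n`.
  refine ⟨fun n => sInf (S n) + 1 / ((n : ℝ) + 1), ?_, ?_⟩
  · simpa using hs.add tendsto_one_div_add_atTop_nhds_zero_nat
  · filter_upwards [h 1 one_pos] with n hn
    have hlt : sInf (S n) < sInf (S n) + 1 / ((n : ℝ) + 1) := by
      have : (0 : ℝ) < 1 / ((n : ℝ) + 1) := by positivity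
      linarith
    obtain ⟨ε, hε, hlt'⟩ := exists_lt_of_csInf_lt
      (⟨1, one_pos, hn⟩ : (S n).Nonempty) hlt
    exact hmono ε _ n hlt'.le hε.2

theorem le_liminf_coe {r : ℝ} {u e : ℕ → ℝ} (he : Tendsto e atTop (𝓝 0))
    (h : ∀ᶠ n in atTop, r - e n ≤ u n) :
    (r : EReal) ≤ liminf (fun n => (u n : EReal)) atTop := by
  have h1 : Tendsto (fun n => ((r - e n : ℝ) : EReal)) atTop (𝓝 (r : EReal)) := by
    refine (continuous_coe_real_ereal.tendsto r).comp ?_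
    simpa using he.const_sub r
  rw [← h1.liminf_eq]
  exact liminf_le_liminf (h.mono fun n hn => EReal.coe_le_coe_iff.2 hn)

variable {X Y₁ Y₂ Z : Type*} [Fintype X] [Fintype Y₁] [Fintype Y₂] [Fintype Z]

/-- There is a code of length `n` which achieves the rate pair `R` up to `ε`. -/
def HasApproxCode (W : Channel X (Y₁ × Y₂ × Z)) (R : ℝ × ℝ) (ε : ℝ) (n : ℕ) : Prop :=
  ∃ (M₁ M₂ : ℕ) (c : Code X Y₁ Y₂ M₁ M₂ n), 0 < M₁ ∧ 0 < M₂ ∧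
    R.1 - ε ≤ Real.logb 2 M₁ / n ∧ R.2 - ε ≤ Real.logb 2 M₂ / n ∧
    c.errorProb W ≤ ε ∧ c.leakage W / n ≤ ε

theorem errorProb_nonneg {M₁ M₂ n : ℕ} (c : Code X Y₁ Y₂ M₁ M₂ n)
    (W : Channel X (Y₁ × Y₂ × Z)) : 0 ≤ c.errorProb W := by
  refine Finset.sum_nonneg fun ω _ => Set.indicator_nonneg (fun ω _ => ?_) ω
  exact mul_nonneg (c.mass_nonneg ω.1 ω.2.1)
    (Finset.prod_nonneg fun i _ => (W.mem_simplex _).1 _)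

theorem isAchievable_of_hasApproxCode [Nonempty X] {W : Channel X (Y₁ × Y₂ × Z)} {R : ℝ × ℝ}
    (h₁ : 0 ≤ R.1) (h₂ : 0 ≤ R.2) (h : ∀ ε > 0, ∀ᶠ n in atTop, HasApproxCode W R ε n) :
    IsAchievable W R := by
  classical
  obtain ⟨e, he, hcode⟩ := exists_tendsto_zero (P := HasApproxCode W R) (fun ε ε' n hε hP => by
    obtain ⟨M₁, M₂, c, hM₁, hM₂, a₁, a₂, a₃, a₄⟩ := hP
    exact ⟨M₁, M₂, c, hM₁, hM₂, by linarith, by linarith, by linarith, by linarith⟩) h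
  obtain ⟨x₀⟩ := ‹Nonempty X›
  have hall : ∀ n, ∃ (M₁ M₂ : ℕ) (c : Code X Y₁ Y₂ M₁ M₂ n), 0 < M₁ ∧ 0 < M₂ ∧
      (HasApproxCode W R (e n) n → R.1 - e n ≤ Real.logb 2 M₁ / n ∧
        R.2 - e n ≤ Real.logb 2 M₂ / n ∧ c.errorProb W ≤ e n ∧ c.leakage W / n ≤ e n) := by
    intro n
    by_cases hn : HasApproxCode W R (e n) n
    · obtain ⟨M₁, M₂, c, hM₁, hM₂, a⟩ := hn
      exact ⟨M₁, M₂, c, hM₁, hM₂, fun _ => a⟩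
    -- Lengths without a good code get a one-message code; eventually they do not occur.
    · exact ⟨1, 1, { enc := { prob := fun _ => Pi.single (fun _ => x₀) 1,
                               mem_simplex := fun _ => single_mem_stdSimplex ℝ _ },
                      dec₁ := fun _ => none,
                      dec₂ := fun _ => none }, one_pos, one_pos, fun h => absurd h hn⟩
  choose M₁ M₂ c hM₁ hM₂ hc using hall
  have hc' : ∀ᶠ n in atTop, R.1 - e n ≤ Real.logb 2 (M₁ n) / n ∧
        R.2 - e n ≤ Real.logb 2 (M₂ n) / n ∧ (c n).errorProb W ≤ e n ∧
        (c n).leakage W / n ≤ e n := hcode.mono fun n hn => hc n hn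
  refine ⟨h₁, h₂, M₁, M₂, c, fun n => ⟨hM₁ n, hM₂ n⟩, le_liminf_coe he (hc'.mono fun n h => h.1),
    le_liminf_coe he (hc'.mono fun n h => h.2.1),
    tendsto_of_tendsto_of_tendsto_of_le_of_le' tendsto_const_nhds he
      (Eventually.of_forall fun n => errorProb_nonneg _ W) (hc'.mono fun n h => h.2.2.1),
    -- The equivocation loses `e n` from each of the two rates and once more from the leakage.
    le_liminf_coe (e := fun n => 3 * e n) (by simpa using he.const_mul 3)
      (hc'.mono fun n h => ?_),
    tendsto_of_tendsto_of_tendsto_of_le_of_le' tendsto_const_nhds he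
      (Eventually.of_forall fun n => div_nonneg ((c n).leakage_nonneg W (hM₁ n) (hM₂ n))
        (Nat.cast_nonneg n)) (hc'.mono fun n h => h.2.2.2)⟩
  rw [(c n).equivocation_eq W (hM₁ n) (hM₂ n), sub_div, add_div]
  linarith

end Diagonal


/-! ### Concentration of sums over the letters -/

section Letters

variable {Ω S Y α β : Type*} [Fintype Ω] [Fintype S] [Fintype Y] [Fintype α] [Fintype β]

theorem expect_sq_sum {p : Ω → ℝ} (hp : p ∈ stdSimplex ℝ Ω) {g : Ω → ℝ} (hg : expect p g = 0)
    (n : ℕ) : expect (piLaw p) (fun ω : Fin n → Ω => (∑ i, g (ω i)) ^ 2) =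
      n * expect p (fun x => g x ^ 2) := by
  simp only [sq, Finset.sum_mul_sum, expect_sum]
  have : ∀ i j : Fin n, expect (piLaw p) (fun ω : Fin n → Ω => g (ω i) * g (ω j)) =
      if i = j then expect p (fun x => g x * g x) else 0 := by
    intro i j
    split_ifs with h
    · subst h
      exact expect_piLaw_apply hp i fun x => g x * g x
    · rw [expect_piLaw_apply_mul hp h, hg, zero_mul]
  simp only [this]
  simp

/-- The variance of `h`. -/
def variance (p h : Ω → ℝ) : ℝ := expect p fun ω => (h ω - expect p h) ^ 2

theorem expect_sq_sub {p : Ω → ℝ} (hp : p ∈ stdSimplex ℝ Ω) (h : Ω → ℝ) (n : ℕ) :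
    expect (piLaw p) (fun ω : Fin n → Ω => (∑ i, h (ω i) - n * expect p h) ^ 2) =
      n * variance p h := by
  have h0 : expect p (fun ω => h ω - expect p h) = 0 := by
    rw [expect_sub, expect_const hp, sub_self]
  rw [variance, ← expect_sq_sum hp h0]
  congr 1
  funext ω
  simp [Finset.sum_sub_distrib]

/-- The elementary bound `|s| ≤ n ε + s² / (n ε)` replaces the absolute deviation by the variance,
which is linear in `n`. After division by `n` only the arbitrary `ε` and the bias survive in the
limit. -/
theorem expect_abs_sub_le {p : Ω → ℝ} (hp : p ∈ stdSimplex ℝ Ω) (h : Ω → ℝ) {n : ℕ} (hn : 0 < n)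
    {ε : ℝ} (hε : 0 < ε) (c : ℝ) :
    expect (piLaw p) (fun ω : Fin n → Ω => |∑ i, h (ω i) - c|) ≤
      n * ε + variance p h / ε + |n * expect p h - c| := by
  have hn' : (0 : ℝ) < n := by exact_mod_cast hn
  have hlaw := piLaw_mem (ι := Fin n) hp
  calc _ ≤ expect (piLaw p) (fun ω : Fin n → Ω => (n * ε + |n * expect p h - c|) +
        1 / (n * ε) * (∑ i, h (ω i) - n * expect p h) ^ 2) := by
        refine expect_mono hlaw fun ω _ => ?_
        set s := ∑ i, h (ω i) - n * expect p h with hs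
        have e : ∑ i, h (ω i) - c = s + (n * expect p h - c) := by rw [hs]; ring
        have h1 : |s| ≤ n * ε + 1 / (n * ε) * s ^ 2 := by
          rw [← sq_abs]
          have hq : 0 < n * ε := by positivity
          have : 1 / (n * ε) * |s| ^ 2 + n * ε - |s| =
              1 / (n * ε) * ((|s| - n * ε / 2) ^ 2 + 3 / 4 * (n * ε) ^ 2) := by
            field_simp
            ring
          have h2 : 0 ≤ 1 / (n * ε) * ((|s| - n * ε / 2) ^ 2 + 3 / 4 * (n * ε) ^ 2) := by positivity
          linarith
        rw [e]
        have := abs_add_le s (n * expect p h - c)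
        linarith
    _ = _ := by
        rw [expect_add, expect_const hlaw, expect_const_mul, expect_sq_sub hp]
        field_simp
        ring

/-- One `ε` is spent on the deviation of the sum from its mean, handled by Chebyshev's inequality;
the other is the exponent left over when the sum is typical. -/
theorem expect_min_exp_le {p : Ω → ℝ} (hp : p ∈ stdSimplex ℝ Ω) (h : Ω → ℝ) {n : ℕ} (hn : 0 < n)
    {ε N : ℝ} (hε : 0 < ε) (hN : N ≤ Real.exp (n * (expect p h - 2 * ε))) :
    expect (piLaw p) (fun ω : Fin n → Ω => min 1 (N * Real.exp (-∑ i, h (ω i)))) ≤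
      variance p h / (n * ε ^ 2) + Real.exp (-(n * ε)) := by
  have hn' : (0 : ℝ) < n := by exact_mod_cast hn
  have hlaw := piLaw_mem (ι := Fin n) hp
  calc _ ≤ expect (piLaw p) (fun ω : Fin n → Ω =>
        1 / (n * ε) ^ 2 * (∑ i, h (ω i) - n * expect p h) ^ 2 + Real.exp (-(n * ε))) := by
        refine expect_mono hlaw fun ω _ => ?_
        set s := ∑ i, h (ω i) with hs
        by_cases hc : |s - n * expect p h| ≤ n * ε
        · refine (min_le_right _ _).trans (le_add_of_nonneg_of_le (by positivity) ?_)
          calc N * Real.exp (-s) ≤ Real.exp (n * (expect p h - 2 * ε)) * Real.exp (-s) :=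
                mul_le_mul_of_nonneg_right hN (Real.exp_pos _).le
            _ ≤ _ := by
                rw [← Real.exp_add, Real.exp_le_exp]
                have := (abs_le.1 hc).1
                linarith
        · refine (min_le_left _ _).trans (le_add_of_le_of_nonneg ?_ (Real.exp_pos _).le)
          rw [one_div_mul_eq_div, le_div_iff₀ (by positivity), one_mul,
            ← sq_abs (s - n * expect p h)]
          exact pow_le_pow_left₀ (by positivity) (not_le.1 hc).le 2
    _ = _ := by
        rw [expect_add, expect_const hlaw, expect_const_mul, expect_sq_sub hp]
        field_simp

/-- The joint law of an input with law `p` and the output of the kernel `K`. -/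
def joint (p : α → ℝ) (K : α → β → ℝ) (x : α × β) : ℝ := p x.1 * K x.1 x.2

theorem expect_joint (p : α → ℝ) (K : α → β → ℝ) (G : α × β → ℝ) :
    expect (joint p K) G = expect p fun a => expect (K a) fun b => G (a, b) := by
  simp only [expect, joint, Fintype.sum_prod_type, Finset.mul_sum, mul_assoc]

theorem joint_mem {p : α → ℝ} (hp : p ∈ stdSimplex ℝ α) {K : α → β → ℝ}
    (hK : ∀ a, K a ∈ stdSimplex ℝ β) : joint p K ∈ stdSimplex ℝ (α × β) := by
  refine ⟨fun x => mul_nonneg (hp.1 _) ((hK _).1 _), ?_⟩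
  have := expect_joint p K fun _ => 1
  simp only [expect_const (hK _), expect_const hp] at this
  simpa [expect] using this

theorem expect_piLaw_joint (p : α → ℝ) (K : α → β → ℝ) {n : ℕ}
    (G : (Fin n → α) → (Fin n → β) → ℝ) :
    expect (piLaw (joint p K)) (fun ω : Fin n → α × β => G (fun i => (ω i).1) fun i => (ω i).2) =
      expect (piLaw p) fun a => expect (powKernel n K a) (G a) := by
  rw [expect, ← Equiv.sum_comp (Equiv.arrowProdEquivProdArrow (Fin n) (fun _ => α)
    (fun _ => β)).symm, Fintype.sum_prod_type]
  simp only [expect, Finset.mul_sum]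
  refine Finset.sum_congr rfl fun a _ => Finset.sum_congr rfl fun b _ => ?_
  simp only [piLaw, joint, powKernel, Equiv.arrowProdEquivProdArrow, Equiv.coe_fn_symm_mk,
    Finset.prod_mul_distrib]
  ring

/-- The log-likelihood ratio. -/
def llr (K L : S → Y → ℝ) (ω : S × Y) : ℝ := Real.log (K ω.1 ω.2) - Real.log (L ω.1 ω.2)

/-- Keeps the default `Real.log 0 = 0` out of the argument: log-likelihood ratios are exponentiated
only on the support, where all factors are positive. -/
theorem pos_of_piLaw_joint_pos {s : S → ℝ} {K : S → Y → ℝ} (hs : s ∈ stdSimplex ℝ S)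
    (hK : ∀ σ, K σ ∈ stdSimplex ℝ Y) {n : ℕ} {ω : Fin n → S × Y}
    (h : 0 < piLaw (joint s K) ω) (i : Fin n) : 0 < s (ω i).1 ∧ 0 < K (ω i).1 (ω i).2 := by
  have h1 : s (ω i).1 * K (ω i).1 (ω i).2 ≠ 0 := fun h0 =>
    h.ne' (Finset.prod_eq_zero (Finset.mem_univ i) h0)
  exact ⟨(hs.1 _).lt_of_ne' (left_ne_zero_of_mul h1),
    ((hK _).1 _).lt_of_ne' (right_ne_zero_of_mul h1)⟩

theorem exp_neg_sum_llr {n : ℕ} {K L : S → Y → ℝ} {ω : Fin n → S × Y}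
    (hK : ∀ i, 0 < K (ω i).1 (ω i).2) (hL : ∀ i, 0 < L (ω i).1 (ω i).2) :
    Real.exp (-∑ i, llr K L (ω i)) =
      powKernel n L (fun i => (ω i).1) (fun i => (ω i).2) /
        powKernel n K (fun i => (ω i).1) fun i => (ω i).2 := by
  rw [← Finset.sum_neg_distrib, Real.exp_sum, powKernel, powKernel, ← Finset.prod_div_distrib]
  refine Finset.prod_congr rfl fun i _ => ?_
  rw [llr, neg_sub, Real.exp_sub, Real.exp_log (hL i), Real.exp_log (hK i)]

/-- The weight of the event that the likelihood of the true word is small. -/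
def confusion (s : S → ℝ) (K L : S → Y → ℝ) (n : ℕ) (N : ℝ) : ℝ :=
  expect (piLaw s) fun σ : Fin n → S =>
    ∑ y, min (powKernel n K σ y) (N * powKernel n L σ y)

theorem confusion_eq {s : S → ℝ} {K L : S → Y → ℝ} (hs : s ∈ stdSimplex ℝ S)
    (hK : ∀ σ, K σ ∈ stdSimplex ℝ Y) (hL : ∀ σ y, 0 ≤ L σ y)
    (hKL : ∀ σ y, 0 < s σ → 0 < K σ y → 0 < L σ y) {n : ℕ} {N : ℝ} (hN : 0 ≤ N) :
    confusion s K L n N ≤ expect (piLaw (joint s K)) (fun ω : Fin n → S × Y =>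
      min 1 (N * Real.exp (-∑ i, llr K L (ω i)))) := by
  have hlaw := piLaw_mem (ι := Fin n) (joint_mem hs hK)
  calc confusion s K L n N = expect (piLaw s) (fun σ : Fin n → S => expect (powKernel n K σ)
        fun y => min 1 (N * (powKernel n L σ y / powKernel n K σ y))) := by
        simp only [confusion]
        congr 1
        funext σ
        refine Finset.sum_congr rfl fun y _ => ?_
        have h0 : 0 ≤ powKernel n K σ y := (powKernel_mem hK n σ).1 y
        have hl : 0 ≤ powKernel n L σ y := Finset.prod_nonneg fun _ _ => hL _ _
        rcases h0.eq_or_lt with h0 | h0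
        · rw [← h0, zero_mul, min_eq_left (mul_nonneg hN hl)]
        · rw [mul_min_of_nonneg _ _ h0.le, mul_one]
          congr 1
          field_simp
    _ = expect (piLaw (joint s K)) (fun ω : Fin n → S × Y => min 1 (N *
          (powKernel n L (fun i => (ω i).1) (fun i => (ω i).2) /
            powKernel n K (fun i => (ω i).1) fun i => (ω i).2))) :=
        (expect_piLaw_joint s K fun σ y =>
          min 1 (N * (powKernel n L σ y / powKernel n K σ y))).symm
    _ ≤ _ := by
        refine expect_mono hlaw fun ω hω => ?_
        have hpos := pos_of_piLaw_joint_pos hs hK hω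
        rw [exp_neg_sum_llr (fun i => (hpos i).2) fun i => hKL _ _ (hpos i).1 (hpos i).2]

theorem confusion_nonneg {s : S → ℝ} {K L : S → Y → ℝ} (hs : s ∈ stdSimplex ℝ S)
    (hK : ∀ σ, K σ ∈ stdSimplex ℝ Y) (hL : ∀ σ y, 0 ≤ L σ y) {n : ℕ} {N : ℝ} (hN : 0 ≤ N) :
    0 ≤ confusion s K L n N :=
  expect_nonneg (piLaw_mem hs) fun σ => Finset.sum_nonneg fun y _ =>
    le_min ((powKernel_mem hK n σ).1 y) (mul_nonneg hN (Finset.prod_nonneg fun _ _ => hL _ _))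

/-- Confusion is unlikely if the number of alternatives grows at a rate below the mean of the
log-likelihood ratio. -/
theorem tendsto_confusion {s : S → ℝ} {K L : S → Y → ℝ} (hs : s ∈ stdSimplex ℝ S)
    (hK : ∀ σ, K σ ∈ stdSimplex ℝ Y) (hL : ∀ σ y, 0 ≤ L σ y)
    (hKL : ∀ σ y, 0 < s σ → 0 < K σ y → 0 < L σ y) {N : ℕ → ℝ} (hN : ∀ n, 0 ≤ N n) {μ δ : ℝ}
    (hμ : expect (joint s K) (llr K L) = μ) (hμ0 : 0 ≤ μ) (hδ : 0 < δ)
    (hNμ : ∀ n : ℕ, N n ≤ Real.exp (n * ((1 - δ) * μ))) (hN0 : μ = 0 → ∀ n, N n = 0) :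
    Tendsto (fun n => confusion s K L n (N n)) atTop (𝓝 0) := by
  -- At mean zero the bound `exp 0 = 1` on the number of competitors gives no decay, so `hN0` has to
  -- make this number vanish exactly.
  rcases hμ0.eq_or_lt with h0 | hpos
  · refine tendsto_const_nhds.congr fun n => ?_
    rw [hN0 h0.symm, confusion]
    simp only [zero_mul]
    have : ∀ σ : Fin n → S, ∀ y, min (powKernel n K σ y) 0 = 0 := fun σ y =>
      min_eq_right ((powKernel_mem hK n σ).1 y)
    simp [this, expect]
  -- Chosen so that `(1 - δ) * μ = μ - 2 * ε`.
  · set ε := δ * μ / 2 with hε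
    have hε0 : 0 < ε := by positivity
    have hlim : Tendsto (fun n : ℕ => variance (joint s K) (llr K L) / ε ^ 2 * (1 / (n : ℝ)) +
        Real.exp (-(n * ε))) atTop (𝓝 0) := by
      have h1 := tendsto_one_div_atTop_nhds_zero_nat (𝕜 := ℝ).const_mul
        (variance (joint s K) (llr K L) / ε ^ 2)
      have h2 : Tendsto (fun n : ℕ => Real.exp (-(n * ε))) atTop (𝓝 0) :=
        Real.tendsto_exp_neg_atTop_nhds_zero.comp
          (tendsto_natCast_atTop_atTop.atTop_mul_const hε0)
      simpa using h1.add h2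
    refine tendsto_of_tendsto_of_tendsto_of_le_of_le' tendsto_const_nhds hlim
      (Eventually.of_forall fun n => confusion_nonneg hs hK hL (hN n)) ?_
    filter_upwards [eventually_gt_atTop 0] with n hn
    refine (confusion_eq hs hK hL hKL (hN n)).trans
      ((expect_min_exp_le (joint_mem hs hK) (llr K L) hn hε0 ?_).trans_eq ?_)
    · rw [hμ, hε]
      convert hNμ n using 3
      ring
    · congr 1
      field_simp

/-- The expected absolute deviation of the log-likelihood ratio. -/
theorem expect_abs_llr_le {s : S → ℝ} {K : S → Y → ℝ} (hs : s ∈ stdSimplex ℝ S)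
    (hK : ∀ σ, K σ ∈ stdSimplex ℝ Y) (g : S × Y → ℝ) {n : ℕ} (hn : 0 < n)
    {ε : ℝ} (hε : 0 < ε) (c : ℝ) :
    expect (piLaw s) (fun σ : Fin n → S => expect (powKernel n K σ) fun y =>
      |∑ i, g (σ i, y i) - c|) ≤
      n * ε + variance (joint s K) g / ε + |n * expect (joint s K) g - c| := by
  rw [← expect_piLaw_joint s K fun σ y => |∑ i, g (σ i, y i) - c|]
  exact expect_abs_sub_le (joint_mem hs hK) g hn hε c

/-- The mean of the log-likelihood ratio with respect to the output law is a mutual information. -/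
theorem sum_mul_log_div_push {q : S → ℝ} {K : S → Y → ℝ} :
    expect q (fun σ => expect (K σ) fun y => Real.log (K σ y) - Real.log (push K q y)) =
      outEnt K q - ∑ σ, q σ * rowEnt K σ := by
  simp only [expect, mul_sub, Finset.sum_sub_distrib, outEnt, rowEnt, Real.negMulLog, neg_mul,
    Finset.sum_neg_distrib, mul_neg]
  have : ∑ σ, q σ * ∑ y, K σ y * Real.log (push K q y) =
      ∑ y, push K q y * Real.log (push K q y) := by
    simp only [push, Finset.sum_mul, Finset.mul_sum]
    rw [Finset.sum_comm]
    simp only [mul_assoc]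
  rw [this]
  ring

theorem push_pos {q : S → ℝ} (hq : ∀ σ, 0 ≤ q σ) {K : S → Y → ℝ}
    (hK : ∀ σ, K σ ∈ stdSimplex ℝ Y) {σ : S} {y : Y} (h1 : 0 < q σ) (h2 : 0 < K σ y) :
    0 < push K q y :=
  (mul_pos h1 h2).trans_le (Finset.single_le_sum (f := fun σ => q σ * K σ y)
    (fun σ _ => mul_nonneg (hq σ) ((hK σ).1 y)) (Finset.mem_univ σ))

end Letters


/-! ### The random coding bound for a memoryless channel -/

section Layers

variable {T U X Y : Type*} [Fintype T] [Fintype U] [Fintype X] [Fintype Y]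

/-- The joint law of the time-sharing letter, the cloud letter and the input letter. -/
def layerLaw (PT : T → ℝ) (PU : T → U → ℝ) (PX : U → X → ℝ) : (T × U) × X → ℝ :=
  joint (joint PT PU) fun p => PX p.2

/-- The output law of `K` given the input letter. -/
def satKernel (T U : Type*) (K : X → Y → ℝ) (σ : (T × U) × X) : Y → ℝ := K σ.2

/-- The output law of `K` given the cloud letter. -/
def cloudKernel (T : Type*) (PX : U → X → ℝ) (K : X → Y → ℝ) (σ : T × U) : Y → ℝ :=
  compKernel PX K σ.2

/-- The output law of `K` given the time-sharing letter. -/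
def timeKernel (PU : T → U → ℝ) (PX : U → X → ℝ) (K : X → Y → ℝ) (σ : T × U) : Y → ℝ :=
  compKernel PU (compKernel PX K) σ.1

/-- The information `I(U; Y | T)` in nats. -/
def cloudInfo (PT : T → ℝ) (PU : T → U → ℝ) (PX : U → X → ℝ) (K : X → Y → ℝ) : ℝ :=
  ∑ t, PT t * (outEnt (compKernel PX K) (PU t) - ∑ u, PU t u * rowEnt (compKernel PX K) u)

/-- The information `I(X; Y | U, T)` in nats. -/
def satInfo (PT : T → ℝ) (PU : T → U → ℝ) (PX : U → X → ℝ) (K : X → Y → ℝ) : ℝ :=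
  ∑ t, PT t * ∑ u, PU t u * (outEnt K (PX u) - ∑ x, PX u x * rowEnt K x)

variable {PT : T → ℝ} {PU : T → U → ℝ} {PX : U → X → ℝ} {K : X → Y → ℝ}

theorem layerLaw_mem (hT : PT ∈ stdSimplex ℝ T) (hU : ∀ t, PU t ∈ stdSimplex ℝ U)
    (hX : ∀ u, PX u ∈ stdSimplex ℝ X) : layerLaw PT PU PX ∈ stdSimplex ℝ ((T × U) × X) :=
  joint_mem (joint_mem hT hU) fun p => hX p.2

theorem expect_expect (p : X → ℝ) (K : X → Y → ℝ) (F : Y → ℝ) :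
    expect p (fun x => expect (K x) F) = expect (push K p) F := by
  simp only [expect, push, Finset.mul_sum, Finset.sum_mul]
  rw [Finset.sum_comm]
  simp only [mul_assoc]

theorem expect_llr_cloud_time :
    expect (joint (joint PT PU) (cloudKernel T PX K))
      (llr (cloudKernel T PX K) (timeKernel PU PX K)) = cloudInfo PT PU PX K := by
  rw [expect_joint, expect_joint]
  exact Finset.sum_congr rfl fun t _ => congrArg (PT t * ·)
    (sum_mul_log_div_push (K := compKernel PX K) (q := PU t))

theorem expect_llr_sat_cloud :
    expect (joint (layerLaw PT PU PX) (satKernel T U K))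
      (llr (satKernel T U K) (fun σ => cloudKernel T PX K σ.1)) = satInfo PT PU PX K := by
  rw [expect_joint, layerLaw, expect_joint, expect_joint]
  exact Finset.sum_congr rfl fun t _ => congrArg (PT t * ·) <|
    Finset.sum_congr rfl fun u _ => congrArg (PU t u * ·) (sum_mul_log_div_push (K := K) (q := PX u))

/-- Averaging over the input letter given the cloud letter turns `K` into the cloud kernel, so the
finer law gives the same mean. The leakage estimate needs both likelihood ratios under this one law.
-/
theorem expect_llr_sat_law_cloud_time :
    expect (joint (layerLaw PT PU PX) (satKernel T U K))
      (llr (fun σ => cloudKernel T PX K σ.1) (fun σ => timeKernel PU PX K σ.1)) =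
        cloudInfo PT PU PX K := by
  rw [← expect_llr_cloud_time, layerLaw]
  simp only [expect_joint]
  exact Finset.sum_congr rfl fun t _ => congrArg (PT t * ·) <| Finset.sum_congr rfl fun u _ =>
    congrArg (PU t u * ·) (expect_expect (PX u) K fun y => Real.log (compKernel PX K u y) -
      Real.log (compKernel PU (compKernel PX K) t y))

theorem expect_llr_sat_time :
    expect (joint (layerLaw PT PU PX) (satKernel T U K))
      (llr (satKernel T U K) (fun σ => timeKernel PU PX K σ.1)) =
        cloudInfo PT PU PX K + satInfo PT PU PX K := by
  rw [← expect_llr_sat_law_cloud_time, ← expect_llr_sat_cloud, ← expect_add]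
  congr 1
  funext ω
  simp only [llr]
  ring

theorem layers_pos (hU : ∀ t, PU t ∈ stdSimplex ℝ U)
    (hX : ∀ u, PX u ∈ stdSimplex ℝ X) {σ : (T × U) × X} (h : 0 < layerLaw PT PU PX σ) :
    0 < PU σ.1.1 σ.1.2 ∧ 0 < PX σ.1.2 σ.2 := by
  have h1 : PT σ.1.1 * PU σ.1.1 σ.1.2 * PX σ.1.2 σ.2 ≠ 0 := h.ne'
  exact ⟨((hU _).1 _).lt_of_ne' (right_ne_zero_of_mul (left_ne_zero_of_mul h1)),
    ((hX _).1 _).lt_of_ne' (right_ne_zero_of_mul h1)⟩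

theorem cloudKernel_pos (hX : ∀ u, PX u ∈ stdSimplex ℝ X) (hK : ∀ x, K x ∈ stdSimplex ℝ Y)
    {σ : (T × U) × X} (h : 0 < PX σ.1.2 σ.2) {y : Y} (hy : 0 < satKernel T U K σ y) :
    0 < cloudKernel T PX K σ.1 y :=
  push_pos (hX _).1 hK h hy

theorem timeKernel_pos (hU : ∀ t, PU t ∈ stdSimplex ℝ U) (hX : ∀ u, PX u ∈ stdSimplex ℝ X)
    (hK : ∀ x, K x ∈ stdSimplex ℝ Y) {σ : T × U} (h : 0 < PU σ.1 σ.2) {y : Y}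
    (hy : 0 < cloudKernel T PX K σ y) : 0 < timeKernel PU PX K σ y :=
  push_pos (K := compKernel PX K) (hU _).1 (compKernel_mem hX hK) h hy

variable {n : ℕ}

theorem expect_layers (G : (Fin n → T) → (Fin n → U) → (Fin n → X) → ℝ) :
    expect (piLaw (layerLaw PT PU PX)) (fun σ : Fin n → (T × U) × X =>
      G (fun i => (σ i).1.1) (fun i => (σ i).1.2) fun i => (σ i).2) =
    expect (piLaw PT) fun t => expect (powKernel n PU t) fun u => expect (powKernel n PX u) (G t u) := by
  rw [← expect_piLaw_joint PT PU fun t u => expect (powKernel n PX u) (G t u)]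
  exact expect_piLaw_joint (joint PT PU) (fun p => PX p.2) fun p : Fin n → T × U =>
    G (fun i => (p i).1) fun i => (p i).2

theorem push_powKernel (n : ℕ) (PX : U → X → ℝ) (K : X → Y → ℝ) (u : Fin n → U) (y : Fin n → Y) :
    push (powKernel n K) (powKernel n PX u) y = powKernel n (compKernel PX K) u y :=
  (congrFun (congrFun (powKernel_compKernel n PX K) u) y).symm

theorem expect_push_powKernel (n : ℕ) (PU : T → U → ℝ) (PX : U → X → ℝ) (K : X → Y → ℝ)
    (t : Fin n → T) (y : Fin n → Y) :
    expect (powKernel n PU t) (fun u => push (powKernel n K) (powKernel n PX u) y) =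
      powKernel n (compKernel PU (compKernel PX K)) t y := by
  simp only [push_powKernel]
  exact push_powKernel n PU (compKernel PX K) t y

theorem min_add_le {x y z : ℝ} (hx : 0 ≤ x) (hy : 0 ≤ y) (hz : 0 ≤ z) :
    min x (y + z) ≤ min x y + min x z := by
  rcases min_cases x y with ⟨h1, -⟩ | ⟨h1, -⟩ <;> rcases min_cases x z with ⟨h2, -⟩ | ⟨h2, -⟩ <;>
    rw [h1, h2]
  · exact (min_le_left _ _).trans (by linarith)
  · exact (min_le_left _ _).trans (by linarith)
  · exact (min_le_left _ _).trans (by linarith)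
  · exact min_le_right _ _

/-- The two terms of the mean interference are the wrong satellites of the right cloud and the wrong
clouds. The minimum is subadditive in its second argument, and averaged codeword likelihoods are
again products over the letters. -/
theorem expect_min_meanInterference_le (hT : PT ∈ stdSimplex ℝ T) (hU : ∀ t, PU t ∈ stdSimplex ℝ U)
    (hX : ∀ u, PX u ∈ stdSimplex ℝ X) (hK : ∀ x, K x ∈ stdSimplex ℝ Y) {a b : ℕ} (ha : 1 ≤ a)
    (hb : 1 ≤ b) :
    expect (piLaw PT) (fun t => ∑ y, expect (powKernel n PU t) fun u => expect (powKernel n PX u)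
      fun x => min (powKernel n K x y) (meanInterference (powKernel n PU t) (powKernel n PX)
        (fun x => powKernel n K x y) a b u)) ≤
    confusion (layerLaw PT PU PX) (satKernel T U K) (fun σ => cloudKernel T PX K σ.1) n (b - 1) +
      confusion (layerLaw PT PU PX) (satKernel T U K) (fun σ => timeKernel PU PX K σ.1) n
        ((a - 1) * b) := by
  have ha' : (0 : ℝ) ≤ a - 1 := sub_nonneg.2 (by exact_mod_cast ha)
  have hb' : (0 : ℝ) ≤ b - 1 := sub_nonneg.2 (by exact_mod_cast hb)
  have hPu := compKernel_mem hX hK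
  have hPt := compKernel_mem hU hPu
  simp only [← expect_sum]
  rw [← expect_layers fun t u x => ∑ y, min (powKernel n K x y) (meanInterference (powKernel n PU t)
    (powKernel n PX) (fun x => powKernel n K x y) a b u), confusion, confusion, ← expect_add]
  refine expect_mono (piLaw_mem (layerLaw_mem hT hU hX)) fun σ _ => ?_
  rw [← Finset.sum_add_distrib]
  refine Finset.sum_le_sum fun y _ => ?_
  have e1 : ∀ u, expect (powKernel n PX u) (fun x => powKernel n K x y) =
      powKernel n (compKernel PX K) u y := fun u => push_powKernel n PX K u y
  have e2 : ∀ t, expect (powKernel n PU t) (fun u => powKernel n (compKernel PX K) u y) =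
      powKernel n (compKernel PU (compKernel PX K)) t y := fun t =>
    push_powKernel n PU (compKernel PX K) t y
  rw [meanInterference]
  simp only [e1, e2]
  exact min_add_le ((powKernel_mem hK n _).1 y)
    (mul_nonneg hb' ((powKernel_mem hPu n _).1 y))
    (mul_nonneg (mul_nonneg ha' (Nat.cast_nonneg b)) ((powKernel_mem hPt n _).1 y))

theorem expect_min_push (N : ℝ) :
    expect (piLaw PT) (fun t => ∑ y, expect (powKernel n PU t) fun u =>
      min (push (powKernel n K) (powKernel n PX u) y)
        (N * expect (powKernel n PU t) fun u => push (powKernel n K) (powKernel n PX u) y)) =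
    confusion (joint PT PU) (cloudKernel T PX K) (timeKernel PU PX K) n N := by
  simp only [← expect_sum, expect_push_powKernel]
  simp only [push_powKernel]
  exact (expect_piLaw_joint PT PU fun t u => ∑ y, min (powKernel n (compKernel PX K) u y)
    (N * powKernel n (compKernel PU (compKernel PX K)) t y)).symm

theorem sum_negMulLog_add_expect (pU : U → ℝ) (pX : U → X → ℝ) (C : X → Y → ℝ)
    (c : Y → U → ℝ) :
    ∑ z, Real.negMulLog (expect pU fun u => push C (pX u) z) +
        ∑ z, expect pU (fun u => expect (pX u) fun x => C x z * Real.log (C x z + c z u)) =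
      expect pU fun u => expect (pX u) fun x => expect (C x) fun z =>
        Real.log (C x z + c z u) - Real.log (expect pU fun u => push C (pX u) z) := by
  rw [← Finset.sum_add_distrib]
  have : ∀ z, Real.negMulLog (expect pU fun u => push C (pX u) z) =
      expect pU fun u => expect (pX u) fun x =>
        C x z * -Real.log (expect pU fun u => push C (pX u) z) := by
    intro z
    simp only [expect_mul_const]
    rw [Real.negMulLog, neg_mul_comm]
    rfl
  simp only [this, ← expect_add, ← expect_sum]
  congr 1; funext u; congr 1; funext x
  exact Finset.sum_congr rfl fun z _ => by ring

theorem log_add_le {x y m : ℝ} (hx : 0 < x) (hy : 0 < y) (hm : 0 < m) :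
    Real.log (x + y + m) - Real.log m ≤ Real.log 3 + |Real.log x - Real.log m| +
      |Real.log y - Real.log m| := by
  set c := |Real.log x - Real.log m| + |Real.log y - Real.log m| with hc
  have key : ∀ w : ℝ, 0 < w → Real.log w - Real.log m ≤ c → w ≤ m * Real.exp c := by
    intro w hw h
    rw [← Real.log_le_log_iff hw (by positivity), Real.log_mul hm.ne' (Real.exp_pos c).ne',
      Real.log_exp]
    linarith
  have h1 := key x hx ((le_abs_self _).trans (le_add_of_nonneg_right (abs_nonneg _)))
  have h2 := key y hy ((le_abs_self _).trans (le_add_of_nonneg_left (abs_nonneg _)))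
  have h3 := key m hm (by rw [sub_self]; positivity)
  have h4 : Real.log (x + y + m) ≤ Real.log (3 * (m * Real.exp c)) :=
    Real.log_le_log (by positivity) (by linarith)
  rw [Real.log_mul (by norm_num) (by positivity), Real.log_mul hm.ne' (Real.exp_pos c).ne',
    Real.log_exp] at h4
  linarith

/-- All three summands are compared with `a * b * t`. The first exceeds it by the amount `log (x /
t) - log (a * b)`, the second by `log (u / t) - log a`. Hence the local randomness should have total
rate `I(X; Z | T)`, with `I(U; Z | T)` in the clouds. -/
theorem log_interference_le {x u t a b : ℝ} (hx : 0 < x) (hu : 0 < u) (ht : 0 < t) (ha : 1 ≤ a)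
    (hb : 1 ≤ b) :
    Real.log (x + ((b - 1) * u + (a - 1) * b * t)) - Real.log t ≤
      |Real.log x - Real.log t - Real.log (a * b)| + |Real.log u - Real.log t - Real.log a| +
        (Real.log 3 + Real.log (a * b)) := by
  have ha0 : 0 < a := by linarith
  have hb0 : 0 < b := by linarith
  have h := log_add_le hx (mul_pos hb0 hu) (mul_pos (mul_pos ha0 hb0) ht)
  have hm : Real.log (x + ((b - 1) * u + (a - 1) * b * t)) ≤ Real.log (x + b * u + a * b * t) := by
    refine Real.log_le_log ?_ ?_
    · have := mul_nonneg (sub_nonneg.2 hb) hu.le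
      have := mul_nonneg (mul_nonneg (sub_nonneg.2 ha) hb0.le) ht.le
      linarith
    · have := mul_pos hb0 ht
      linarith
  have e1 : Real.log x - Real.log (a * b * t) = Real.log x - Real.log t - Real.log (a * b) := by
    rw [Real.log_mul (by positivity) ht.ne']
    ring
  have e2 : Real.log (b * u) - Real.log (a * b * t) = Real.log u - Real.log t - Real.log a := by
    rw [Real.log_mul (by positivity) ht.ne', Real.log_mul ha0.ne' hb0.ne', Real.log_mul hb0.ne' hu.ne']
    ring
  rw [e1, e2] at h
  have e3 : Real.log (a * b * t) = Real.log (a * b) + Real.log t :=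
    Real.log_mul (by positivity) ht.ne'
  linarith

theorem log_powKernel {S : Type*} {L : S → Y → ℝ} {σ : Fin n → S} {y : Fin n → Y}
    (h : ∀ i, 0 < L (σ i) (y i)) :
    Real.log (powKernel n L σ y) = ∑ i, Real.log (L (σ i) (y i)) :=
  Real.log_prod fun i _ => (h i).ne'

theorem expect_le_of_le_add {p G F₁ F₂ : Y → ℝ} (hp : p ∈ stdSimplex ℝ Y) {r : ℝ}
    (h : ∀ y, 0 < p y → G y ≤ F₁ y + F₂ y + r) : expect p G ≤ expect p F₁ + expect p F₂ + r := by
  rw [← expect_add, ← expect_const hp r, ← expect_add]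
  simpa only [expect_const hp] using expect_mono hp h

/-- The output entropy and the conditional term combine into the expected logarithm of the codebook
output over the product law, to which `log_interference_le` applies. Absolute deviations are good
enough because the sizes of the local randomness will be matched to the information of the
eavesdropper. -/
theorem expect_leak_le (hT : PT ∈ stdSimplex ℝ T) (hU : ∀ t, PU t ∈ stdSimplex ℝ U)
    (hX : ∀ u, PX u ∈ stdSimplex ℝ X) (hK : ∀ x, K x ∈ stdSimplex ℝ Y) {a b : ℕ} (ha : 1 ≤ a)
    (hb : 1 ≤ b) (hn : 0 < n) {ε : ℝ} (hε : 0 < ε) :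
    expect (piLaw PT) (fun t => ∑ z, Real.negMulLog (expect (powKernel n PU t) fun u =>
        push (powKernel n K) (powKernel n PX u) z) - Real.log (a * b) +
      ∑ z, expect (powKernel n PU t) fun u => expect (powKernel n PX u) fun x =>
        powKernel n K x z * Real.log (powKernel n K x z + meanInterference (powKernel n PU t)
          (powKernel n PX) (fun x => powKernel n K x z) a b u)) ≤
    (n * ε + variance (joint (layerLaw PT PU PX) (satKernel T U K))
        (llr (satKernel T U K) (fun σ => timeKernel PU PX K σ.1)) / ε +
        |n * (cloudInfo PT PU PX K + satInfo PT PU PX K) - Real.log (a * b)|) +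
      (n * ε + variance (joint (layerLaw PT PU PX) (satKernel T U K))
        (llr (fun σ => cloudKernel T PX K σ.1) (fun σ => timeKernel PU PX K σ.1)) / ε +
        |n * cloudInfo PT PU PX K - Real.log a|) + Real.log 3 := by
  have ha' : (1 : ℝ) ≤ a := by exact_mod_cast ha
  have hb' : (1 : ℝ) ≤ b := by exact_mod_cast hb
  have hS := layerLaw_mem hT hU hX
  have hsat : ∀ σ, satKernel T U K σ ∈ stdSimplex ℝ Y := fun σ => hK _
  rw [← expect_llr_sat_time, ← expect_llr_sat_law_cloud_time]
  refine le_trans ?_ (add_le_add (add_le_add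
    (expect_abs_llr_le hS hsat _ hn hε _) (expect_abs_llr_le hS hsat _ hn hε _))
    (le_refl (Real.log 3)))
  have e1 : ∀ u z, expect (powKernel n PX u) (fun x => powKernel n K x z) =
      powKernel n (compKernel PX K) u z := fun u z => push_powKernel n PX K u z
  have e2 : ∀ t z, expect (powKernel n PU t) (fun u => powKernel n (compKernel PX K) u z) =
      powKernel n (compKernel PU (compKernel PX K)) t z := fun t z =>
    push_powKernel n PU (compKernel PX K) t z
  have e3 := expect_layers (PT := PT) (PU := PU) (PX := PX) (n := n) fun t u x =>
    expect (powKernel n K x) fun z => Real.log (powKernel n K x z + meanInterference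
      (powKernel n PU t) (powKernel n PX) (fun x => powKernel n K x z) a b u) -
        Real.log (powKernel n (compKernel PU (compKernel PX K)) t z)
  have e4 : ∀ t : Fin n → T, ∑ z, Real.negMulLog (expect (powKernel n PU t) fun u =>
        push (powKernel n K) (powKernel n PX u) z) - Real.log (a * b) +
      ∑ z, expect (powKernel n PU t) (fun u => expect (powKernel n PX u) fun x =>
        powKernel n K x z * Real.log (powKernel n K x z + meanInterference (powKernel n PU t)
          (powKernel n PX) (fun x => powKernel n K x z) a b u)) =
      expect (powKernel n PU t) (fun u => expect (powKernel n PX u) fun x =>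
        expect (powKernel n K x) fun z => Real.log (powKernel n K x z + meanInterference
          (powKernel n PU t) (powKernel n PX) (fun x => powKernel n K x z) a b u) -
        Real.log (powKernel n (compKernel PU (compKernel PX K)) t z)) - Real.log (a * b) := by
    intro t
    rw [sub_add_eq_add_sub, sum_negMulLog_add_expect]
    simp only [expect_push_powKernel]
  simp only [e4]
  rw [expect_sub, expect_const (piLaw_mem (ι := Fin n) hT), ← e3, sub_le_iff_le_add,
    add_assoc _ (Real.log 3)]
  refine expect_le_of_le_add (piLaw_mem hS) fun σ hσ =>
    expect_le_of_le_add (powKernel_mem hsat n σ) fun z hz => ?_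
  have hσ' : ∀ i, 0 < layerLaw PT PU PX (σ i) := fun i =>
    (hS.1 _).lt_of_ne' fun h0 => hσ.ne' (Finset.prod_eq_zero (Finset.mem_univ i) h0)
  have h1 : ∀ i, 0 < satKernel T U K (σ i) (z i) := fun i =>
    ((hsat _).1 _).lt_of_ne' fun h0 => hz.ne' (Finset.prod_eq_zero (Finset.mem_univ i) h0)
  have h2 : ∀ i, 0 < cloudKernel T PX K (σ i).1 (z i) := fun i =>
    cloudKernel_pos hX hK (layers_pos hU hX (hσ' i)).2 (h1 i)
  have h3 : ∀ i, 0 < timeKernel PU PX K (σ i).1 (z i) := fun i =>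
    timeKernel_pos hU hX hK (layers_pos hU hX (hσ' i)).1 (h2 i)
  have l1 := log_powKernel h1
  have l2 := log_powKernel h2
  have l3 := log_powKernel h3
  have p2 : 0 < powKernel n (fun p : (T × U) × X => cloudKernel T PX K p.1) σ z :=
    Finset.prod_pos fun i _ => h2 i
  have p3 : 0 < powKernel n (fun p : (T × U) × X => timeKernel PU PX K p.1) σ z :=
    Finset.prod_pos fun i _ => h3 i
  simp only [llr, Finset.sum_sub_distrib]
  rw [← l1, ← l2, ← l3, meanInterference]
  simp only [e1, e2]
  change Real.log (powKernel n (satKernel T U K) σ z +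
    ((b - 1) * powKernel n (fun p : (T × U) × X => cloudKernel T PX K p.1) σ z +
      (a - 1) * b * powKernel n (fun p : (T × U) × X => timeKernel PU PX K p.1) σ z)) -
      Real.log (powKernel n (fun p : (T × U) × X => timeKernel PU PX K p.1) σ z) ≤ _
  exact log_interference_le hz p2 p3 ha' hb'

end Layers


/-! ### Existence of superposition codes and achievability of the region. -/

section RandomCoding

variable {T U X Y₁ Y₂ Z : Type*} [Fintype T] [Fintype U] [Fintype X] [Fintype Y₁] [Fintype Y₂]
  [Fintype Z] {PT : T → ℝ} {PU : T → U → ℝ} {PX : U → X → ℝ}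

/-- The deviation of the logarithmic size of the local randomness from the information that the
eavesdropper can obtain. -/
def leakBound (PT : T → ℝ) (PU : T → U → ℝ) (PX : U → X → ℝ) (C : X → Z → ℝ) (n : ℕ) (ε a b : ℝ) :
    ℝ :=
  (n * ε + variance (joint (layerLaw PT PU PX) (satKernel T U C))
      (llr (satKernel T U C) (fun σ => timeKernel PU PX C σ.1)) / ε +
      |n * (cloudInfo PT PU PX C + satInfo PT PU PX C) - Real.log (a * b)|) +
    (n * ε + variance (joint (layerLaw PT PU PX) (satKernel T U C))
      (llr (fun σ => cloudKernel T PX C σ.1) (fun σ => timeKernel PU PX C σ.1)) / ε +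
      |n * cloudInfo PT PU PX C - Real.log a|) + Real.log 3

/-- The time-sharing word is fixed by averaging the sum of the error and leakage bounds; a codebook
is then chosen for this word. There are `M₂ * a * l` clouds with `b * l'` satellites each, where `l`
and `l'` count the local randomness. -/
theorem exists_code (W : Channel X (Y₁ × Y₂ × Z)) (hT : PT ∈ stdSimplex ℝ T)
    (hU : ∀ t, PU t ∈ stdSimplex ℝ U) (hX : ∀ u, PX u ∈ stdSimplex ℝ X) {M₂ a b l l' n : ℕ}
    (h₂ : 0 < M₂) (ha : 0 < a) (hb : 0 < b) (hl : 0 < l) (hl' : 0 < l') (hn : 0 < n) {ε : ℝ}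
    (hε : 0 < ε) :
    ∃ c : Code X Y₁ Y₂ (a * b) M₂ n, c.errorProb W + c.leakage W / n * Real.log 2 ≤
      confusion (layerLaw PT PU PX) (satKernel T U W.toY₁)
          (fun σ => cloudKernel T PX W.toY₁ σ.1) n ((b * l' : ℕ) - 1) +
        confusion (layerLaw PT PU PX) (satKernel T U W.toY₁)
          (fun σ => timeKernel PU PX W.toY₁ σ.1) n (((M₂ * a * l : ℕ) - 1) * (b * l' : ℕ)) +
        confusion (joint PT PU) (cloudKernel T PX W.toY₂) (timeKernel PU PX W.toY₂) n
          ((M₂ * a * l : ℕ) - 1) +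
        1 / n * leakBound PT PU PX W.toZ n ε l l' := by
  classical
  have : NeZero M₂ := ⟨h₂.ne'⟩
  have : NeZero a := ⟨ha.ne'⟩
  have : NeZero b := ⟨hb.ne'⟩
  have : NeZero l := ⟨hl.ne'⟩
  have : NeZero l' := ⟨hl'.ne'⟩
  have hn' : (0 : ℝ) < n := by exact_mod_cast hn
  have hI : 1 ≤ M₂ * a * l := Nat.mul_pos (Nat.mul_pos h₂ ha) hl
  have hJ : 1 ≤ b * l' := Nat.mul_pos hb hl'
  have b1 := expect_min_meanInterference_le (n := n) hT hU hX (toY₁_mem W) hI hJ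
  have b2 := expect_min_push (n := n) (PT := PT) (PU := PU) (PX := PX) (K := W.toY₂)
    ((M₂ * a * l : ℕ) - 1)
  have b3 := mul_le_mul_of_nonneg_left (expect_leak_le hT hU hX (toZ_mem W) hl hl' hn hε)
    (one_div_nonneg.2 hn'.le)
  rw [← expect_const_mul] at b3
  have b4 := add_le_add (add_le_add b1 b2.le) b3
  rw [← expect_add, ← expect_add] at b4
  obtain ⟨t, ht⟩ := exists_le_expect (piLaw_mem (ι := Fin n) hT) _
  have ht := ht.trans b4
  obtain ⟨cb, d₁, d₂, h⟩ := exists_codebook (V := Fin M₂ × Fin a) (V' := Fin b) (L := Fin l)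
    (L' := Fin l') (powKernel_mem hU n t) (powKernel_mem hX n) (powKernel_mem (toY₁_mem W) n)
    (powKernel_mem (toY₂_mem W) n) (powKernel_mem (toZ_mem W) n) (one_div_nonneg.2 hn'.le)
  refine ⟨codebookCode hl hl' cb d₁ d₂, ?_⟩
  have he := codebookCode_errorProb_le hl hl' cb d₁ d₂ W
  have hlog : Real.log 2 ≠ 0 := (Real.log_pos one_lt_two).ne'
  have hle : (codebookCode hl hl' cb d₁ d₂).leakage W / n * Real.log 2 =
      1 / n * codebookLeak (powKernel n W.toZ) cb := by
    rw [codebookCode_leakage hl hl' cb d₁ d₂ W h₂ ha hb]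
    field_simp
  rw [hle]
  have c1 : Fintype.card ((Fin M₂ × Fin a) × Fin l) = M₂ * a * l := by simp
  have c2 : Fintype.card (Fin b × Fin l') = b * l' := by simp
  simp only [c1, c2, Fintype.card_fin] at h he
  exact (add_le_add_left he _).trans (h.trans ht)

/-- The number of codewords of length `n` at rate `r`, in nats. -/
def rateSize (r : ℝ) (n : ℕ) : ℕ := ⌊Real.exp (n * r)⌋₊

/-- Exactly one codeword at rate zero, hence no competitors at all: the degenerate case of
`tendsto_confusion`. -/
theorem rateSize_zero (n : ℕ) : rateSize 0 n = 1 := by simp [rateSize]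

theorem rateSize_le (r : ℝ) (n : ℕ) : (rateSize r n : ℝ) ≤ Real.exp (n * r) :=
  Nat.floor_le (Real.exp_pos _).le

theorem rateSize_pos {r : ℝ} (hr : 0 ≤ r) (n : ℕ) : 0 < rateSize r n :=
  Nat.floor_pos.2 (Real.one_le_exp (by positivity))

theorem log_rateSize_le {r : ℝ} (hr : 0 ≤ r) (n : ℕ) : Real.log (rateSize r n) ≤ n * r := by
  rw [Real.log_le_iff_le_exp (by exact_mod_cast rateSize_pos hr n)]
  exact rateSize_le r n

theorem le_log_rateSize {r : ℝ} (hr : 0 ≤ r) (n : ℕ) :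
    n * r - Real.log 2 ≤ Real.log (rateSize r n) := by
  have h1 : (1 : ℝ) ≤ rateSize r n := by exact_mod_cast rateSize_pos hr n
  have h2 : Real.exp (n * r) < rateSize r n + 1 := Nat.lt_floor_add_one _
  rw [sub_le_iff_le_add, ← Real.log_mul (by positivity) two_ne_zero,
    Real.le_log_iff_exp_le (by positivity)]
  linarith

theorem rateSize_mul_le {r r' q : ℝ} (h : r + r' ≤ q) (n : ℕ) :
    ((rateSize r n * rateSize r' n : ℕ) : ℝ) ≤ Real.exp (n * q) := by
  push_cast
  calc _ ≤ Real.exp (n * r) * Real.exp (n * r') :=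
        mul_le_mul (rateSize_le r n) (rateSize_le r' n) (Nat.cast_nonneg _) (Real.exp_pos _).le
    _ ≤ _ := by
        rw [← Real.exp_add, ← mul_add]
        exact Real.exp_le_exp.2 (mul_le_mul_of_nonneg_left h (Nat.cast_nonneg n))

theorem rateSize_mul_mul_le {r r' r'' q : ℝ} (h : r + r' + r'' ≤ q) (n : ℕ) :
    ((rateSize r n * rateSize r' n * rateSize r'' n : ℕ) : ℝ) ≤ Real.exp (n * q) := by
  rw [Nat.cast_mul]
  calc _ ≤ Real.exp (n * (r + r')) * Real.exp (n * r'') :=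
        mul_le_mul (rateSize_mul_le le_rfl n) (rateSize_le r'' n) (Nat.cast_nonneg _)
          (Real.exp_pos _).le
    _ ≤ _ := by
        rw [← Real.exp_add, ← mul_add]
        exact Real.exp_le_exp.2 (mul_le_mul_of_nonneg_left h (Nat.cast_nonneg n))

theorem leakBound_rateSize_le (PT : T → ℝ) (PU : T → U → ℝ) (PX : U → X → ℝ) (C : X → Z → ℝ)
    {μ ν : ℝ} (hμ : cloudInfo PT PU PX C = μ) (hν : satInfo PT PU PX C = ν) (hμ0 : 0 ≤ μ)
    (hν0 : 0 ≤ ν) {δ : ℝ} (hδ0 : 0 ≤ δ) (hδ1 : δ ≤ 1) (ε : ℝ) :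
    ∃ c : ℝ, ∀ n : ℕ, 0 < n → 1 / n * leakBound PT PU PX C n ε (rateSize ((1 - δ) * μ) n)
      (rateSize ((1 - δ) * ν) n) ≤ 2 * ε + δ * (2 * μ + ν) + c * (1 / n) := by
  have hδ : 0 ≤ 1 - δ := by linarith
  have hμ' := mul_nonneg hδ hμ0
  have hν' := mul_nonneg hδ hν0
  -- `3 * Real.log 2` collects the losses from rounding down: two sizes in the first deviation, one
  -- in the second. The term `δ * (2 * μ + ν)` arises in the same way from `μ + ν` and `μ`.
  refine ⟨variance (joint (layerLaw PT PU PX) (satKernel T U C))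
      (llr (satKernel T U C) (fun σ => timeKernel PU PX C σ.1)) / ε +
    variance (joint (layerLaw PT PU PX) (satKernel T U C))
      (llr (fun σ => cloudKernel T PX C σ.1) (fun σ => timeKernel PU PX C σ.1)) / ε +
    3 * Real.log 2 + Real.log 3, fun n hn => ?_⟩
  have hn' : (0 : ℝ) < n := by exact_mod_cast hn
  have l1 := log_rateSize_le hμ' n
  have l2 := le_log_rateSize hμ' n
  have l3 := log_rateSize_le hν' n
  have l4 := le_log_rateSize hν' n
  have p1 : (rateSize ((1 - δ) * μ) n : ℝ) ≠ 0 := by exact_mod_cast (rateSize_pos hμ' n).ne'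
  have p2 : (rateSize ((1 - δ) * ν) n : ℝ) ≠ 0 := by exact_mod_cast (rateSize_pos hν' n).ne'
  have q1 : 0 ≤ n * (δ * μ) := by positivity
  have q2 : 0 ≤ n * (δ * ν) := by positivity
  have hlog := Real.log_pos one_lt_two
  rw [leakBound, hμ, hν, Real.log_mul p1 p2, abs_of_nonneg (by linarith),
    abs_of_nonneg (by linarith), one_div_mul_eq_div, div_le_iff₀ hn']
  have e : ∀ x c : ℝ, (x + c * (1 / n)) * n = n * x + c := fun x c => by field_simp
  rw [e]
  linarith

theorem sub_le_logb_div {r ε δ m : ℝ} {n : ℕ} (hn : 0 < n) (hε : 0 < ε) (hr : δ * r ≤ ε / 8)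
    (hn2 : 2 * (1 / (n : ℝ)) ≤ ε / 8)
    (h : n * ((1 - δ) * (r * Real.log 2)) - 2 * Real.log 2 ≤ Real.log m) :
    r - ε ≤ Real.logb 2 m / n := by
  have hlog := Real.log_pos one_lt_two
  have hn' : (0 : ℝ) < n := by exact_mod_cast hn
  rw [Real.logb, div_div, le_div_iff₀ (by positivity)]
  rw [mul_one_div, div_le_iff₀ hn'] at hn2
  have h1 : n * (δ * r) ≤ n * (ε / 8) := mul_le_mul_of_nonneg_left hr hn'.le
  have h2 : n * (r - ε) ≤ n * ((1 - δ) * r) - 2 := by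
    have := mul_pos hn' hε
    linarith
  have := mul_le_mul_of_nonneg_right h2 hlog.le
  linarith

set_option maxHeartbeats 800000 in
/-- Rate pairs in the superposition coding region are achievable. -/
theorem isAchievable_of_layers [Nonempty X] (W : Channel X (Y₁ × Y₂ × Z))
    (hT : PT ∈ stdSimplex ℝ T) (hU : ∀ t, PU t ∈ stdSimplex ℝ U)
    (hX : ∀ u, PX u ∈ stdSimplex ℝ X) {R : ℝ × ℝ} (h₁ : 0 ≤ R.1) (h₂ : 0 ≤ R.2)
    (hμ : 0 ≤ cloudInfo PT PU PX W.toZ) (hν : 0 ≤ satInfo PT PU PX W.toZ)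
    (hBA : cloudInfo PT PU PX W.toY₂ ≤ cloudInfo PT PU PX W.toY₁)
    (hCA : satInfo PT PU PX W.toZ ≤ satInfo PT PU PX W.toY₁)
    (hR₂ : R.2 * Real.log 2 ≤ cloudInfo PT PU PX W.toY₂ - cloudInfo PT PU PX W.toZ)
    (hR : (R.1 + R.2) * Real.log 2 ≤ cloudInfo PT PU PX W.toY₂ - cloudInfo PT PU PX W.toZ +
      (satInfo PT PU PX W.toY₁ - satInfo PT PU PX W.toZ)) : IsAchievable W R := by
  refine isAchievable_of_hasApproxCode h₁ h₂ fun ε₀ hε₀ => ?_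
  have hlog := Real.log_pos one_lt_two
  have hlog' : (1 : ℝ) / 2 < Real.log 2 := by linarith [Real.log_two_gt_d9]
  -- Rate splitting: the clouds take as much of the first message as user 2 leaves room for, and the
  -- satellites carry the rest. This is why only `R₂` and the sum rate are constrained.
  obtain ⟨rc, rp, hrc, hrp, hr, hrcB, hrpA⟩ : ∃ rc rp : ℝ, 0 ≤ rc ∧ 0 ≤ rp ∧
      rc + rp = R.1 * Real.log 2 ∧ R.2 * Real.log 2 + rc + cloudInfo PT PU PX W.toZ ≤
        cloudInfo PT PU PX W.toY₂ ∧ rp + satInfo PT PU PX W.toZ ≤ satInfo PT PU PX W.toY₁ := by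
    refine ⟨min (R.1 * Real.log 2) (cloudInfo PT PU PX W.toY₂ - cloudInfo PT PU PX W.toZ -
      R.2 * Real.log 2), R.1 * Real.log 2 - min (R.1 * Real.log 2) (cloudInfo PT PU PX W.toY₂ -
        cloudInfo PT PU PX W.toZ - R.2 * Real.log 2), le_min (by positivity) (by linarith),
      sub_nonneg.2 (min_le_left _ _), by ring, ?_, ?_⟩
    · linarith [min_le_right (R.1 * Real.log 2) (cloudInfo PT PU PX W.toY₂ -
        cloudInfo PT PU PX W.toZ - R.2 * Real.log 2)]
    · rcases min_cases (R.1 * Real.log 2) (cloudInfo PT PU PX W.toY₂ -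
        cloudInfo PT PU PX W.toZ - R.2 * Real.log 2) with ⟨h, -⟩ | ⟨h, -⟩ <;> rw [h] <;> linarith
  set r₂ := R.2 * Real.log 2 with hr₂def
  have hr₂ : 0 ≤ r₂ := by positivity
  generalize hμC : cloudInfo PT PU PX W.toZ = μC at *
  generalize hνC : satInfo PT PU PX W.toZ = νC at *
  generalize hμB : cloudInfo PT PU PX W.toY₂ = μB at *
  generalize hμA : cloudInfo PT PU PX W.toY₁ = μA at *
  generalize hνA : satInfo PT PU PX W.toY₁ = νA at *
  set k := 2 * μC + νC + R.1 + R.2 with hk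
  have hk0 : 0 ≤ k := by positivity
  -- All quantities that `δ` will multiply are collected in `k`; adding `ε₀` keeps the denominator
  -- positive when `k = 0`.
  set δ := ε₀ / (8 * (ε₀ + k)) with hδ
  have hδ0 : 0 < δ := by positivity
  have hδk : δ * k ≤ ε₀ / 8 := by
    rw [hδ, div_mul_eq_mul_div, div_le_div_iff₀ (by positivity) (by norm_num)]
    nlinarith [mul_pos hε₀ hε₀]
  have hδ1 : δ ≤ 1 := by
    rw [hδ, div_le_one (by positivity)]
    linarith
  have hs : 0 ≤ 1 - δ := by linarith
  have smul : ∀ {x y : ℝ}, x ≤ y → (1 - δ) * x ≤ (1 - δ) * y := fun h =>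
    mul_le_mul_of_nonneg_left h hs
  obtain ⟨c, hc⟩ := leakBound_rateSize_le PT PU PX W.toZ hμC hνC hμ hν hδ0.le hδ1 (ε₀ / 16)
  let M₂ := rateSize ((1 - δ) * r₂)
  let a := rateSize ((1 - δ) * rc)
  let b := rateSize ((1 - δ) * rp)
  let l := rateSize ((1 - δ) * μC)
  let l' := rateSize ((1 - δ) * νC)
  have pM₂ : ∀ n, 0 < M₂ n := rateSize_pos (mul_nonneg hs hr₂)
  have pa : ∀ n, 0 < a n := rateSize_pos (mul_nonneg hs hrc)
  have pb : ∀ n, 0 < b n := rateSize_pos (mul_nonneg hs hrp)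
  have pl : ∀ n, 0 < l n := rateSize_pos (mul_nonneg hs hμ)
  have pl' : ∀ n, 0 < l' n := rateSize_pos (mul_nonneg hs hν)
  have hI : ∀ n, (1 : ℝ) ≤ (M₂ n * a n * l n : ℕ) := fun n => by
    exact_mod_cast Nat.mul_pos (Nat.mul_pos (pM₂ n) (pa n)) (pl n)
  have hJ : ∀ n, (1 : ℝ) ≤ (b n * l' n : ℕ) := fun n => by
    exact_mod_cast Nat.mul_pos (pb n) (pl' n)
  have hIe : ∀ n : ℕ, ((M₂ n * a n * l n : ℕ) : ℝ) ≤ Real.exp (n * ((1 - δ) * μB)) := fun n =>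
    rateSize_mul_mul_le (by rw [← mul_add, ← mul_add]; exact smul hrcB) n
  have hJe : ∀ n : ℕ, ((b n * l' n : ℕ) : ℝ) ≤ Real.exp (n * ((1 - δ) * νA)) := fun n =>
    rateSize_mul_le (by rw [← mul_add]; exact smul hrpA) n
  -- If the clouds have no capacity, all three rates in them are zero and there is a single cloud.
  have hI0 : μB = 0 → ∀ n, ((M₂ n * a n * l n : ℕ) : ℝ) - 1 = 0 := fun h n => by
    have z1 : r₂ = 0 := by linarith
    have z2 : rc = 0 := by linarith
    have z3 : μC = 0 := by linarith
    simp [M₂, a, l, z1, z2, z3, rateSize_zero]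
  have hJ0 : νA = 0 → ∀ n, ((b n * l' n : ℕ) : ℝ) - 1 = 0 := fun h n => by
    have z2 : rp = 0 := by linarith
    have z3 : νC = 0 := by linarith
    simp [b, l', z2, z3, rateSize_zero]
  have hS := layerLaw_mem hT hU hX
  have hA := toY₁_mem W
  have hB := toY₂_mem W
  -- `t1`: user 1 confuses satellites of the right cloud. `t2`: user 1 takes a wrong cloud, where
  -- `μB ≤ μA` is needed. `t3`: user 2 takes a wrong cloud.
  have t1 := tendsto_confusion (K := satKernel T U W.toY₁)
    (L := fun σ => cloudKernel T PX W.toY₁ σ.1) hS (fun σ => hA _)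
    (fun σ y => (compKernel_mem hX hA _).1 y)
    (fun σ y h h' => cloudKernel_pos hX hA (layers_pos hU hX h).2 h')
    (N := fun n => (b n * l' n : ℕ) - 1) (fun n => sub_nonneg.2 (hJ n))
    (expect_llr_sat_cloud.trans hνA) (hν.trans hCA) hδ0
    (fun n => (sub_le_self _ zero_le_one).trans (hJe n)) hJ0
  have t2 := tendsto_confusion (K := satKernel T U W.toY₁)
    (L := fun σ => timeKernel PU PX W.toY₁ σ.1) hS (fun σ => hA _)
    (fun σ y => (compKernel_mem hU (compKernel_mem hX hA) _).1 y)
    (fun σ y h h' => timeKernel_pos hU hX hA (layers_pos hU hX h).1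
      (cloudKernel_pos hX hA (layers_pos hU hX h).2 h'))
    (N := fun n => ((M₂ n * a n * l n : ℕ) - 1) * (b n * l' n : ℕ))
    (fun n => mul_nonneg (sub_nonneg.2 (hI n)) (Nat.cast_nonneg _))
    (expect_llr_sat_time.trans (by rw [hμA, hνA])) (by linarith) hδ0
    (fun n => by
      calc _ ≤ Real.exp (n * ((1 - δ) * μB)) * Real.exp (n * ((1 - δ) * νA)) :=
            mul_le_mul ((sub_le_self _ zero_le_one).trans (hIe n)) (hJe n) (Nat.cast_nonneg _)
              (Real.exp_pos _).le
        _ ≤ _ := by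
            rw [← Real.exp_add, ← mul_add, ← mul_add]
            exact Real.exp_le_exp.2 (mul_le_mul_of_nonneg_left (smul (by linarith))
              (Nat.cast_nonneg n)))
    (fun h n => by rw [hI0 (by linarith) n, zero_mul])
  have t3 := tendsto_confusion (K := cloudKernel T PX W.toY₂) (L := timeKernel PU PX W.toY₂)
    (joint_mem hT hU) (fun σ => compKernel_mem hX hB _)
    (fun σ y => (compKernel_mem hU (compKernel_mem hX hB) _).1 y)
    (fun σ y h h' => timeKernel_pos hU hX hB (((hU _).1 _).lt_of_ne'
      (right_ne_zero_of_mul h.ne')) h')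
    (N := fun n => (M₂ n * a n * l n : ℕ) - 1) (fun n => sub_nonneg.2 (hI n))
    (expect_llr_cloud_time.trans hμB) (by linarith) hδ0
    (fun n => (sub_le_self _ zero_le_one).trans (hIe n)) hI0
  have t4 : Tendsto (fun n : ℕ => c * (1 / (n : ℝ))) atTop (𝓝 0) := by
    simpa using tendsto_one_div_atTop_nhds_zero_nat (𝕜 := ℝ).const_mul c
  have t5 : Tendsto (fun n : ℕ => 2 * (1 / (n : ℝ))) atTop (𝓝 0) := by
    simpa using tendsto_one_div_atTop_nhds_zero_nat (𝕜 := ℝ).const_mul 2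
  have hε8 : (0 : ℝ) < ε₀ / 8 := by positivity
  filter_upwards [((t1.add t2).add t3).eventually_le_const (u := ε₀ / 8) (by simpa using hε8),
    t4.eventually_le_const hε8, t5.eventually_le_const hε8, eventually_gt_atTop 0]
    with n u1 u2 u3 hn
  have hn' : (0 : ℝ) < n := by exact_mod_cast hn
  obtain ⟨code, hcode⟩ := exists_code W hT hU hX (pM₂ n) (pa n) (pb n) (pl n) (pl' n) hn
    (ε := ε₀ / 16) (by positivity)
  have hM₁ : 0 < a n * b n := Nat.mul_pos (pa n) (pb n)
  have hδk' : δ * (2 * μC + νC) + δ * (R.1 + R.2) ≤ ε₀ / 8 := by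
    rw [← mul_add]
    convert hδk using 2
    rw [hk]
    ring
  have hδR₁ := mul_nonneg hδ0.le h₁
  have hδR₂ := mul_nonneg hδ0.le h₂
  have hδμ : 0 ≤ δ * (2 * μC + νC) := by positivity
  have hcn := hc n hn
  have herr := errorProb_nonneg code W
  have hleak : 0 ≤ code.leakage W / n := div_nonneg (code.leakage_nonneg W hM₁ (pM₂ n)) hn'.le
  -- Four contributions of `ε₀ / 8`: the confusions, `2 * (ε₀ / 16)`, the `δ`-term and `c / n`. The
  -- total `ε₀ / 2` leaves room for `Real.log 2 > 1 / 2` when the leakage is isolated.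
  have hsum : code.errorProb W + code.leakage W / n * Real.log 2 ≤ ε₀ / 2 := by
    refine hcode.trans ?_
    have : δ * (R.1 + R.2) = δ * R.1 + δ * R.2 := mul_add _ _ _
    linarith
  refine ⟨a n * b n, M₂ n, code, hM₁, pM₂ n, ?_, ?_, ?_, ?_⟩
  · refine sub_le_logb_div hn hε₀ (δ := δ) (by linarith [mul_add δ R.1 R.2]) u3 ?_
    have g1 := le_log_rateSize (mul_nonneg hs hrc) n
    have g2 := le_log_rateSize (mul_nonneg hs hrp) n
    have g3 : (n : ℝ) * ((1 - δ) * rc) + n * ((1 - δ) * rp) =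
        n * ((1 - δ) * (R.1 * Real.log 2)) := by
      rw [← hr]
      ring
    rw [Nat.cast_mul, Real.log_mul (by exact_mod_cast (pa n).ne') (by exact_mod_cast (pb n).ne')]
    change _ ≤ Real.log (rateSize ((1 - δ) * rc) n) + Real.log (rateSize ((1 - δ) * rp) n)
    linarith
  · refine sub_le_logb_div hn hε₀ (δ := δ) (by linarith [mul_add δ R.1 R.2]) u3 ?_
    have g1 := le_log_rateSize (mul_nonneg hs hr₂) n
    change _ ≤ Real.log (rateSize ((1 - δ) * r₂) n)
    linarith
  · have := mul_nonneg hleak hlog.le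
    linarith
  · have : code.leakage W / n * (1 / 2) ≤ code.leakage W / n * Real.log 2 :=
      mul_le_mul_of_nonneg_left hlog'.le hleak
    linarith

end RandomCoding


/-! ### The secrecy capacity region -/

section Informations

variable {T U X Y Y' : Type*} [Fintype T] [Fintype U] [Fintype X] [Fintype Y] [Fintype Y']
  {PT : T → ℝ} {PU : T → U → ℝ} {PX : U → X → ℝ} {K : X → Y → ℝ} {L : X → Y' → ℝ}

theorem sum_mul_rowEnt_le (hK : ∀ x, K x ∈ stdSimplex ℝ Y) {p : X → ℝ}
    (hp : p ∈ stdSimplex ℝ X) : ∑ x, p x * rowEnt K x ≤ outEnt K p := by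
  simp only [rowEnt, outEnt, Finset.mul_sum]
  rw [Finset.sum_comm]
  exact Finset.sum_le_sum fun y _ => sum_negMulLog_le hp fun x => (hK x).1 y

theorem cloudInfo_nonneg (hT : PT ∈ stdSimplex ℝ T) (hU : ∀ t, PU t ∈ stdSimplex ℝ U)
    (hX : ∀ u, PX u ∈ stdSimplex ℝ X) (hK : ∀ x, K x ∈ stdSimplex ℝ Y) :
    0 ≤ cloudInfo PT PU PX K :=
  Finset.sum_nonneg fun t _ => mul_nonneg (hT.1 t)
    (sub_nonneg.2 (sum_mul_rowEnt_le (compKernel_mem hX hK) (hU t)))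

theorem satInfo_nonneg (hT : PT ∈ stdSimplex ℝ T) (hU : ∀ t, PU t ∈ stdSimplex ℝ U)
    (hX : ∀ u, PX u ∈ stdSimplex ℝ X) (hK : ∀ x, K x ∈ stdSimplex ℝ Y) :
    0 ≤ satInfo PT PU PX K :=
  Finset.sum_nonneg fun t _ => mul_nonneg (hT.1 t) <| Finset.sum_nonneg fun u _ =>
    mul_nonneg ((hU t).1 u) (sub_nonneg.2 (sum_mul_rowEnt_le hK (hX u)))

theorem outEnt_compKernel (PX : U → X → ℝ) (K : X → Y → ℝ) (p : U → ℝ) :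
    outEnt (compKernel PX K) p = outEnt K (∑ u, p u • PX u) := by
  simp only [outEnt, push_compKernel]
  congr! 3
  funext x
  simp [push]

theorem rowEnt_compKernel (PX : U → X → ℝ) (K : X → Y → ℝ) (u : U) :
    rowEnt (compKernel PX K) u = outEnt K (PX u) := rfl

theorem cloudInfo_sub (hK : ∀ x, K x ∈ stdSimplex ℝ Y) (hL : ∀ x, L x ∈ stdSimplex ℝ Y') :
    cloudInfo PT PU PX K - cloudInfo PT PU PX L =
      ∑ t, (entDiff K L (∑ u, (PT t * PU t u) • PX u) -
        ∑ u, entDiff K L ((PT t * PU t u) • PX u)) := by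
  rw [cloudInfo, cloudInfo, ← Finset.sum_sub_distrib]
  refine Finset.sum_congr rfl fun t _ => ?_
  simp only [mul_smul, ← Finset.smul_sum, entDiff_smul hK hL, ← Finset.mul_sum,
    outEnt_compKernel]
  simp only [entDiff, mul_sub, Finset.sum_sub_distrib]
  simp only [rowEnt_compKernel]
  ring

theorem satInfo_sub (hK : ∀ x, K x ∈ stdSimplex ℝ Y) (hL : ∀ x, L x ∈ stdSimplex ℝ Y') :
    satInfo PT PU PX K - satInfo PT PU PX L =
      ∑ t, ∑ u, infoDiff K L ((PT t * PU t u) • PX u) := by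
  rw [satInfo, satInfo, ← Finset.sum_sub_distrib]
  refine Finset.sum_congr rfl fun t _ => ?_
  simp only [infoDiff_smul hK hL, mul_assoc, ← Finset.mul_sum]
  rw [← mul_sub, ← Finset.sum_sub_distrib]
  congr 1
  refine Finset.sum_congr rfl fun u _ => ?_
  simp only [infoDiff, mul_sub, Finset.sum_sub_distrib]
  ring

theorem cloudInfo_le (hT : PT ∈ stdSimplex ℝ T) (hU : ∀ t, PU t ∈ stdSimplex ℝ U)
    (hX : ∀ u, PX u ∈ stdSimplex ℝ X) (hK : ∀ x, K x ∈ stdSimplex ℝ Y)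
    (hL : ∀ x, L x ∈ stdSimplex ℝ Y') (h : OutSuperadd K L) :
    cloudInfo PT PU PX L ≤ cloudInfo PT PU PX K := by
  rw [← sub_nonneg, cloudInfo_sub hK hL]
  exact Finset.sum_nonneg fun t _ => sub_nonneg.2 (h.sum (fun u x =>
    mul_nonneg (mul_nonneg (hT.1 t) ((hU t).1 u)) ((hX u).1 x)) Finset.univ)

theorem satInfo_le (hT : PT ∈ stdSimplex ℝ T) (hU : ∀ t, PU t ∈ stdSimplex ℝ U)
    (hX : ∀ u, PX u ∈ stdSimplex ℝ X) (hK : ∀ x, K x ∈ stdSimplex ℝ Y)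
    (hL : ∀ x, L x ∈ stdSimplex ℝ Y') (h : OutSuperadd K L) :
    satInfo PT PU PX L ≤ satInfo PT PU PX K := by
  rw [← sub_nonneg, satInfo_sub hK hL]
  refine Finset.sum_nonneg fun t _ => Finset.sum_nonneg fun u _ => ?_
  -- For a one-point auxiliary variable the left side vanishes, so that `infoDiff` is nonnegative.
  simpa using entDiff_sub_sum_le_infoDiff hK hL h
    (m := fun _ : Unit => (PT t * PU t u) • PX u) fun _ x =>
      mul_nonneg (mul_nonneg (hT.1 t) ((hU t).1 u)) ((hX u).1 x)

end Informations

/-! ### The capacity region and the cascade channel. -/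

section Capacity

variable {X Y₁ Y₂ Z : Type*} [Fintype X] [Fintype Y₁] [Fintype Y₂] [Fintype Z]

theorem nonempty_of_mem_stdSimplex {α : Type*} [Fintype α] {p : α → ℝ}
    (hp : p ∈ stdSimplex ℝ α) : Nonempty α := by
  by_contra h
  rw [not_nonempty_iff] at h
  have := hp.2
  simp at this

theorem IsAchievable.nonempty {W : Channel X (Y₁ × Y₂ × Z)} {R : ℝ × ℝ} (h : IsAchievable W R) :
    Nonempty X := by
  obtain ⟨-, -, M₁, M₂, c, hM, -⟩ := h
  -- Length one rather than zero, since the empty word exists over an empty alphabet too.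
  obtain ⟨x⟩ := nonempty_of_mem_stdSimplex
    ((c 1).enc.mem_simplex (⟨0, (hM 1).1⟩, ⟨0, (hM 1).2⟩))
  exact ⟨x 0⟩

/-- The secrecy capacity region only depends on the marginals, and it is the single-letter region
of any channel with the same marginals in which `Z` is produced from `Y₁` by `Q`. -/
theorem secrecyCapacityRegion_eq {W V : Channel X (Y₁ × Y₂ × Z)} {Q : Channel Y₁ Z}
    (hless : IsLessNoisy W.toY₁ W.toY₂) (hdeg : IsDegradedThrough W.toZ W.toY₁ Q)
    (e₁ : V.toY₁ = W.toY₁) (e₂ : V.toY₂ = W.toY₂) (e₃ : V.toZ = W.toZ)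
    (hQ : ∀ x y₁ z, V.toY₁Z x y₁ z = V.toY₁ x y₁ * Q.prob y₁ z) :
    secrecyCapacityRegion W = singleLetterRegion V := by
  have hA := toY₁_mem W
  have hB := toY₂_mem W
  have hC := toZ_mem W
  -- Every point of the single-letter region is itself achievable; the closure matters only for the
  -- converse, where closedness of `rateRegion` absorbs it.
  refine Set.Subset.antisymm ?_ fun R hR => subset_closure ?_
  · refine (closure_minimal (fun R hR => ?_) (isClosed_rateRegion W.toY₁ W.toY₂ W.toZ)).trans ?_
    · have := IsAchievable.nonempty hR
      exact IsAchievable.mem_rateRegion hless hdeg hR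
    · have := rateRegion_subset_singleLetterRegion V Q hQ
      rwa [e₁, e₂, e₃] at this
  · obtain ⟨h₁, h₂, kT, kU, PT, PU, PX, hT, hR₂, hR⟩ := (mem_singleLetterRegion_iff V Q hQ R).1 hR
    have hU := PU.mem_simplex
    have hX := PX.mem_simplex
    obtain ⟨t⟩ := nonempty_of_mem_stdSimplex hT
    obtain ⟨u⟩ := nonempty_of_mem_stdSimplex (hU t)
    have := nonempty_of_mem_stdSimplex (hX u)
    have hAC : W.toZ = compKernel W.toY₁ Q.prob := funext fun x => funext fun z => hdeg x z
    have hsup : OutSuperadd W.toY₁ W.toZ := hAC ▸ outSuperadd_compKernel hA Q.mem_simplex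
    rw [e₂, e₃] at hR₂ hR
    rw [e₁] at hR
    simp only [auxMass_eq_smul, ← cloudInfo_sub hB hC, ← satInfo_sub hA hC] at hR₂ hR
    exact isAchievable_of_layers W hT hU hX h₁ h₂ (cloudInfo_nonneg hT hU hX hC)
      (satInfo_nonneg hT hU hX hC) (cloudInfo_le hT hU hX hA hB (hless.outSuperadd hA hB))
      (satInfo_le hT hU hX hA hC hsup) hR₂ hR

variable (W : Channel X (Y₁ × Y₂ × Z)) (Q : Channel Y₁ Z)

theorem toY₁_cascade : (W.cascade Q).toY₁ = W.toY₁ := by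
  funext x y
  simp only [Channel.toY₁, Channel.cascade, Channel.toY₁Y₂, ← Finset.mul_sum, (Q.mem_simplex _).2,
    mul_one]

theorem toY₂_cascade : (W.cascade Q).toY₂ = W.toY₂ := by
  funext x y
  simp only [Channel.toY₂, Channel.cascade, Channel.toY₁Y₂, ← Finset.mul_sum, (Q.mem_simplex _).2,
    mul_one]

theorem toY₁Z_cascade (x : X) (y₁ : Y₁) (z : Z) :
    (W.cascade Q).toY₁Z x y₁ z = (W.cascade Q).toY₁ x y₁ * Q.prob y₁ z := by
  rw [toY₁_cascade]
  simp only [Channel.toY₁Z, Channel.cascade, Channel.toY₁, Channel.toY₁Y₂, ← Finset.sum_mul]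

theorem isDegradedThrough_of_toY₁Z {Q : Channel Y₁ Z}
    (hQ : ∀ x y₁ z, W.toY₁Z x y₁ z = W.toY₁ x y₁ * Q.prob y₁ z) :
    IsDegradedThrough W.toZ W.toY₁ Q := fun x z => by
  simp only [← hQ]
  rfl

theorem toZ_cascade (hdeg : IsDegradedThrough W.toZ W.toY₁ Q) : (W.cascade Q).toZ = W.toZ := by
  funext x z
  rw [hdeg x z, isDegradedThrough_of_toY₁Z _ (toY₁Z_cascade W Q) x z, toY₁_cascade]

end Capacity

end

end WiretapBC


theorem mainTheorem5 {X : Type*} {Y₁ : Type*} {Y₂ : Type*} {Z : Type*}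
    [Fintype X] [Fintype Y₁] [Fintype Y₂] [Fintype Z]
    (W : WiretapBC.Channel X (Y₁ × Y₂ × Z)) (Q : WiretapBC.Channel Y₁ Z)
    (hless : WiretapBC.IsLessNoisy W.toY₁ W.toY₂)
    (hdeg : WiretapBC.IsDegradedThrough W.toZ W.toY₁ Q) :
    WiretapBC.secrecyCapacityRegion W = WiretapBC.singleLetterRegion (W.cascade Q) ∧
    (W.IsMarkov →
      WiretapBC.secrecyCapacityRegion W = WiretapBC.singleLetterRegion W) := by
  refine ⟨WiretapBC.secrecyCapacityRegion_eq hless hdeg (WiretapBC.toY₁_cascade W Q)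
    (WiretapBC.toY₂_cascade W Q) (WiretapBC.toZ_cascade W Q hdeg)
    (WiretapBC.toY₁Z_cascade W Q), ?_⟩
  -- `Q'` also degrades `Z` from `Y₁`, so the channel itself can replace the cascade.
  rintro ⟨Q', hQ'⟩
  exact WiretapBC.secrecyCapacityRegion_eq hless
    (WiretapBC.isDegradedThrough_of_toY₁Z W hQ') rfl rfl rfl hQ'
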